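/- Write $D=-i\partial_x$, let $S(t)=e^{itD^2}$ be the Schrödinger group on $L^2(\mathbb R)$ (so that $v(t)=S(t)v_0$ solves $iv_t-v_{xx}=0$), and consider right continuous bounded functions $u:\mathbb R\to L^2(\mathbb R;\mathbb C)$. For a one-parameter group $G$ on $L^2(\mathbb R)$ (either $G=S$ or $G=\mathrm{Id}$), an atom is a function $a=\sum_k 1_{[t_k,t_{k+1})}(t)\,G(t)f_k$ with $(t_k)$ an increasing sequence in $[-\infty,\infty]$ and $\sum_k\|f_k\|_{L^2}^2=1$. Let $\|u\|_{U^2_G}$ be the infimum of $\sum_j|c_j|$ over all representations $u=\sum_j c_ja_j$ with atoms $a_j$, and let $$\|u\|_{V^2_G}^2=\sup_t\|u(t)\|_{L^2}^2+\sup_{t_0\le t_1\le\dots\le t_n}\ \sum_{k<n}\|G(-t_k)u(t_k)-G(-t_{k+1})u(t_{k+1})\|_{L^2}^2 .$$ Write $U^2_\Delta,V^2_\Delta$ for $G=S$ and $U^2,V^2$ for $G=\mathrm{Id}$. Fix $m\in C^\infty(\mathbb R;\mathbb R)$ with $m=1$ on $[-1,1]$ and $m=0$ outside $(-2,2)$.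 Let $Q_{\le N}$ be the space-time Fourier multiplier with symbol $m((\tau-\xi^2)/N)$ and $Q_{\ge N}=1-Q_{\le N}$. For $\lambda\ge1$ set $$\|u\|_{U^2_\lambda}^2=\|Q_{\le\lambda^2}u\|_{U^2_\Delta}^2+\sum_{I,J}\|\chi_I(t)\chi_J(x)Q_{\ge\lambda^2}u\|_{U^2}^2,\qquad \|u\|_{V^2_\lambda}^2=\|Q_{\le\lambda^2}u\|_{V^2_\Delta}^2+\sum_{I,J}\|\chi_I(t)\chi_J(x)Q_{\ge\lambda^2}u\|_{V^2}^2,$$ where $I$ and $J$ run over the intervals $[k\lambda^{-2},(k+1)\lambda^{-2})$ and $[j\lambda^{-1},(j+1)\lambda^{-1})$, $k,j\in\mathbb Z$. All these norms take values in $[0,\infty]$. For $\lambda\in\{1,2,4,\dots\}$, a function $u$ as above is said to be at frequency $\lambda$ if for every $t$ the spatial Fourier transform of $u(t)$ is supported in $\{\lambda/2\le|\xi|\le2\lambda\}$ (in $\{|\xi|\le2\}$ if $\lambda=1$). **Proposition.** There are constants $K$ and $C$, depending only on the cutoff $m$, such that for all dyadic $\lambda,\mu\in\{1,2,4,\dots\}$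 with $K\lambda\le\mu$, every interval $I\subset\mathbb R$ of length $1$, every $u_\lambda$ at frequency $\lambda$ and every $v_\mu$ at frequency $\mu$, $$\|\chi_I(t)\,u_\lambda v_\mu\|_{L^2(\mathbb R\times\mathbb R)}\le C\,\mu^{-1/2}\,\ln(1+\lambda)\,\|u_\lambda\|_{V^2_\lambda}\,\|v_\mu\|_{U^2_\mu}.$$ (For $\lambda\ge2$ the factor $\ln(1+\lambda)$ is comparable to $\ln\lambda$, so that the logarithmic loss is in the low frequency only.) -/

import Mathlib

open MeasureTheory
open scoped ENNReal NNReal FourierTransform ContDiff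

noncomputable section

namespace NLS

/-- The complex Hilbert space `L²(ℝ)` in the space variable. -/
abbrev L2 : Type := Lp ℂ 2 (volume : Measure ℝ)

/-! ### The Schrödinger group and frequency localization

Mathlib's Fourier transform is `𝓕 f ξ = ∫ exp(-2πixξ) f(x) dx`, so that the frequency in the sense of
`D = -i ∂ₓ` is `2πξ`. -/

theorem memLp_phase (t : ℝ) (f : L2) :
    MemLp (fun ξ : ℝ ↦ Complex.exp (Complex.I * ((t * (2 * Real.pi * ξ) ^ 2 : ℝ) : ℂ)) * f ξ)
      2 volume := by
  refine (Lp.memLp f).congr_norm ?_ ?_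
  · exact (Continuous.aestronglyMeasurable (by fun_prop)).mul (Lp.aestronglyMeasurable f)
  · refine Filter.Eventually.of_forall fun ξ ↦ ?_
    rw [norm_mul, mul_comm Complex.I, Complex.norm_exp_ofReal_mul_I, one_mul]

/-- The Schrödinger group `exp(i t D²)` on `L²(ℝ)`, `D = -i ∂ₓ`: the Fourier multiplier with symbol
`exp(i t η²)`, `η` the angular frequency. The solution of `i vₜ - vₓₓ = 0`, `v(0) = f` is
`v(t) = schrodinger t f`. -/
def schrodinger (t : ℝ) (f : L2) : L2 :=
  𝓕⁻ ((memLp_phase t (𝓕 f : L2)).toLp _ : L2)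

/-- The trivial group, used for the spaces `U²` and `V²` without the subscript `Δ`. -/
def trivialFlow (_t : ℝ) (f : L2) : L2 := f

/-- `f ∈ L²(ℝ)` is localized at the (dyadic) frequency `lam`: its Fourier transform is supported in
`lam / 2 ≤ |η| ≤ 2 lam` if `lam > 1`, and in `|η| ≤ 2` if `lam = 1` (inhomogeneous decomposition). -/
def FreqLocalized (lam : ℝ) (f : L2) : Prop :=
  ∀ᵐ ξ : ℝ, ¬ (|2 * Real.pi * ξ| ≤ 2 * lam ∧ (lam = 1 ∨ lam / 2 ≤ |2 * Real.pi * ξ|)) →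
    (𝓕 f : L2) ξ = 0

/-- Right continuous functions `u : ℝ → L²(ℝ)` in `L^∞_t L²_x`, localized at spatial frequency
`lam` at all times. -/
structure AtFrequency (lam : ℝ) (u : ℝ → L2) : Prop where
  right_continuous : ∀ t : ℝ, ContinuousWithinAt u (Set.Ici t) t
  bounded : ∃ M : ℝ, ∀ t : ℝ, ‖u t‖ ≤ M
  localized : ∀ t : ℝ, FreqLocalized lam (u t)

/-! ### The spaces `U²` and `V²` along a flow `G` -/

/-- `U²` atoms along `G`: piecewise free evolutions `a = ∑ₖ 1_{[tₖ, tₖ₊₁)} G(s) fₖ` with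
`∑ₖ ‖fₖ‖² = 1`. The sequence is indexed by `ℤ` and takes values in `[-∞, ∞]`; as repetitions are
allowed, this includes finite and one-sided sequences. -/
def IsU2Atom (G : ℝ → L2 → L2) (a : ℝ → L2) : Prop :=
  ∃ (τ : ℤ → EReal) (f : ℤ → L2), Monotone τ ∧ HasSum (fun k ↦ ‖f k‖ ^ 2) 1 ∧
    (∀ (k : ℤ) (s : ℝ), τ k ≤ (s : EReal) → (s : EReal) < τ (k + 1) → a s = G s (f k)) ∧
    (∀ s : ℝ, (∀ k : ℤ, ¬ (τ k ≤ (s : EReal) ∧ (s : EReal) < τ (k + 1))) → a s = 0)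

/-- The atomic norm: the infimum of `∑ⱼ |cⱼ|` over all representations `u = ∑ⱼ cⱼ aⱼ` with atoms
`aⱼ`; it is `∞` if there is no representation with a finite sum. As `‖aⱼ(t)‖ ≤ 1` for the flows used
here, the series then converges in `L²` uniformly in `t`. -/
def normU2 (G : ℝ → L2 → L2) (u : ℝ → L2) : ℝ≥0∞ :=
  ⨅ (c : ℕ → ℂ) (a : ℕ → ℝ → L2)
    (_ : (∀ j, IsU2Atom G (a j)) ∧ ∀ t : ℝ, HasSum (fun j ↦ c j • a j t) (u t)), ∑' j, ‖c j‖ₑ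

/-- The norm of `V²` along `G`:
`‖u‖² = sup_t ‖u(t)‖² + sup ∑ₖ ‖G(-tₖ) u(tₖ) - G(-tₖ₊₁) u(tₖ₊₁)‖²`, where the second supremum is
over all increasing sequences of times. -/
def normV2 (G : ℝ → L2 → L2) (u : ℝ → L2) : ℝ≥0∞ :=
  ((⨆ t : ℝ, ‖u t‖ₑ) ^ 2 +
    ⨆ (n : ℕ) (τ : ℕ → ℝ) (_ : Monotone τ),
      ∑ k ∈ Finset.range n, ‖G (-τ k) (u (τ k)) - G (-τ (k + 1)) (u (τ (k + 1)))‖ₑ ^ 2) ^ (1 / 2 : ℝ)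

/-! ### Modulation projections -/

/-- Smooth cutoffs, equal to `1` on `[-1, 1]` and supported in `[-2, 2]`. -/
structure IsCutoff (m : ℝ → ℝ) : Prop where
  smooth : ContDiff ℝ ∞ m
  eq_one : ∀ x : ℝ, |x| ≤ 1 → m x = 1
  eq_zero : ∀ x : ℝ, 2 ≤ |x| → m x = 0

/-- The inverse Fourier transform `(2π)⁻¹ ∫ m(σ / N) exp(i s σ) dσ` of the symbol `m(· / N)`. -/
def modKernel (m : ℝ → ℝ) (N s : ℝ) : ℂ :=
  (2 * Real.pi : ℂ)⁻¹ * ∫ σ : ℝ, (m (σ / N) : ℂ) * Complex.exp (Complex.I * ((s * σ : ℝ) : ℂ))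

/-- The projection `Q_{≤ N}` to modulations `|τ - ξ²| ≲ N`, that is the space-time Fourier multiplier
with symbol `m((τ - ξ²) / N)`. After conjugation with the Schrödinger group it is the convolution in
time with `modKernel m N`. -/
def Qlow (m : ℝ → ℝ) (N : ℝ) (u : ℝ → L2) (t : ℝ) : L2 :=
  ∫ s : ℝ, modKernel m N s • schrodinger s (u (t - s))

/-- The complementary projection `Q_{≥ N} = 1 - Q_{≤ N}`. -/
def Qhigh (m : ℝ → ℝ) (N : ℝ) (u : ℝ → L2) (t : ℝ) : L2 :=
  u t - Qlow m N u t

/-! ### The spaces `U²_λ` and `V²_λ` -/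

/-- Multiplication of `f ∈ L²(ℝ)` by the characteristic function of the interval `[a, b)`. -/
def spaceCut (a b : ℝ) (f : L2) : L2 :=
  ((Lp.memLp f).indicator (measurableSet_Ico (a := a) (b := b))).toLp _

/-- The truncation `χ_I(t) χ_J(x) w` to the grid rectangle with
`I = [k lam⁻², (k+1) lam⁻²)` and `J = [j lam⁻¹, (j+1) lam⁻¹)`. -/
def rectCut (lam : ℝ) (k j : ℤ) (w : ℝ → L2) : ℝ → L2 :=
  (Set.Ico (k / lam ^ 2) ((k + 1) / lam ^ 2)).indicator
    fun t ↦ spaceCut (j / lam) ((j + 1) / lam) (w t)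

/-- The norm of `U²_λ`. -/
def normU2At (m : ℝ → ℝ) (lam : ℝ) (u : ℝ → L2) : ℝ≥0∞ :=
  (normU2 schrodinger (Qlow m (lam ^ 2) u) ^ 2 +
    ∑' (k : ℤ) (j : ℤ), normU2 trivialFlow (rectCut lam k j (Qhigh m (lam ^ 2) u)) ^ 2) ^ (1 / 2 : ℝ)

/-- The norm of `V²_λ`. -/
def normV2At (m : ℝ → ℝ) (lam : ℝ) (u : ℝ → L2) : ℝ≥0∞ :=
  (normV2 schrodinger (Qlow m (lam ^ 2) u) ^ 2 +
    ∑' (k : ℤ) (j : ℤ), normV2 trivialFlow (rectCut lam k j (Qhigh m (lam ^ 2) u)) ^ 2) ^ (1 / 2 : ℝ)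

/-- The norm `‖χ_I u v‖` in `L²(ℝ × ℝ)` of the (unconjugated) pointwise product, cut off to times in `I`. -/
def normL2Prod (I : Set ℝ) (u v : ℝ → L2) : ℝ≥0∞ :=
  (∫⁻ t in I, ∫⁻ x : ℝ, ‖u t x * v t x‖ₑ ^ 2) ^ (1 / 2 : ℝ)

end NLS

end

/-! Split `u v` into three products: low modulation of `u` times low modulation of `v`, high
modulation of `u` times low modulation of `v`, and `u` times high modulation of `v`. Each gains
`μ^{-1/2}` for its own reason, and only the first loses a logarithm.

Low times low. For two free waves the spatial Fourier transform of the product at `ξ` is an integral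
over `η` whose time phase has `η`-derivative of size at least a multiple of `μ`, because `λ` is much
smaller than `μ`; Plancherel in time then gains `μ^{-1}` in the squared norm
(`lintegral_freqMul_schrodinger_le`). Bounds for free waves pass to `U²`, as an atom is free on each
piece and the squares add up (`FreeBound.normU2_le`). This settles `v`. The factor `u` is only in
`V²`, which does not embed in `U²`. Its profile `w(t) = S(-t) Q_{≤λ²} u(t)` is telescoped along
dyadic time grids of a unit interval. Each difference of consecutive grid approximations is
piecewise free with `ℓ²` norm at most the `V²` norm. About `2 log₂ λ` scales are coarser than
`λ^{-2}` and cost a constant each; on finer scales the band limitation of `w` gives geometric decay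
(`Reproduced.tsum_sub_le`). The number of coarse scales is the logarithm
(`FreeBound.logarithmic_loss`).

High times low. On a strip of width `λ^{-1}`, local smoothing bounds `v` in `L²` by `λ^{-1/2}
μ^{-1/2}`, and the local Bernstein inequality bounds `u` pointwise by `λ^{1/2}` times norms on
nearby rectangles, with square summable total (`lintegral_freqMul_high_low_le`).

Right factor high. The rectangles of `v` have time length `μ^{-2}`, so the high part of `v` has `L²`
norm at most `μ^{-1}`; Bernstein for `u` costs `λ^{1/2} ≤ μ^{1/2}` (`eLpNorm_right_high_le`).

The local smoothing and bilinear bounds rest on `lintegral_oscillatory_le`, a form of Plancherel for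
phases that push the underlying measure to at most `A` times Lebesgue measure. -/

noncomputable section

namespace NLS

/-! ### Multipliers -/

/-- Measurable symbols bounded by `1`. -/
structure UnitSymbol where
  toFun : ℝ → ℂ
  measurable : Measurable toFun
  norm_le : ∀ x, ‖toFun x‖ ≤ 1

theorem memLp_symbol_mul (σ : UnitSymbol) (f : L2) :
    MemLp (fun x ↦ σ.toFun x * f x) 2 volume := by
  refine (Lp.memLp f).mono (σ.measurable.aestronglyMeasurable.mul (Lp.aestronglyMeasurable f)) ?_
  refine Filter.Eventually.of_forall fun x ↦ ?_
  rw [norm_mul]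
  exact mul_le_of_le_one_left (norm_nonneg _) (σ.norm_le x)

/-- Pointwise multiplication with a symbol. -/
def mulOp (σ : UnitSymbol) : L2 →L[ℂ] L2 :=
  LinearMap.mkContinuous
    { toFun := fun f ↦ (memLp_symbol_mul σ f).toLp _
      map_add' := fun f g ↦ by
        rw [← MemLp.toLp_add]
        refine MemLp.toLp_congr _ _ ?_
        filter_upwards [Lp.coeFn_add f g] with x hx
        simp only [Pi.add_apply, hx, mul_add]
      map_smul' := fun c f ↦ by
        rw [RingHom.id_apply, ← MemLp.toLp_const_smul]
        refine MemLp.toLp_congr _ _ ?_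
        filter_upwards [Lp.coeFn_smul c f] with x hx
        simp only [Pi.smul_apply, hx, smul_eq_mul, mul_left_comm] } 1 fun f ↦ by
    rw [one_mul]
    refine Lp.norm_le_norm_of_ae_le ?_
    filter_upwards [(memLp_symbol_mul σ f).coeFn_toLp] with x hx
    change ‖((memLp_symbol_mul σ f).toLp _ : L2) x‖ ≤ _
    rw [hx, norm_mul]
    exact mul_le_of_le_one_left (norm_nonneg _) (σ.norm_le x)

theorem coeFn_mulOp (σ : UnitSymbol) (f : L2) :
    mulOp σ f =ᵐ[volume] fun x ↦ σ.toFun x * f x :=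
  (memLp_symbol_mul σ f).coeFn_toLp

theorem norm_mulOp_le (σ : UnitSymbol) (f : L2) : ‖mulOp σ f‖ ≤ ‖f‖ := by
  refine Lp.norm_le_norm_of_ae_le ?_
  filter_upwards [coeFn_mulOp σ f] with x hx
  rw [hx, norm_mul]
  exact mul_le_of_le_one_left (norm_nonneg _) (σ.norm_le x)

theorem mulOp_eq_of_ae {σ : UnitSymbol} {f g : L2}
    (h : g =ᵐ[volume] fun x ↦ σ.toFun x * f x) : mulOp σ f = g :=
  Lp.ext ((coeFn_mulOp σ f).trans h.symm)

/-- The Fourier multiplier with a given symbol (as a function of `ξ`, in Mathlib's normalisation). -/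
def fourierMult (σ : UnitSymbol) : L2 →L[ℂ] L2 :=
  ((Lp.fourierTransformₗᵢ ℝ ℂ).symm.toContinuousLinearEquiv : L2 →L[ℂ] L2) ∘L mulOp σ ∘L
    ((Lp.fourierTransformₗᵢ ℝ ℂ).toContinuousLinearEquiv : L2 →L[ℂ] L2)

theorem fourierMult_apply (σ : UnitSymbol) (f : L2) :
    fourierMult σ f = 𝓕⁻ (mulOp σ (𝓕 f : L2) : L2) := rfl

theorem fourier_fourierMult (σ : UnitSymbol) (f : L2) :
    (𝓕 (fourierMult σ f) : L2) = mulOp σ (𝓕 f : L2) := by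
  rw [fourierMult_apply, FourierTransform.fourier_fourierInv_eq]

theorem norm_fourierInv_eq (f : L2) : ‖(𝓕⁻ f : L2)‖ = ‖f‖ :=
  (Lp.fourierTransformₗᵢ ℝ ℂ).symm.norm_map f

theorem norm_fourierMult_le (σ : UnitSymbol) (f : L2) : ‖fourierMult σ f‖ ≤ ‖f‖ := by
  rw [fourierMult_apply, norm_fourierInv_eq, ← Lp.norm_fourier_eq f]
  exact norm_mulOp_le σ _

theorem fourier_injective {f g : L2} (h : (𝓕 f : L2) = (𝓕 g : L2)) : f = g :=
  (Lp.fourierTransformₗᵢ ℝ ℂ).injective h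

theorem mulOp_comp (σ₁ σ₂ σ₃ : UnitSymbol) (h : ∀ x, σ₁.toFun x * σ₂.toFun x = σ₃.toFun x) (f : L2) :
    mulOp σ₁ (mulOp σ₂ f) = mulOp σ₃ f := by
  refine mulOp_eq_of_ae ?_
  filter_upwards [coeFn_mulOp σ₃ f, coeFn_mulOp σ₂ f] with x h3 h2
  rw [h3, h2, ← mul_assoc, h]

theorem fourierMult_comp (σ₁ σ₂ σ₃ : UnitSymbol) (h : ∀ x, σ₁.toFun x * σ₂.toFun x = σ₃.toFun x)
    (f : L2) : fourierMult σ₁ (fourierMult σ₂ f) = fourierMult σ₃ f := by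
  apply fourier_injective
  simp only [fourier_fourierMult]
  exact mulOp_comp _ _ _ h _

theorem mulOp_comm (σ₁ σ₂ : UnitSymbol) (f : L2) :
    mulOp σ₁ (mulOp σ₂ f) = mulOp σ₂ (mulOp σ₁ f) := by
  refine mulOp_eq_of_ae ?_
  filter_upwards [coeFn_mulOp σ₂ f, coeFn_mulOp σ₁ f, coeFn_mulOp σ₂ (mulOp σ₁ f)] with x h2 h1 h3
  rw [h3, h2, h1]; ring

theorem fourierMult_comm (σ₁ σ₂ : UnitSymbol) (f : L2) :
    fourierMult σ₁ (fourierMult σ₂ f) = fourierMult σ₂ (fourierMult σ₁ f) := by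
  apply fourier_injective
  simp only [fourier_fourierMult]
  exact mulOp_comm _ _ _

/-- The indicator function of a measurable set as a symbol. -/
def indicatorSymbol (A : Set ℝ) (hA : MeasurableSet A) : UnitSymbol where
  toFun := A.indicator 1
  measurable := measurable_one.indicator hA
  norm_le x := by
    by_cases h : x ∈ A <;> simp [h]

theorem mulOp_indicator_ae (A : Set ℝ) (hA : MeasurableSet A) (f : L2) :
    mulOp (indicatorSymbol A hA) f =ᵐ[volume] A.indicator f := by
  filter_upwards [coeFn_mulOp (indicatorSymbol A hA) f] with x hx
  rw [hx]
  by_cases h : x ∈ A <;> simp [indicatorSymbol, h]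

theorem spaceCut_eq_mulOp (a b : ℝ) (f : L2) :
    spaceCut a b f = mulOp (indicatorSymbol (Set.Ico a b) measurableSet_Ico) f :=
  Lp.ext (((Lp.memLp f).indicator measurableSet_Ico).coeFn_toLp.trans
    (mulOp_indicator_ae _ _ f).symm)

/-! ### The Schrödinger group -/

/-- The symbol of `exp(i t D²)`. -/
def phaseSymbol (t : ℝ) : UnitSymbol where
  toFun ξ := Complex.exp (Complex.I * ((t * (2 * Real.pi * ξ) ^ 2 : ℝ) : ℂ))
  measurable := (Continuous.measurable (by fun_prop))
  norm_le ξ := by rw [mul_comm Complex.I, Complex.norm_exp_ofReal_mul_I]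

theorem norm_phaseSymbol (t ξ : ℝ) : ‖(phaseSymbol t).toFun ξ‖ = 1 := by
  simp only [phaseSymbol]
  rw [mul_comm Complex.I, Complex.norm_exp_ofReal_mul_I]

theorem schrodinger_eq_fourierMult (t : ℝ) (f : L2) :
    schrodinger t f = fourierMult (phaseSymbol t) f := rfl

theorem phaseSymbol_mul (s t ξ : ℝ) :
    (phaseSymbol s).toFun ξ * (phaseSymbol t).toFun ξ = (phaseSymbol (s + t)).toFun ξ := by
  simp only [phaseSymbol]
  rw [← Complex.exp_add]
  congr 1
  push_cast
  ring

theorem schrodinger_add (s t : ℝ) (f : L2) :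
    schrodinger s (schrodinger t f) = schrodinger (s + t) f := by
  simp only [schrodinger_eq_fourierMult]
  exact fourierMult_comp _ _ _ (phaseSymbol_mul s t) f

theorem schrodinger_zero (f : L2) : schrodinger 0 f = f := by
  apply fourier_injective
  rw [schrodinger_eq_fourierMult, fourier_fourierMult]
  refine mulOp_eq_of_ae (Filter.Eventually.of_forall fun x ↦ ?_)
  simp [phaseSymbol]

theorem norm_schrodinger (t : ℝ) (f : L2) : ‖schrodinger t f‖ = ‖f‖ := by
  have h : ∀ s g, ‖schrodinger s g‖ ≤ ‖g‖ := fun s g ↦ by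
    rw [schrodinger_eq_fourierMult]
    exact norm_fourierMult_le (phaseSymbol s) g
  refine le_antisymm (h t f) ?_
  have := h (-t) (schrodinger t f)
  rwa [schrodinger_add, neg_add_cancel, schrodinger_zero] at this

theorem schrodinger_fourierMult (t : ℝ) (σ : UnitSymbol) (f : L2) :
    schrodinger t (fourierMult σ f) = fourierMult σ (schrodinger t f) := by
  rw [schrodinger_eq_fourierMult, schrodinger_eq_fourierMult]
  exact fourierMult_comm (phaseSymbol t) σ f

/-- Dominated convergence for the squares of representatives `g i`; it yields strong continuity of
the group on the Fourier side. -/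
theorem tendsto_norm_toLp_zero {ι : Type*} {l : Filter ι} [l.IsCountablyGenerated]
    (G : ι → L2) (g : ι → ℝ → ℂ) (hG : ∀ i, G i =ᵐ[volume] g i) (b : ℝ → ℝ)
    (hb : MemLp b 2 volume) (hle : ∀ i x, ‖g i x‖ ≤ b x)
    (hlim : ∀ᵐ x, Filter.Tendsto (fun i ↦ g i x) l (nhds 0)) :
    Filter.Tendsto G l (nhds 0) := by
  rw [tendsto_zero_iff_norm_tendsto_zero]
  have h1 : ∀ i, ‖G i‖ ^ 2 = ∫ x, ‖g i x‖ ^ 2 := fun i ↦ by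
    rw [← @inner_self_eq_norm_sq ℂ, L2.inner_def, ← integral_re]
    · refine integral_congr_ae ?_
      filter_upwards [hG i] with x hx
      rw [hx, inner_self_eq_norm_sq]
    · exact L2.integrable_inner _ _
  have h2 : Filter.Tendsto (fun i ↦ ∫ x, ‖g i x‖ ^ 2) l (nhds (∫ _ : ℝ, (0 : ℝ))) := by
    refine tendsto_integral_filter_of_dominated_convergence (fun x ↦ b x ^ 2) ?_ ?_ ?_ ?_
    · refine Filter.Eventually.of_forall fun i ↦ ?_
      have := ((Lp.aestronglyMeasurable (G i)).congr (hG i)).norm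
      exact this.pow 2
    · refine Filter.Eventually.of_forall fun i ↦ Filter.Eventually.of_forall fun x ↦ ?_
      rw [norm_pow, norm_norm]
      exact pow_le_pow_left₀ (norm_nonneg _) (hle i x) 2
    · exact hb.integrable_sq
    · filter_upwards [hlim] with x hx
      simpa using (hx.norm.pow 2)
  simp only [integral_zero] at h2
  have h3 := (h2.congr fun i ↦ (h1 i).symm).sqrt
  simpa [Real.sqrt_sq] using h3

theorem continuous_schrodinger_left (f : L2) : Continuous fun t ↦ schrodinger t f := by
  rw [continuous_iff_continuousAt]
  intro t₀
  have key : Filter.Tendsto (fun t ↦ mulOp (phaseSymbol t) (𝓕 f : L2) -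
      mulOp (phaseSymbol t₀) (𝓕 f : L2)) (nhds t₀) (nhds 0) := by
    refine tendsto_norm_toLp_zero _ (fun t x ↦ (phaseSymbol t).toFun x * (𝓕 f : L2) x -
      (phaseSymbol t₀).toFun x * (𝓕 f : L2) x) (fun t ↦ ?_) (fun x ↦ 2 * ‖(𝓕 f : L2) x‖) ?_ ?_ ?_
    · filter_upwards [Lp.coeFn_sub (mulOp (phaseSymbol t) (𝓕 f : L2))
        (mulOp (phaseSymbol t₀) (𝓕 f : L2)), coeFn_mulOp (phaseSymbol t) (𝓕 f : L2),
        coeFn_mulOp (phaseSymbol t₀) (𝓕 f : L2)] with x h1 h2 h3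
      rw [h1, Pi.sub_apply, h2, h3]
    · exact (Lp.memLp (𝓕 f : L2)).norm.const_mul 2
    · intro t x
      refine (norm_sub_le _ _).trans ?_
      rw [norm_mul, norm_mul, norm_phaseSymbol, norm_phaseSymbol]
      linarith
    · refine Filter.Eventually.of_forall fun x ↦ ?_
      have : Continuous fun t ↦ (phaseSymbol t).toFun x * (𝓕 f : L2) x -
        (phaseSymbol t₀).toFun x * (𝓕 f : L2) x := by
        simp only [phaseSymbol]; fun_prop
      simpa using this.tendsto t₀
  have h2 := ((Lp.fourierTransformₗᵢ ℝ ℂ).symm.continuous.tendsto 0).comp key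
  rw [map_zero] at h2
  rw [ContinuousAt, ← tendsto_sub_nhds_zero_iff]
  refine h2.congr fun t ↦ ?_
  simp only [Function.comp, map_sub]
  rfl

/-- Strong continuity and isometry give joint continuity, hence measurability of `t ↦ S(f t) (g t)`
for measurable `f` and `g`. -/
theorem continuous_schrodinger : Continuous fun p : ℝ × L2 ↦ schrodinger p.1 p.2 := by
  rw [continuous_iff_continuousAt]
  rintro ⟨t₀, f₀⟩
  have h1 : Filter.Tendsto (fun p : ℝ × L2 ↦ schrodinger p.1 (p.2 - f₀)) (nhds (t₀, f₀))
      (nhds 0) := by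
    rw [tendsto_zero_iff_norm_tendsto_zero]
    simp only [norm_schrodinger]
    have : Continuous fun p : ℝ × L2 ↦ ‖p.2 - f₀‖ := by fun_prop
    simpa using this.tendsto (t₀, f₀)
  have h2 : Filter.Tendsto (fun p : ℝ × L2 ↦ schrodinger p.1 f₀) (nhds (t₀, f₀))
      (nhds (schrodinger t₀ f₀)) :=
    (continuous_schrodinger_left f₀).tendsto t₀ |>.comp (continuous_fst.tendsto (t₀, f₀))
  have h3 := h1.add h2
  rw [zero_add] at h3
  refine h3.congr fun p ↦ ?_
  simp only [schrodinger_eq_fourierMult, map_sub, sub_add_cancel]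

/-! ### Fourier integrals of integrable square integrable functions -/

/-- Fubini: the general flip identity for the form `-innerₗ`, whose Fourier integral is `𝓕⁻`. -/
theorem integral_fourierInv_mul_eq_flip {f g : ℝ → ℂ} (hf : Integrable f) (hg : Integrable g) :
    ∫ x, (𝓕⁻ f : ℝ → ℂ) x • g x = ∫ x, f x • (𝓕⁻ g : ℝ → ℂ) x := by
  have flip := VectorFourier.integral_fourierIntegral_smul_eq_flip (μ := volume) (ν := volume)
    (L := -(innerₗ ℝ)) (f := f) (g := g) Real.continuous_fourierChar
    (by exact continuous_inner.neg) hf hg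
  have hi : (-(innerₗ ℝ)).flip = -(innerₗ ℝ) := by
    ext; simp
  rw [hi] at flip
  have h : ∀ k : ℝ → ℂ, (𝓕⁻ k : ℝ → ℂ) =
      VectorFourier.fourierIntegral Real.fourierChar volume (-(innerₗ ℝ)) k := fun k ↦ by
    ext x
    simp [Real.fourierInv_eq, VectorFourier.fourierIntegral]
  rw [h, h]
  exact flip

/-- On `L²` the inverse transform is not given by an integral. This duality with Schwartz functions,
read off from tempered distributions, is the bridge to integral formulas. -/
theorem integral_schwartz_fourierInv_L2 (G : SchwartzMap ℝ ℂ) (H : L2) :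
    ∫ x, (𝓕⁻ G : SchwartzMap ℝ ℂ) x • H x = ∫ x, G x • (𝓕⁻ H : L2) x := by
  have key := congrArg (fun T ↦ T G) (Lp.fourierInv_toTemperedDistribution_eq H)
  simpa only [TemperedDistribution.fourierInv_apply, Lp.toTemperedDistribution_apply] using key

theorem continuous_fourierInv {h : ℝ → ℂ} (h1 : Integrable h) : Continuous (𝓕⁻ h : ℝ → ℂ) := by
  have : (𝓕⁻ h : ℝ → ℂ) = fun x ↦ 𝓕 h (-x) := by
    ext x; rw [Real.fourierInv_eq_fourier_neg]
  rw [this]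
  exact (VectorFourier.fourierIntegral_continuous Real.continuous_fourierChar
    (by exact continuous_inner) h1).comp continuous_neg

/-- The superposition of the characters `exp(2πi x ξ)` with density `h`. -/
def synthesis (h : ℝ → ℂ) (x : ℝ) : ℂ :=
  ∫ ξ : ℝ, Complex.exp (Complex.I * ((2 * Real.pi * (x * ξ) : ℝ) : ℂ)) * h ξ

theorem synthesis_eq_fourierInv (h : ℝ → ℂ) (x : ℝ) :
    synthesis h x = (𝓕⁻ h : ℝ → ℂ) x := by
  rw [synthesis, Real.fourierInv_eq']
  refine integral_congr_ae (Filter.Eventually.of_forall fun ξ ↦ ?_)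
  simp only [smul_eq_mul]
  congr 2
  simp [mul_comm, mul_left_comm]

theorem continuous_synthesis {h : ℝ → ℂ} (h1 : Integrable h) : Continuous (synthesis h) := by
  have : synthesis h = (𝓕⁻ h : ℝ → ℂ) := funext (synthesis_eq_fourierInv h)
  rw [this]
  exact continuous_fourierInv h1

theorem exists_schwartz_of_hasCompactSupport {g : ℝ → ℝ} (hg : ContDiff ℝ ∞ g)
    (hgs : HasCompactSupport g) : ∃ G : SchwartzMap ℝ ℂ, ∀ x, G x = (g x : ℂ) := by
  have hgs' : HasCompactSupport fun x ↦ (g x : ℂ) :=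
    hgs.comp_left (g := fun y : ℝ ↦ (y : ℂ)) Complex.ofReal_zero
  have hGc : ContDiff ℝ ∞ fun x ↦ (g x : ℂ) := Complex.ofRealCLM.contDiff.comp hg
  exact ⟨hgs'.toSchwartzMap hGc, fun x ↦ rfl⟩

/-- For a density in `L¹ ∩ L²` both sides have the same pairing with every test function, by duality
on the left and by Fubini on the right. -/
theorem fourierInv_ae_eq_synthesis {h : ℝ → ℂ} (h1 : Integrable h) (H F : L2) (hF : F = 𝓕⁻ H)
    (hH : H =ᵐ[volume] h) : F =ᵐ[volume] synthesis h := by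
  have hloc : LocallyIntegrable F volume :=
    (Lp.memLp _).locallyIntegrable (by norm_num)
  refine ae_eq_of_integral_contDiff_smul_eq hloc (continuous_synthesis h1).locallyIntegrable ?_
  intro g hg hgs
  obtain ⟨G, hG⟩ := exists_schwartz_of_hasCompactSupport hg hgs
  have e1 : ∫ x, g x • F x = ∫ x, G x • F x := by
    refine integral_congr_ae (Filter.Eventually.of_forall fun x ↦ ?_)
    simp only [hG, Complex.real_smul, smul_eq_mul]
  have e2 : ∫ x, g x • synthesis h x = ∫ x, G x • synthesis h x := by
    refine integral_congr_ae (Filter.Eventually.of_forall fun x ↦ ?_)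
    simp only [hG, Complex.real_smul, smul_eq_mul]
  rw [e1, e2, hF, ← integral_schwartz_fourierInv_L2]
  have e3 : ∫ x, (𝓕⁻ G : SchwartzMap ℝ ℂ) x • H x = ∫ x, (𝓕⁻ (G : ℝ → ℂ)) x • h x := by
    refine integral_congr_ae ?_
    filter_upwards [hH] with x hx
    rw [hx, SchwartzMap.fourierInv_coe]
  rw [e3]
  simp only [synthesis_eq_fourierInv]
  exact integral_fourierInv_mul_eq_flip G.integrable h1

theorem eLpNorm_two_sq {α E : Type*} [MeasurableSpace α] [NormedAddCommGroup E] (F : α → E)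
    (ν : Measure α) : eLpNorm F 2 ν ^ 2 = ∫⁻ t, ‖F t‖ₑ ^ 2 ∂ν := by
  have := eLpNorm_nnreal_pow_eq_lintegral (f := F) (μ := ν) (p := 2) (by norm_num)
  simpa using this

theorem enorm_sq_eq_lintegral (F : L2) : ‖F‖ₑ ^ 2 = ∫⁻ x, ‖F x‖ₑ ^ 2 := by
  rw [← eLpNorm_two_sq, Lp.enorm_def]

/-! ### Frequency projections -/

/-- The support condition in `FreqLocalized`. -/
def freqSet (lam : ℝ) : Set ℝ :=
  {ξ | |2 * Real.pi * ξ| ≤ 2 * lam ∧ (lam = 1 ∨ lam / 2 ≤ |2 * Real.pi * ξ|)}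

theorem measurableSet_freqSet (lam : ℝ) : MeasurableSet (freqSet lam) := by
  have h : Measurable fun ξ : ℝ ↦ |2 * Real.pi * ξ| := by fun_prop
  exact (measurableSet_le h measurable_const).inter
    ((MeasurableSet.const _).union (measurableSet_le measurable_const h))

/-- The sharp projection to the frequencies in `freqSet lam`. -/
def freqProj (lam : ℝ) : L2 →L[ℂ] L2 :=
  fourierMult (indicatorSymbol (freqSet lam) (measurableSet_freqSet lam))

theorem fourier_freqProj_ae (lam : ℝ) (f : L2) :
    (𝓕 (freqProj lam f) : L2) =ᵐ[volume] (freqSet lam).indicator (𝓕 f : L2) := by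
  rw [freqProj, fourier_fourierMult]
  exact mulOp_indicator_ae _ _ _

theorem FreqLocalized.freqProj_eq {lam : ℝ} {f : L2} (hf : FreqLocalized lam f) :
    freqProj lam f = f := by
  apply fourier_injective
  refine Lp.ext ((fourier_freqProj_ae lam f).trans ?_)
  filter_upwards [hf] with ξ hξ
  by_cases h : ξ ∈ freqSet lam
  · rw [Set.indicator_of_mem h]
  · rw [Set.indicator_of_notMem h, hξ h]

theorem schrodinger_freqProj (lam t : ℝ) (f : L2) :
    schrodinger t (freqProj lam f) = freqProj lam (schrodinger t f) :=
  schrodinger_fourierMult _ _ _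

/-- The Fourier transform cut off to `freqSet lam`. -/
def freqDensity (lam : ℝ) (f : L2) : ℝ → ℂ :=
  (freqSet lam).indicator (𝓕 f : L2)

theorem freqSet_subset (lam : ℝ) : freqSet lam ⊆ Set.Icc (-(lam / Real.pi)) (lam / Real.pi) := by
  intro ξ hξ
  have h := abs_le.1 hξ.1
  have hp := Real.pi_pos
  constructor
  · rw [← neg_div, div_le_iff₀ hp]; linarith [h.1]
  · rw [le_div_iff₀ hp]; linarith [h.2]

theorem volume_freqSet_le {lam : ℝ} (hl : 0 ≤ lam) : volume (freqSet lam) ≤ ENNReal.ofReal lam := by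
  refine (measure_mono (freqSet_subset lam)).trans ?_
  rw [Real.volume_Icc]
  refine ENNReal.ofReal_le_ofReal ?_
  have h3 := Real.pi_gt_three
  have : lam / Real.pi ≤ lam / 2 := div_le_div_of_nonneg_left hl (by norm_num) (by linarith)
  linarith

theorem stronglyMeasurable_freqDensity (lam : ℝ) (f : L2) :
    StronglyMeasurable (freqDensity lam f) :=
  (Lp.stronglyMeasurable _).indicator (measurableSet_freqSet lam)

theorem memLp_freqDensity (lam : ℝ) (f : L2) : MemLp (freqDensity lam f) 2 volume :=
  (Lp.memLp _).indicator (measurableSet_freqSet lam)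

theorem eLpNorm_freqDensity_le (lam : ℝ) (f : L2) : eLpNorm (freqDensity lam f) 2 volume ≤ ‖f‖ₑ := by
  refine (eLpNorm_indicator_le _).trans ?_
  rw [← Lp.enorm_def, ← ofReal_norm, ← ofReal_norm, Lp.norm_fourier_eq]

theorem lintegral_freqDensity_sq_le (lam : ℝ) (f : L2) :
    ∫⁻ ξ, ‖freqDensity lam f ξ‖ₑ ^ 2 ≤ ‖f‖ₑ ^ 2 := by
  rw [← eLpNorm_two_sq]
  exact pow_le_pow_left₀ zero_le (eLpNorm_freqDensity_le lam f) 2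

/-- Cauchy–Schwarz on `freqSet lam`, of measure at most `lam`; the origin of the Bernstein factor
`lam^(1/2)`. -/
theorem lintegral_freqDensity_le {lam : ℝ} (hl : 0 ≤ lam) (f : L2) :
    ∫⁻ ξ, ‖freqDensity lam f ξ‖ₑ ≤ ENNReal.ofReal (lam ^ (1 / 2 : ℝ)) * ‖f‖ₑ := by
  have h1 : ∫⁻ ξ, ‖freqDensity lam f ξ‖ₑ =
      eLpNorm ((𝓕 f : L2) : ℝ → ℂ) 1 (volume.restrict (freqSet lam)) := by
    rw [eLpNorm_one_eq_lintegral_enorm, ← lintegral_indicator (measurableSet_freqSet lam)]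
    refine lintegral_congr fun ξ ↦ ?_
    rw [freqDensity, enorm_indicator_eq_indicator_enorm]
  rw [h1]
  have h2 := eLpNorm_le_eLpNorm_mul_rpow_measure_univ (μ := volume.restrict (freqSet lam))
    (p := 1) (q := 2) (f := ((𝓕 f : L2) : ℝ → ℂ)) (by norm_num)
    (Lp.aestronglyMeasurable (𝓕 f : L2)).restrict
  refine h2.trans ?_
  rw [mul_comm]
  refine mul_le_mul' ?_ ?_
  · rw [Measure.restrict_apply_univ, ← ENNReal.ofReal_rpow_of_nonneg hl (by norm_num)]
    have : (1 / (1 : ℝ≥0∞).toReal - 1 / (2 : ℝ≥0∞).toReal) = (1 / 2 : ℝ) := by norm_num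
    rw [this]
    exact ENNReal.rpow_le_rpow (volume_freqSet_le hl) (by norm_num)
  · refine (eLpNorm_mono_measure _ Measure.restrict_le_self).trans ?_
    rw [← Lp.enorm_def, ← ofReal_norm, ← ofReal_norm, Lp.norm_fourier_eq]

theorem integrable_freqDensity {lam : ℝ} (hl : 0 ≤ lam) (f : L2) :
    Integrable (freqDensity lam f) := by
  refine ⟨(stronglyMeasurable_freqDensity lam f).aestronglyMeasurable, ?_⟩
  exact (lintegral_freqDensity_le hl f).trans_lt (ENNReal.mul_lt_top ENNReal.ofReal_lt_top (by simp))

theorem integrable_symbol_mul (σ : UnitSymbol) {h : ℝ → ℂ} (hh : Integrable h) :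
    Integrable fun ξ ↦ σ.toFun ξ * h ξ := by
  refine hh.mono (σ.measurable.aestronglyMeasurable.mul hh.aestronglyMeasurable) ?_
  refine Filter.Eventually.of_forall fun x ↦ ?_
  rw [norm_mul]
  exact mul_le_of_le_one_left (norm_nonneg _) (σ.norm_le x)

theorem fourierMult_freqProj_ae {lam : ℝ} (hl : 0 ≤ lam) (σ : UnitSymbol) (f : L2) :
    fourierMult σ (freqProj lam f) =ᵐ[volume]
      synthesis fun ξ ↦ σ.toFun ξ * freqDensity lam f ξ := by
  refine fourierInv_ae_eq_synthesis (integrable_symbol_mul σ (integrable_freqDensity hl f))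
    (mulOp σ (𝓕 (freqProj lam f) : L2)) _ (fourierMult_apply _ _) ?_
  filter_upwards [coeFn_mulOp σ (𝓕 (freqProj lam f) : L2), fourier_freqProj_ae lam f] with ξ h1 h2
  rw [h1, h2, freqDensity]

theorem schrodinger_freqProj_ae {lam : ℝ} (hl : 0 ≤ lam) (t : ℝ) (f : L2) :
    schrodinger t (freqProj lam f) =ᵐ[volume]
      synthesis fun ξ ↦ (phaseSymbol t).toFun ξ * freqDensity lam f ξ := by
  rw [schrodinger_eq_fourierMult]
  exact fourierMult_freqProj_ae hl _ f

theorem freqProj_ae {lam : ℝ} (hl : 0 ≤ lam) (f : L2) :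
    freqProj lam f =ᵐ[volume] synthesis (freqDensity lam f) := by
  have h := schrodinger_freqProj_ae hl 0 f
  rw [schrodinger_zero] at h
  have e : (fun ξ ↦ (phaseSymbol 0).toFun ξ * freqDensity lam f ξ) = freqDensity lam f := by
    ext ξ; simp [phaseSymbol]
  rwa [e] at h

theorem enorm_synthesis_le (h : ℝ → ℂ) (x : ℝ) : ‖synthesis h x‖ₑ ≤ ∫⁻ ξ, ‖h ξ‖ₑ := by
  refine (enorm_integral_le_lintegral_enorm _).trans (lintegral_mono fun ξ ↦ ?_)
  rw [enorm_mul, ← ofReal_norm, mul_comm Complex.I, Complex.norm_exp_ofReal_mul_I]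
  simp

theorem freqProj_enorm_ae_le {lam : ℝ} (hl : 0 ≤ lam) (f : L2) :
    ∀ᵐ x, ‖freqProj lam f x‖ₑ ≤ ENNReal.ofReal (lam ^ (1 / 2 : ℝ)) * ‖f‖ₑ := by
  filter_upwards [freqProj_ae hl f] with x hx
  rw [hx]
  exact (enorm_synthesis_le _ _).trans (lintegral_freqDensity_le hl f)

theorem freqProj_norm_ae_le {lam : ℝ} (hl : 0 ≤ lam) (f : L2) :
    ∀ᵐ x, ‖freqProj lam f x‖ ≤ lam ^ (1 / 2 : ℝ) * ‖f‖ := by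
  filter_upwards [freqProj_enorm_ae_le hl f] with x hx
  rw [← ofReal_norm, ← ofReal_norm, ← ENNReal.ofReal_mul (by positivity)] at hx
  exact (ENNReal.ofReal_le_ofReal_iff (by positivity)).1 hx

/-! ### Products with one frequency localized factor -/

theorem memLp_top_freqProj {lam : ℝ} (hl : 0 ≤ lam) (f : L2) :
    MemLp (freqProj lam f) ∞ volume :=
  memLp_top_of_bound (Lp.aestronglyMeasurable _) _ (freqProj_norm_ae_le hl f)

theorem memLp_freqProj_mul {lam : ℝ} (hl : 0 ≤ lam) (f g : L2) :
    MemLp (fun x ↦ freqProj lam f x * g x) 2 volume :=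
  (Lp.memLp g).mul' (memLp_top_freqProj hl f)

/-- The product `(P f) g`, where `P` is the projection to frequencies in `freqSet lam`. -/
def freqMul {lam : ℝ} (hl : 0 ≤ lam) : L2 →L[ℂ] L2 →L[ℂ] L2 :=
  LinearMap.mkContinuous₂
    (LinearMap.mk₂ ℂ (fun f g ↦ (memLp_freqProj_mul hl f g).toLp _)
      (fun f f' g ↦ by
        rw [← MemLp.toLp_add]
        refine MemLp.toLp_congr _ _ ?_
        rw [map_add]
        filter_upwards [Lp.coeFn_add (freqProj lam f) (freqProj lam f')] with x hx
        simp only [Pi.add_apply, hx, add_mul])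
      (fun c f g ↦ by
        rw [← MemLp.toLp_const_smul]
        refine MemLp.toLp_congr _ _ ?_
        rw [map_smul]
        filter_upwards [Lp.coeFn_smul c (freqProj lam f)] with x hx
        simp only [Pi.smul_apply, hx, smul_eq_mul, mul_assoc])
      (fun f g g' ↦ by
        rw [← MemLp.toLp_add]
        refine MemLp.toLp_congr _ _ ?_
        filter_upwards [Lp.coeFn_add g g'] with x hx
        simp only [Pi.add_apply, hx, mul_add])
      (fun c f g ↦ by
        rw [← MemLp.toLp_const_smul]
        refine MemLp.toLp_congr _ _ ?_
        filter_upwards [Lp.coeFn_smul c g] with x hx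
        simp only [Pi.smul_apply, hx, smul_eq_mul, mul_left_comm]))
    (lam ^ (1 / 2 : ℝ)) fun f g ↦ by
      rw [LinearMap.mk₂_apply]
      refine Lp.norm_le_mul_norm_of_ae_le_mul ?_
      filter_upwards [(memLp_freqProj_mul hl f g).coeFn_toLp, freqProj_norm_ae_le hl f] with x h1 h2
      rw [h1, norm_mul]
      exact mul_le_mul_of_nonneg_right h2 (norm_nonneg _)

theorem coeFn_freqMul {lam : ℝ} (hl : 0 ≤ lam) (f g : L2) :
    freqMul hl f g =ᵐ[volume] fun x ↦ freqProj lam f x * g x :=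
  (memLp_freqProj_mul hl f g).coeFn_toLp

theorem enorm_freqMul_le {lam : ℝ} (hl : 0 ≤ lam) (f g : L2) :
    ‖freqMul hl f g‖ₑ ≤ ENNReal.ofReal (lam ^ (1 / 2 : ℝ)) * ‖f‖ₑ * ‖g‖ₑ := by
  rw [← ofReal_norm, ← ofReal_norm, ← ofReal_norm, ← ENNReal.ofReal_mul (by positivity),
    ← ENNReal.ofReal_mul (by positivity)]
  refine ENNReal.ofReal_le_ofReal ?_
  refine Lp.norm_le_mul_norm_of_ae_le_mul ?_
  filter_upwards [coeFn_freqMul hl f g, freqProj_norm_ae_le hl f] with x h1 h2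
  rw [h1, norm_mul]
  exact mul_le_mul_of_nonneg_right h2 (norm_nonneg _)

/-- With the projection built in, `freqMul` is a bounded bilinear map, so the product becomes an
`L²`-valued function of time that can be treated linearly in each factor. On localized `u` the
projection is invisible. -/
theorem normL2Prod_eq_eLpNorm {lam : ℝ} (hl : 0 ≤ lam) (I : Set ℝ) (u v : ℝ → L2)
    (hu : ∀ t, FreqLocalized lam (u t)) :
    normL2Prod I u v = eLpNorm (fun t ↦ freqMul hl (u t) (v t)) 2 (volume.restrict I) := by
  have : eLpNorm (fun t ↦ freqMul hl (u t) (v t)) 2 (volume.restrict I) =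
      (eLpNorm (fun t ↦ freqMul hl (u t) (v t)) 2 (volume.restrict I) ^ 2) ^ (1 / 2 : ℝ) := by
    rw [← ENNReal.rpow_natCast, ← ENNReal.rpow_mul]; norm_num
  rw [this, eLpNorm_two_sq, normL2Prod]
  congr 1
  refine lintegral_congr fun t ↦ ?_
  rw [enorm_sq_eq_lintegral]
  refine lintegral_congr_ae ?_
  filter_upwards [coeFn_freqMul hl (u t) (v t)] with x hx
  rw [hx, (hu t).freqProj_eq]

/-! ### An `L²` bound for oscillatory superpositions -/

/-- The Fourier transform of `exp(-π b t²)`. -/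
def gaussKernel (b s : ℝ) : ℝ := 1 / b ^ (1 / 2 : ℝ) * Real.exp (-Real.pi / b * s ^ 2)

theorem gaussKernel_nonneg {b : ℝ} (hb : 0 < b) (s : ℝ) : 0 ≤ gaussKernel b s := by
  unfold gaussKernel; positivity

theorem continuous_gaussKernel (b : ℝ) : Continuous (gaussKernel b) := by
  unfold gaussKernel; fun_prop

theorem gaussKernel_neg (b s : ℝ) : gaussKernel b (-s) = gaussKernel b s := by
  simp [gaussKernel]

theorem integral_gauss_mul_exp {b : ℝ} (hb : 0 < b) (s : ℝ) :
    ∫ t : ℝ, Complex.exp (Complex.I * ((2 * Real.pi * (t * s) : ℝ) : ℂ)) *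
      (Real.exp (-Real.pi * b * t ^ 2) : ℂ) = gaussKernel b s := by
  have h := congrFun (fourier_gaussian_pi (b := (b : ℂ)) (by simpa using hb)) (-s)
  rw [Real.fourier_real_eq_integral_exp_smul] at h
  have e : (gaussKernel b s : ℂ) =
      1 / (b : ℂ) ^ (1 / 2 : ℂ) * Complex.exp (-Real.pi / b * ((-s : ℝ) : ℂ) ^ 2) := by
    unfold gaussKernel
    push_cast
    rw [Complex.ofReal_cpow hb.le]
    congr 2
    · push_cast; rfl
    · ring_nf
  rw [e, ← h]
  refine integral_congr_ae (Filter.Eventually.of_forall fun t ↦ ?_)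
  simp only [smul_eq_mul]
  push_cast
  congr 2
  ring

theorem integral_gaussKernel {b : ℝ} (hb : 0 < b) : ∫ s, gaussKernel b s = 1 := by
  unfold gaussKernel
  rw [integral_const_mul]
  have h := integral_gaussian (Real.pi / b)
  have e : ∀ s : ℝ, -Real.pi / b * s ^ 2 = -(Real.pi / b) * s ^ 2 := fun s ↦ by ring
  simp only [e]
  rw [h, div_div_cancel₀ Real.pi_ne_zero, Real.sqrt_eq_rpow]
  exact one_div_mul_cancel (by positivity)

theorem lintegral_gaussKernel {b : ℝ} (hb : 0 < b) (c : ℝ) :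
    ∫⁻ s, ENNReal.ofReal (gaussKernel b (c - s)) = 1 := by
  rw [lintegral_sub_left_eq_self (fun s ↦ ENNReal.ofReal (gaussKernel b s)) c,
    ← ofReal_integral_eq_lintegral_ofReal, integral_gaussKernel hb, ENNReal.ofReal_one]
  · by_contra h
    have := integral_undef h
    rw [integral_gaussKernel hb] at this
    exact one_ne_zero this
  · exact Filter.Eventually.of_forall fun s ↦ gaussKernel_nonneg hb s

theorem two_mul_enorm_mul_le (a b : ℂ) : 2 * (‖a‖ₑ * ‖b‖ₑ) ≤ ‖a‖ₑ ^ 2 + ‖b‖ₑ ^ 2 := by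
  have := two_mul_le_add_sq ‖a‖₊ ‖b‖₊
  rw [mul_assoc] at this
  simp only [enorm_eq_nnnorm]
  exact_mod_cast this

section

variable {X : Type*} [MeasurableSpace X] {ν : Measure X} [SFinite ν]

/-- Schur's test: the push-forward hypothesis bounds each row integral of the kernel by `A` times
the total mass `1` of `gaussKernel b`, uniformly in `b`. -/
theorem schur_gauss_le {φ : X → ℝ} (hφ : Measurable φ) {A : ℝ≥0∞} (hA : ν.map φ ≤ A • volume)
    {h : X → ℂ} (hh : AEStronglyMeasurable h ν) {b : ℝ} (hb : 0 < b) :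
    ∫⁻ z, ‖h z.1‖ₑ * ‖h z.2‖ₑ * ENNReal.ofReal (gaussKernel b (φ z.1 - φ z.2)) ∂(ν.prod ν) ≤
      A * ∫⁻ x, ‖h x‖ₑ ^ 2 ∂ν := by
  have hk : Measurable fun z : X × X ↦ ENNReal.ofReal (gaussKernel b (φ z.1 - φ z.2)) :=
    ((continuous_gaussKernel b).measurable.comp
      ((hφ.comp measurable_fst).sub (hφ.comp measurable_snd))).ennreal_ofReal
  have h1 : AEMeasurable (fun z : X × X ↦ ‖h z.1‖ₑ ^ 2) (ν.prod ν) :=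
    (hh.comp_fst (ν := ν)).enorm.pow_const 2
  have h2 : AEMeasurable (fun z : X × X ↦ ‖h z.2‖ₑ ^ 2) (ν.prod ν) :=
    (hh.comp_snd (μ := ν)).enorm.pow_const 2
  have inner : ∀ c : ℝ, ∫⁻ y, ENNReal.ofReal (gaussKernel b (c - φ y)) ∂ν ≤ A := fun c ↦ by
    have hm : Measurable fun s ↦ ENNReal.ofReal (gaussKernel b (c - s)) :=
      ((continuous_gaussKernel b).comp (continuous_const.sub continuous_id)).measurable.ennreal_ofReal
    rw [← lintegral_map hm hφ]
    refine (lintegral_mono' hA le_rfl).trans ?_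
    rw [lintegral_smul_measure, lintegral_gaussKernel hb, smul_eq_mul, mul_one]
  have hm1 : AEMeasurable (fun z : X × X ↦ ‖h z.1‖ₑ ^ 2 *
      ENNReal.ofReal (gaussKernel b (φ z.1 - φ z.2))) (ν.prod ν) := h1.mul hk.aemeasurable
  have m1 : ∫⁻ z, ‖h z.1‖ₑ ^ 2 * ENNReal.ofReal (gaussKernel b (φ z.1 - φ z.2)) ∂(ν.prod ν) ≤
      A * ∫⁻ x, ‖h x‖ₑ ^ 2 ∂ν := by
    rw [lintegral_prod _ hm1, mul_comm A,
      ← lintegral_mul_const'' _ (hh.enorm.pow_const 2)]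
    refine lintegral_mono fun x ↦ ?_
    simp only
    rw [lintegral_const_mul' _ _ (by simp)]
    exact mul_le_mul' le_rfl (inner _)
  have hm2 : AEMeasurable (fun z : X × X ↦ ‖h z.2‖ₑ ^ 2 *
      ENNReal.ofReal (gaussKernel b (φ z.1 - φ z.2))) (ν.prod ν) := h2.mul hk.aemeasurable
  have m2 : ∫⁻ z, ‖h z.2‖ₑ ^ 2 * ENNReal.ofReal (gaussKernel b (φ z.1 - φ z.2)) ∂(ν.prod ν) ≤
      A * ∫⁻ x, ‖h x‖ₑ ^ 2 ∂ν := by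
    rw [lintegral_prod_symm _ hm2, mul_comm A,
      ← lintegral_mul_const'' _ (hh.enorm.pow_const 2)]
    refine lintegral_mono fun y ↦ ?_
    simp only
    rw [lintegral_const_mul' _ _ (by simp)]
    refine mul_le_mul' le_rfl ((lintegral_mono fun x ↦ ?_).trans (inner (φ y)))
    rw [← gaussKernel_neg, neg_sub]
  have key := add_le_add m1 m2
  rw [← lintegral_add_left' hm1, ← two_mul] at key
  refine (ENNReal.mul_le_mul_iff_right (a := 2) (by simp) (by simp)).1 (le_trans ?_ key)
  rw [← lintegral_const_mul' _ _ (by simp)]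
  refine lintegral_mono fun z ↦ ?_
  rw [← mul_assoc, ← add_mul]
  exact mul_le_mul' (two_mul_enorm_mul_le _ _) le_rfl

/-- Expanding the square gives a double integral with phase `φ x - φ y`. The Gaussian weight
justifies Fubini, and the `t`-integral becomes `gaussKernel`. -/
theorem lintegral_gauss_oscillatory_le {φ : X → ℝ} (hφ : Measurable φ) {A : ℝ≥0∞}
    (hA : ν.map φ ≤ A • volume) {h : X → ℂ} (hh : Integrable h ν) {b : ℝ} (hb : 0 < b) :
    ∫⁻ t, ENNReal.ofReal (Real.exp (-Real.pi * b * t ^ 2)) *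
      ‖∫ x, Complex.exp (Complex.I * ((2 * Real.pi * (t * φ x) : ℝ) : ℂ)) * h x ∂ν‖ₑ ^ 2 ≤
      A * ∫⁻ x, ‖h x‖ₑ ^ 2 ∂ν := by
  set G : ℝ → ℂ := fun t ↦
    ∫ x, Complex.exp (Complex.I * ((2 * Real.pi * (t * φ x) : ℝ) : ℂ)) * h x ∂ν with hG
  let e : ℝ → ℝ → ℂ := fun t s ↦ Complex.exp (Complex.I * ((2 * Real.pi * (t * s) : ℝ) : ℂ))
  have he : ∀ t s, ‖e t s‖ = 1 := fun t s ↦ by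
    simp only [e]; rw [mul_comm Complex.I, Complex.norm_exp_ofReal_mul_I]
  have hec : Continuous fun p : ℝ × ℝ ↦ e p.1 p.2 := by simp only [e]; fun_prop
  let g : ℝ → ℂ := fun t ↦ (Real.exp (-Real.pi * b * t ^ 2) : ℂ)
  have hg : Integrable g := by
    have := integrable_exp_neg_mul_sq (b := Real.pi * b) (by positivity)
    have h2 := this.ofReal (𝕜 := ℂ)
    refine h2.congr (Filter.Eventually.of_forall fun t ↦ ?_)
    simp only [g, neg_mul]
    rfl
  let P : X × X → ℂ := fun z ↦ h z.1 * (starRingEnd ℂ) (h z.2)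
  have hP : Integrable P (ν.prod ν) := hh.mul_prod (Complex.conjCLE.toContinuousLinearMap.integrable_comp hh)
  let F : ℝ × (X × X) → ℂ := fun w ↦ e w.1 (φ w.2.1 - φ w.2.2) * (g w.1 * P w.2)
  have hF : Integrable F (volume.prod (ν.prod ν)) := by
    have h0 := hg.mul_prod hP
    refine h0.mono (AEStronglyMeasurable.mul ?_ h0.aestronglyMeasurable) ?_
    · refine Measurable.aestronglyMeasurable (hec.measurable.comp (measurable_fst.prodMk ?_))
      exact (hφ.comp (measurable_fst.comp measurable_snd)).sub
        (hφ.comp (measurable_snd.comp measurable_snd))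
    · refine Filter.Eventually.of_forall fun w ↦ ?_
      simp only [F]
      rw [norm_mul, he, one_mul]
  have h1 : ∀ t, ∫ z, F (t, z) ∂(ν.prod ν) = ((Real.exp (-Real.pi * b * t ^ 2) * ‖G t‖ ^ 2 : ℝ) : ℂ) := by
    intro t
    have hs : ∀ z : X × X, F (t, z) =
        g t * ((e t (φ z.1) * h z.1) * (starRingEnd ℂ) (e t (φ z.2) * h z.2)) := fun z ↦ by
      have : e t (φ z.1 - φ z.2) = e t (φ z.1) * (starRingEnd ℂ) (e t (φ z.2)) := by
        simp only [e]
        rw [← Complex.exp_conj, ← Complex.exp_add]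
        congr 1
        simp only [map_mul, Complex.conj_I, Complex.conj_ofReal]
        push_cast
        ring
      simp only [F, P, this, map_mul]
      ring
    simp only [hs]
    rw [integral_const_mul, integral_prod_mul (fun x ↦ e t (φ x) * h x)
      (fun y ↦ (starRingEnd ℂ) (e t (φ y) * h y)), integral_conj]
    change g t * (G t * (starRingEnd ℂ) (G t)) = _
    rw [Complex.mul_conj, Complex.normSq_eq_norm_sq]
    simp only [g]
    push_cast
    ring
  have h2 : ∀ z, ∫ t, F (t, z) = P z * gaussKernel b (φ z.1 - φ z.2) := by
    intro z
    rw [← integral_gauss_mul_exp hb, ← integral_const_mul]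
    refine integral_congr_ae (Filter.Eventually.of_forall fun t ↦ ?_)
    simp only [F, e, g]
    ring
  have h3 : Integrable (fun t ↦ Real.exp (-Real.pi * b * t ^ 2) * ‖G t‖ ^ 2) := by
    have := hF.integral_prod_left
    simp only [h1] at this
    exact this.re
  have h4 : ∫⁻ t, ENNReal.ofReal (Real.exp (-Real.pi * b * t ^ 2)) * ‖G t‖ₑ ^ 2 =
      ‖∫ t, ∫ z, F (t, z) ∂(ν.prod ν)‖ₑ := by
    simp only [h1]
    rw [integral_complex_ofReal, ← ofReal_norm, Complex.norm_real, Real.norm_of_nonneg (integral_nonneg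
      fun t ↦ by positivity), ofReal_integral_eq_lintegral_ofReal h3
      (Filter.Eventually.of_forall fun t ↦ by positivity)]
    refine lintegral_congr fun t ↦ ?_
    rw [ENNReal.ofReal_mul (by positivity), ENNReal.ofReal_pow (norm_nonneg _), ofReal_norm]
  rw [h4, integral_integral_swap hF]
  simp only [h2]
  refine (enorm_integral_le_lintegral_enorm _).trans
    (le_trans (le_of_eq ?_) (schur_gauss_le hφ hA hh.aestronglyMeasurable hb))
  refine lintegral_congr fun z ↦ ?_
  simp only [P]
  rw [enorm_mul, enorm_mul, ← ofReal_norm ((gaussKernel b _ : ℝ) : ℂ), Complex.norm_real,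
    Real.norm_of_nonneg (gaussKernel_nonneg hb _), RCLike.enorm_conj]

/-- In the variable `s = φ x` the inner integral is a Fourier transform, and this is Plancherel; the
push-forward bound plays the role of the Jacobian. The Gaussian weight with `b = 1/(n+1)` is removed
by Fatou. -/
theorem lintegral_oscillatory_le {φ : X → ℝ} (hφ : Measurable φ) {A : ℝ≥0∞}
    (hA : ν.map φ ≤ A • volume) {h : X → ℂ} (hh : Integrable h ν) :
    ∫⁻ t, ‖∫ x, Complex.exp (Complex.I * ((2 * Real.pi * (t * φ x) : ℝ) : ℂ)) * h x ∂ν‖ₑ ^ 2 ≤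
      A * ∫⁻ x, ‖h x‖ₑ ^ 2 ∂ν := by
  have hmeas : Continuous fun t : ℝ ↦
      ∫ x, Complex.exp (Complex.I * ((2 * Real.pi * (t * φ x) : ℝ) : ℂ)) * h x ∂ν := by
    refine continuous_of_dominated (bound := fun x ↦ ‖h x‖) (fun t ↦ ?_) (fun t ↦ ?_) hh.norm ?_
    · refine AEStronglyMeasurable.mul ?_ hh.aestronglyMeasurable
      exact Measurable.aestronglyMeasurable (by fun_prop)
    · refine Filter.Eventually.of_forall fun x ↦ ?_
      rw [norm_mul, mul_comm Complex.I, Complex.norm_exp_ofReal_mul_I, one_mul]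
    · exact Filter.Eventually.of_forall fun x ↦ by fun_prop
  set G : ℝ → ℂ := fun t ↦
    ∫ x, Complex.exp (Complex.I * ((2 * Real.pi * (t * φ x) : ℝ) : ℂ)) * h x ∂ν with hG
  have hlim : ∀ t : ℝ, Filter.Tendsto (fun n : ℕ ↦
      ENNReal.ofReal (Real.exp (-Real.pi * (1 / ((n : ℝ) + 1)) * t ^ 2)) * ‖G t‖ₑ ^ 2)
      Filter.atTop (nhds (‖G t‖ₑ ^ 2)) := by
    intro t
    have h1 : Filter.Tendsto (fun n : ℕ ↦ -Real.pi * (1 / ((n : ℝ) + 1)) * t ^ 2) Filter.atTop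
        (nhds (-Real.pi * 0 * t ^ 2)) :=
      (tendsto_one_div_add_atTop_nhds_zero_nat.const_mul _).mul_const _
    have h2 := ENNReal.tendsto_ofReal ((Real.continuous_exp.tendsto _).comp h1)
    have h3 := ENNReal.Tendsto.mul_const (b := ‖G t‖ₑ ^ 2) h2 (Or.inr (by simp))
    simpa using h3
  calc ∫⁻ t, ‖G t‖ₑ ^ 2 = ∫⁻ t, Filter.liminf (fun n : ℕ ↦
        ENNReal.ofReal (Real.exp (-Real.pi * (1 / ((n : ℝ) + 1)) * t ^ 2)) * ‖G t‖ₑ ^ 2)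
          Filter.atTop := lintegral_congr fun t ↦ (hlim t).liminf_eq.symm
    _ ≤ Filter.liminf (fun n : ℕ ↦ ∫⁻ t,
        ENNReal.ofReal (Real.exp (-Real.pi * (1 / ((n : ℝ) + 1)) * t ^ 2)) * ‖G t‖ₑ ^ 2)
          Filter.atTop := by
        refine lintegral_liminf_le' fun n ↦ ?_
        exact (by fun_prop : Measurable _).aemeasurable.mul (hmeas.measurable.enorm.pow_const 2).aemeasurable
    _ ≤ A * ∫⁻ x, ‖h x‖ₑ ^ 2 ∂ν := by
        refine Filter.liminf_le_of_le (by isBoundedDefault) fun c hc ↦ ?_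
        obtain ⟨n, hn⟩ := hc.exists
        exact hn.trans (lintegral_gauss_oscillatory_le hφ hA hh (by positivity))

end

/-! ### Push-forwards under phases without stationary points -/

/-- Change of variables: an injective map with derivative at least `d` enlarges measure by a factor
at least `d`, so preimages of `B` within `s` have measure at most `|B| / d`. -/
theorem map_restrict_le_of_deriv {φ φ' : ℝ → ℝ} (hφ : ∀ x, HasDerivAt φ (φ' x) x) {s : Set ℝ}
    (hs : MeasurableSet s) (hinj : Set.InjOn φ s) {d : ℝ} (hd : 0 < d) (hd' : ∀ x ∈ s, d ≤ |φ' x|) :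
    (volume.restrict s).map φ ≤ ENNReal.ofReal d⁻¹ • volume := by
  have hm : Measurable φ := (continuous_iff_continuousAt.2 fun x ↦ (hφ x).continuousAt).measurable
  refine Measure.le_iff.2 fun B hB ↦ ?_
  rw [Measure.map_apply hm hB, Measure.restrict_apply (hm hB), Measure.smul_apply, smul_eq_mul]
  set E := φ ⁻¹' B ∩ s
  have hE : MeasurableSet E := (hm hB).inter hs
  have h1 := lintegral_image_eq_lintegral_abs_deriv_mul hE
    (fun x _ ↦ (hφ x).hasDerivWithinAt) (hinj.mono Set.inter_subset_right) (fun _ ↦ 1)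
  simp only [mul_one, lintegral_const, one_mul, Measure.restrict_apply_univ] at h1
  have h2 : ENNReal.ofReal d * volume E ≤ volume B := by
    calc ENNReal.ofReal d * volume E = ∫⁻ _ in E, ENNReal.ofReal d := by simp
      _ ≤ ∫⁻ x in E, ENNReal.ofReal |φ' x| :=
        setLIntegral_mono' hE fun x hx ↦ ENNReal.ofReal_le_ofReal (hd' x hx.2)
      _ = volume (φ '' E) := h1.symm
      _ ≤ volume B := measure_mono (by rintro _ ⟨x, hx, rfl⟩; exact hx.1)
  rw [ENNReal.ofReal_inv_of_pos hd]
  calc volume E = (ENNReal.ofReal d)⁻¹ * (ENNReal.ofReal d * volume E) := by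
        rw [← mul_assoc, ENNReal.inv_mul_cancel (by simpa using hd) (by simp), one_mul]
    _ ≤ _ := mul_le_mul' le_rfl h2

theorem map_restrict_union_le {φ : ℝ → ℝ} (hφ : Measurable φ) {s s₁ s₂ : Set ℝ} (h : s ⊆ s₁ ∪ s₂)
    {A : ℝ≥0∞} (h₁ : (volume.restrict s₁).map φ ≤ A • volume)
    (h₂ : (volume.restrict s₂).map φ ≤ A • volume) :
    (volume.restrict s).map φ ≤ (2 * A) • volume := by
  calc (volume.restrict s).map φ ≤ (volume.restrict s₁ + volume.restrict s₂).map φ :=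
        Measure.map_mono ((Measure.restrict_mono h le_rfl).trans (Measure.restrict_union_le _ _)) hφ
    _ = (volume.restrict s₁).map φ + (volume.restrict s₂).map φ := Measure.map_add _ _ hφ
    _ ≤ A • volume + A • volume := add_le_add h₁ h₂
    _ = (2 * A) • volume := by rw [two_mul, add_smul]

/-! ### Free waves -/

/-- The free solution with Fourier transform `h` at time `0`. -/
def wave (h : ℝ → ℂ) (t x : ℝ) : ℂ :=
  synthesis (fun ξ ↦ (phaseSymbol t).toFun ξ * h ξ) x

theorem continuous_wave {h : ℝ → ℂ} (hh : Integrable h) :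
    Continuous fun p : ℝ × ℝ ↦ wave h p.1 p.2 := by
  unfold wave synthesis
  refine continuous_of_dominated (bound := fun ξ ↦ ‖h ξ‖) (fun p ↦ ?_) (fun p ↦ ?_) hh.norm ?_
  · refine AEStronglyMeasurable.mul (Continuous.aestronglyMeasurable (by fun_prop)) ?_
    exact (phaseSymbol p.1).measurable.aestronglyMeasurable.mul hh.aestronglyMeasurable
  · refine Filter.Eventually.of_forall fun ξ ↦ ?_
    rw [norm_mul, norm_mul, norm_phaseSymbol, mul_comm Complex.I, Complex.norm_exp_ofReal_mul_I,
      one_mul, one_mul]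
  · refine Filter.Eventually.of_forall fun ξ ↦ ?_
    simp only [phaseSymbol]
    fun_prop

theorem phaseSymbol_eq (t ξ : ℝ) : (phaseSymbol t).toFun ξ =
    Complex.exp (Complex.I * ((2 * Real.pi * (t * (2 * Real.pi * ξ ^ 2)) : ℝ) : ℂ)) := by
  simp only [phaseSymbol]
  congr 3
  ring

theorem enorm_exp_I_mul (r : ℝ) : ‖Complex.exp (Complex.I * (r : ℂ))‖ₑ = 1 := by
  rw [← ofReal_norm, mul_comm Complex.I, Complex.norm_exp_ofReal_mul_I, ENNReal.ofReal_one]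

/-- The derivative is `2(2πξ)`, at least `mu` in size on `freqSet mu`; `mu ≠ 1` excludes frequencies
near zero. The factor `2` counts the signs of `ξ`, since the phase is injective on each half line.
-/
theorem map_square_phase_le {mu : ℝ} (h1 : mu ≠ 1) (h0 : 0 < mu) :
    (volume.restrict (freqSet mu)).map (fun ξ : ℝ ↦ 2 * Real.pi * ξ ^ 2) ≤
      (2 * ENNReal.ofReal mu⁻¹) • volume := by
  have hp := Real.pi_pos
  have hd : ∀ ξ : ℝ, HasDerivAt (fun ξ : ℝ ↦ 2 * Real.pi * ξ ^ 2) (2 * (2 * Real.pi * ξ)) ξ :=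
    fun ξ ↦ by
      have := (hasDerivAt_pow 2 ξ).const_mul (2 * Real.pi)
      refine this.congr_deriv ?_
      norm_num
      ring
  have hlow : ∀ ξ ∈ freqSet mu, mu ≤ |2 * (2 * Real.pi * ξ)| := fun ξ hξ ↦ by
    rw [abs_mul, abs_two]
    linarith [hξ.2.resolve_left h1]
  refine map_restrict_union_le (s₁ := freqSet mu ∩ Set.Ici 0) (s₂ := freqSet mu ∩ Set.Iic 0)
    (by fun_prop) ?_ ?_ ?_
  · intro ξ hξ
    rcases le_total 0 ξ with h | h
    exacts [Or.inl ⟨hξ, h⟩, Or.inr ⟨hξ, h⟩]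
  · refine map_restrict_le_of_deriv hd ((measurableSet_freqSet mu).inter measurableSet_Ici) ?_ h0
      fun x hx ↦ hlow x hx.1
    rintro x ⟨-, hx⟩ y ⟨-, hy⟩ hxy
    exact (pow_left_inj₀ hx hy two_ne_zero).1 (mul_left_cancel₀ (by positivity) hxy)
  · refine map_restrict_le_of_deriv hd ((measurableSet_freqSet mu).inter measurableSet_Iic) ?_ h0
      fun x hx ↦ hlow x hx.1
    rintro x ⟨-, hx⟩ y ⟨-, hy⟩ hxy
    have hx' : 0 ≤ -x := neg_nonneg.2 hx
    have hy' : 0 ≤ -y := neg_nonneg.2 hy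
    have : (-x) ^ 2 = (-y) ^ 2 := by
      rw [neg_sq, neg_sq]; exact mul_left_cancel₀ (by positivity) hxy
    exact neg_injective ((pow_left_inj₀ hx' hy' two_ne_zero).1 this)

/-- At a fixed position the spatial character has modulus one and is absorbed into the density,
leaving an oscillatory integral in `t` with phase `2πξ²`. -/
theorem lintegral_wave_time_le {mu : ℝ} (h1 : mu ≠ 1) (h0 : 0 < mu) (g : L2) (x : ℝ) :
    ∫⁻ t, ‖wave (freqDensity mu g) t x‖ₑ ^ 2 ≤ 2 * ENNReal.ofReal mu⁻¹ * ‖g‖ₑ ^ 2 := by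
  have hint : Integrable (fun ξ ↦ Complex.exp (Complex.I * ((2 * Real.pi * (x * ξ) : ℝ) : ℂ)) *
      freqDensity mu g ξ) := by
    refine (integrable_freqDensity h0.le g).bdd_mul (c := 1) ?_ ?_
    · exact Continuous.aestronglyMeasurable (by fun_prop)
    · refine Filter.Eventually.of_forall fun ξ ↦ ?_
      rw [mul_comm Complex.I, Complex.norm_exp_ofReal_mul_I]
  have key := lintegral_oscillatory_le (by fun_prop) (map_square_phase_le h1 h0)
    (hint.mono_measure Measure.restrict_le_self)
  calc ∫⁻ t, ‖wave (freqDensity mu g) t x‖ₑ ^ 2 = _ := by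
        refine lintegral_congr fun t ↦ ?_
        rw [wave, synthesis, ← setIntegral_eq_integral_of_forall_compl_eq_zero (s := freqSet mu)
          (fun ξ hξ ↦ by simp [freqDensity, hξ])]
        simp only [phaseSymbol_eq]
        congr 2
        refine integral_congr_ae (Filter.Eventually.of_forall fun ξ ↦ ?_)
        simp only
        ring
    _ ≤ _ := key
    _ ≤ _ := by
        refine mul_le_mul' le_rfl ?_
        refine (lintegral_mono' Measure.restrict_le_self le_rfl).trans ?_
        refine le_trans (le_of_eq ?_) (lintegral_freqDensity_sq_le mu g)
        refine lintegral_congr fun ξ ↦ ?_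
        rw [enorm_mul, enorm_exp_I_mul, one_mul]

theorem enorm_sq_mulOp_indicator (A : Set ℝ) (hA : MeasurableSet A) (f : L2) :
    ‖mulOp (indicatorSymbol A hA) f‖ₑ ^ 2 = ∫⁻ x in A, ‖f x‖ₑ ^ 2 := by
  rw [enorm_sq_eq_lintegral, ← lintegral_indicator hA]
  refine lintegral_congr_ae ?_
  filter_upwards [mulOp_indicator_ae A hA f] with x hx
  rw [hx]
  by_cases h : x ∈ A <;> simp [h]

/-- Local smoothing for free waves on a set `A` of positions. -/
theorem lintegral_schrodinger_indicator_le {mu : ℝ} (h1 : mu ≠ 1) (h0 : 0 < mu) (A : Set ℝ)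
    (hA : MeasurableSet A) (g : L2) :
    ∫⁻ t, ‖mulOp (indicatorSymbol A hA) (freqProj mu (schrodinger t g))‖ₑ ^ 2 ≤
      2 * ENNReal.ofReal mu⁻¹ * volume A * ‖g‖ₑ ^ 2 := by
  have hc := continuous_wave (integrable_freqDensity h0.le g)
  calc _ = ∫⁻ t, ∫⁻ x in A, ‖wave (freqDensity mu g) t x‖ₑ ^ 2 := by
        refine lintegral_congr fun t ↦ ?_
        rw [enorm_sq_mulOp_indicator, ← schrodinger_freqProj]
        refine lintegral_congr_ae (ae_restrict_of_ae ?_)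
        filter_upwards [schrodinger_freqProj_ae h0.le t g] with x hx
        rw [hx, wave]
    _ = ∫⁻ x in A, ∫⁻ t, ‖wave (freqDensity mu g) t x‖ₑ ^ 2 :=
        lintegral_lintegral_swap (hc.measurable.enorm.pow_const 2).aemeasurable
    _ ≤ ∫⁻ _ in A, 2 * ENNReal.ofReal mu⁻¹ * ‖g‖ₑ ^ 2 :=
        lintegral_mono fun x ↦ lintegral_wave_time_le h1 h0 g x
    _ = _ := by
        rw [setLIntegral_const]; ring

/-! ### The bilinear estimate for free waves -/

/-- The phase of the product of two free waves at output frequency `ξ`. -/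
def pairPhase (ξ η : ℝ) : ℝ := 2 * Real.pi * (η ^ 2 + (ξ - η) ^ 2)

/-- The set of `η` such that `η` and `ξ - η` are admissible frequencies. -/
def pairSet (lam mu ξ : ℝ) : Set ℝ := freqSet lam ∩ (fun η ↦ ξ - η) ⁻¹' freqSet mu

theorem measurableSet_pairSet (lam mu ξ : ℝ) : MeasurableSet (pairSet lam mu ξ) :=
  (measurableSet_freqSet lam).inter ((measurable_const.sub measurable_id) (measurableSet_freqSet mu))

theorem pairPhase_inj {ξ x y : ℝ} (h : pairPhase ξ x = pairPhase ξ y) : x = y ∨ x + y = ξ := by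
  have hp := Real.pi_pos
  unfold pairPhase at h
  have h1 := mul_left_cancel₀ (by positivity) h
  have h2 : (x - y) * (x + y - ξ) = 0 := by linarith
  rcases mul_eq_zero.1 h2 with h3 | h3
  · left; linarith
  · right; linarith

/-- Here `8 λ ≤ μ` enters: `|2πη| ≤ 2λ ≤ μ/4` and `|2π(ξ-η)| ≥ μ/2`, so twice their difference is at
least `μ/2`. The phase is symmetric under `η ↔ ξ - η` and injective on either side of the fixed
point, which gives the factor `2`. -/
theorem map_pairPhase_le {lam mu : ℝ} (h0 : 0 < mu) (h1 : mu ≠ 1) (hl : 8 * lam ≤ mu) (ξ : ℝ) :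
    (volume.restrict (pairSet lam mu ξ)).map (pairPhase ξ) ≤
      (2 * ENNReal.ofReal (mu / 2)⁻¹) • volume := by
  have hp := Real.pi_pos
  have hd : ∀ η : ℝ, HasDerivAt (pairPhase ξ) (2 * (2 * Real.pi * η - 2 * Real.pi * (ξ - η))) η :=
    fun η ↦ by
      have h2 := (hasDerivAt_pow 2 η).add (((hasDerivAt_id η).const_sub ξ).pow 2)
      have := h2.const_mul (2 * Real.pi)
      refine this.congr_deriv ?_
      norm_num
      ring
  have hlow : ∀ η ∈ pairSet lam mu ξ, mu / 2 ≤ |2 * (2 * Real.pi * η - 2 * Real.pi * (ξ - η))| := by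
    intro η hη
    rw [abs_mul, abs_two]
    have ha := hη.1.1
    have hb : mu / 2 ≤ |2 * Real.pi * (ξ - η)| := hη.2.2.resolve_left h1
    have hc := abs_sub_abs_le_abs_sub (2 * Real.pi * (ξ - η)) (2 * Real.pi * η)
    rw [abs_sub_comm] at hc
    linarith
  have hne : ∀ η ∈ pairSet lam mu ξ, η ≠ ξ - η := fun η hη h ↦ by
    have := hlow η hη
    rw [← h, sub_self, mul_zero, abs_zero] at this
    linarith
  have hm := measurableSet_pairSet lam mu ξ
  have hs : Measurable fun η : ℝ ↦ ξ - η := by fun_prop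
  refine map_restrict_union_le (s₁ := pairSet lam mu ξ ∩ {η | η < ξ - η})
    (s₂ := pairSet lam mu ξ ∩ {η | ξ - η < η}) (by unfold pairPhase; fun_prop) ?_ ?_ ?_
  · intro η hη
    rcases lt_or_gt_of_ne (hne η hη) with h | h
    exacts [Or.inl ⟨hη, h⟩, Or.inr ⟨hη, h⟩]
  · refine map_restrict_le_of_deriv hd (hm.inter (measurableSet_lt measurable_id hs)) ?_
      (by positivity) fun x hx ↦ hlow x hx.1
    rintro x ⟨-, hx⟩ y ⟨-, hy⟩ hxy
    simp only [Set.mem_ofPred_eq, id] at hx hy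
    rcases pairPhase_inj hxy with h | h
    · exact h
    · linarith
  · refine map_restrict_le_of_deriv hd (hm.inter (measurableSet_lt hs measurable_id)) ?_
      (by positivity) fun x hx ↦ hlow x hx.1
    rintro x ⟨-, hx⟩ y ⟨-, hy⟩ hxy
    simp only [Set.mem_ofPred_eq, id] at hx hy
    rcases pairPhase_inj hxy with h | h
    · exact h
    · linarith

/-- The spatial Fourier transform of the product of two free waves. -/
def pairTransform (a b : ℝ → ℂ) (t ξ : ℝ) : ℂ :=
  ∫ η, Complex.exp (Complex.I * ((2 * Real.pi * (t * pairPhase ξ η) : ℝ) : ℂ)) * (a η * b (ξ - η))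

theorem stronglyMeasurable_pairTransform {a b : ℝ → ℂ} (ha : Measurable a) (hb : Measurable b) :
    StronglyMeasurable fun p : ℝ × ℝ ↦ pairTransform a b p.1 p.2 := by
  unfold pairTransform
  refine StronglyMeasurable.integral_prod_right (f := fun (p : ℝ × ℝ) (η : ℝ) ↦
    Complex.exp (Complex.I * ((2 * Real.pi * (p.1 * pairPhase p.2 η) : ℝ) : ℂ)) *
      (a η * b (p.2 - η))) ?_
  refine Measurable.stronglyMeasurable ?_
  have hb' : Measurable fun q : (ℝ × ℝ) × ℝ ↦ b (q.1.2 - q.2) := hb.comp (by fun_prop)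
  have ha' : Measurable fun q : (ℝ × ℝ) × ℝ ↦ a q.2 := ha.comp (by fun_prop)
  refine Measurable.mul (Continuous.measurable ?_) (ha'.mul hb')
  unfold pairPhase
  fun_prop

/-- The spatial characters multiply to the character at `ξ`, and the time phases add up to
`pairPhase ξ η`. -/
theorem convolution_wave_eq (a b : ℝ → ℂ) (t x ξ : ℝ) :
    (convolution (fun η ↦ Complex.exp (Complex.I * ((2 * Real.pi * (x * η) : ℝ) : ℂ)) *
        ((phaseSymbol t).toFun η * a η))
      (fun η ↦ Complex.exp (Complex.I * ((2 * Real.pi * (x * η) : ℝ) : ℂ)) *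
        ((phaseSymbol t).toFun η * b η)) (ContinuousLinearMap.mul ℂ ℂ) volume) ξ =
    Complex.exp (Complex.I * ((2 * Real.pi * (x * ξ) : ℝ) : ℂ)) * pairTransform a b t ξ := by
  rw [convolution_def, pairTransform, ← integral_const_mul]
  refine integral_congr_ae (Filter.Eventually.of_forall fun η ↦ ?_)
  simp only [ContinuousLinearMap.mul_apply', phaseSymbol_eq]
  have e1 : ∀ A B C D c d : ℂ, A * (B * c) * (C * (D * d)) = (A * B * C * D) * (c * d) := by
    intros; ring
  rw [e1, ← mul_assoc (Complex.exp _) (Complex.exp _) (a η * b (ξ - η)), ← Complex.exp_add, ← Complex.exp_add, ← Complex.exp_add, ← Complex.exp_add]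
  congr 2
  unfold pairPhase
  push_cast
  ring

/-- The integral of a convolution is the product of the integrals. With the characters included in
both factors, this is the inversion formula for the product at every `x`. -/
theorem wave_mul_wave {a b : ℝ → ℂ} (ha : Integrable a) (hb : Integrable b) (t : ℝ) :
    Integrable (pairTransform a b t) ∧
      ∀ x, wave a t x * wave b t x = ∫ ξ, Complex.exp (Complex.I * ((2 * Real.pi * (x * ξ) : ℝ) : ℂ)) *
        pairTransform a b t ξ := by
  have hi : ∀ {h : ℝ → ℂ} (_ : Integrable h) (x : ℝ), Integrable fun η ↦
      Complex.exp (Complex.I * ((2 * Real.pi * (x * η) : ℝ) : ℂ)) *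
        ((phaseSymbol t).toFun η * h η) := fun hh x ↦ by
    refine (integrable_symbol_mul (phaseSymbol t) hh).bdd_mul (c := 1) ?_ ?_
    · exact Continuous.aestronglyMeasurable (by fun_prop)
    · refine Filter.Eventually.of_forall fun ξ ↦ ?_
      rw [mul_comm Complex.I, Complex.norm_exp_ofReal_mul_I]
  constructor
  · have h := (hi ha 0).integrable_convolution (ContinuousLinearMap.mul ℂ ℂ) (hi hb 0)
    refine h.congr (Filter.Eventually.of_forall fun ξ ↦ ?_)
    rw [convolution_wave_eq]
    simp
  · intro x
    have h := integral_convolution (ContinuousLinearMap.mul ℂ ℂ) (hi ha x) (hi hb x)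
    simp only [convolution_wave_eq] at h
    rw [h]
    rfl

/-- For fixed output frequency the time integral is of oscillatory type with phase `pairPhase ξ`;
the density is integrable in `η` for every `ξ`, as a product of two `L²` functions. -/
theorem lintegral_pairTransform_time_le {lam mu : ℝ} (h0 : 0 < mu) (h1 : mu ≠ 1)
    (hl : 8 * lam ≤ mu) (f g : L2) (ξ : ℝ) :
    ∫⁻ t, ‖pairTransform (freqDensity lam f) (freqDensity mu g) t ξ‖ₑ ^ 2 ≤
      2 * ENNReal.ofReal (mu / 2)⁻¹ *
        ∫⁻ η, ‖freqDensity lam f η‖ₑ ^ 2 * ‖freqDensity mu g (ξ - η)‖ₑ ^ 2 := by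
  have hint : Integrable (fun η ↦ freqDensity lam f η * freqDensity mu g (ξ - η)) := by
    refine (memLp_freqDensity lam f).integrable_mul (q := 2) ?_
    exact (memLp_freqDensity mu g).comp_measurePreserving (Measure.measurePreserving_sub_left volume ξ)
  have key := lintegral_oscillatory_le (by unfold pairPhase; fun_prop) (map_pairPhase_le h0 h1 hl ξ)
    (hint.mono_measure Measure.restrict_le_self)
  calc _ = _ := by
        refine lintegral_congr fun t ↦ ?_
        rw [pairTransform, ← setIntegral_eq_integral_of_forall_compl_eq_zero
          (s := pairSet lam mu ξ) (fun η hη ↦ ?_)]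
        by_cases h : η ∈ freqSet lam
        · have h' : ξ - η ∉ freqSet mu := fun h' ↦ hη ⟨h, h'⟩
          simp [freqDensity, h']
        · simp [freqDensity, h]
    _ ≤ _ := key
    _ ≤ _ := by
        refine mul_le_mul' le_rfl ?_
        refine (lintegral_mono' Measure.restrict_le_self le_rfl).trans (le_of_eq ?_)
        refine lintegral_congr fun η ↦ ?_
        rw [enorm_mul, mul_pow]

/-- The bilinear `L²` estimate for free waves with separated frequencies. -/
theorem lintegral_freqMul_schrodinger_le {lam mu : ℝ} (hl0 : 0 ≤ lam) (h0 : 0 < mu) (h1 : mu ≠ 1)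
    (hl : 8 * lam ≤ mu) (f g : L2) :
    ∫⁻ t, ‖freqMul hl0 (schrodinger t f) (freqProj mu (schrodinger t g))‖ₑ ^ 2 ≤
      2 * ENNReal.ofReal (mu / 2)⁻¹ * ‖f‖ₑ ^ 2 * ‖g‖ₑ ^ 2 := by
  set a := freqDensity lam f with ha
  set b := freqDensity mu g with hb
  have ham : Measurable a := (stronglyMeasurable_freqDensity lam f).measurable
  have hbm : Measurable b := (stronglyMeasurable_freqDensity mu g).measurable
  have hai : Integrable a := integrable_freqDensity hl0 f
  have hbi : Integrable b := integrable_freqDensity h0.le g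
  calc _ = ∫⁻ t, ∫⁻ x, ‖wave a t x * wave b t x‖ₑ ^ 2 := by
        refine lintegral_congr fun t ↦ ?_
        rw [enorm_sq_eq_lintegral]
        refine lintegral_congr_ae ?_
        filter_upwards [coeFn_freqMul hl0 (schrodinger t f) (freqProj mu (schrodinger t g)),
          schrodinger_freqProj_ae hl0 t f, schrodinger_freqProj_ae h0.le t g] with x hx hu hv
        rw [hx, ← schrodinger_freqProj, ← schrodinger_freqProj, hu, hv, wave, wave]
    _ ≤ ∫⁻ t, ∫⁻ ξ, ‖pairTransform a b t ξ‖ₑ ^ 2 := by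
        refine lintegral_mono fun t ↦ ?_
        obtain ⟨hi, he⟩ := wave_mul_wave hai hbi t
        -- Plancherel in `x`, as an inequality: the oscillatory bound for the identity phase with `A
        -- = 1`.
        have := lintegral_oscillatory_le (ν := volume) (φ := fun ξ : ℝ ↦ ξ) measurable_id (A := 1)
          (by rw [one_smul]; exact (Measure.map_id).le) hi
        simp only [he]
        simpa only [one_mul] using this
    _ = ∫⁻ ξ, ∫⁻ t, ‖pairTransform a b t ξ‖ₑ ^ 2 :=
        lintegral_lintegral_swap
          ((stronglyMeasurable_pairTransform ham hbm).measurable.enorm.pow_const 2).aemeasurable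
    _ ≤ ∫⁻ ξ, 2 * ENNReal.ofReal (mu / 2)⁻¹ * ∫⁻ η, ‖a η‖ₑ ^ 2 * ‖b (ξ - η)‖ₑ ^ 2 :=
        lintegral_mono fun ξ ↦ lintegral_pairTransform_time_le h0 h1 hl f g ξ
    _ = 2 * ENNReal.ofReal (mu / 2)⁻¹ * ∫⁻ η, ∫⁻ ξ, ‖a η‖ₑ ^ 2 * ‖b (ξ - η)‖ₑ ^ 2 := by
        rw [lintegral_const_mul' _ _ (ENNReal.mul_ne_top (by simp) (by simp)),
          lintegral_lintegral_swap]
        refine Measurable.aemeasurable ?_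
        have hb' : Measurable fun q : ℝ × ℝ ↦ b (q.1 - q.2) := hbm.comp (by fun_prop)
        have ha' : Measurable fun q : ℝ × ℝ ↦ a q.2 := ham.comp (by fun_prop)
        exact (ha'.enorm.pow_const 2).mul (hb'.enorm.pow_const 2)
    _ = 2 * ENNReal.ofReal (mu / 2)⁻¹ * ((∫⁻ η, ‖a η‖ₑ ^ 2) * ∫⁻ ξ, ‖b ξ‖ₑ ^ 2) := by
        congr 1
        rw [← lintegral_mul_const _ (ham.enorm.pow_const 2)]
        refine lintegral_congr fun η ↦ ?_
        rw [lintegral_const_mul' _ _ (by simp),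
          lintegral_sub_right_eq_self (fun ξ ↦ ‖b ξ‖ₑ ^ 2) η]
    _ ≤ 2 * ENNReal.ofReal (mu / 2)⁻¹ * (‖f‖ₑ ^ 2 * ‖g‖ₑ ^ 2) :=
        mul_le_mul' le_rfl (mul_le_mul' (lintegral_freqDensity_sq_le lam f)
          (lintegral_freqDensity_sq_le mu g))
    _ = _ := by ring

/-! ### Transfer of estimates from free solutions to `U²` -/

/-- Fatou and the triangle inequality: pointwise convergence of the series is enough. -/
theorem eLpNorm_le_tsum_of_tendsto {α E : Type*} [MeasurableSpace α] [NormedAddCommGroup E]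
    {ν : Measure α} {w : ℕ → α → E} {v : α → E} (hw : ∀ j, AEStronglyMeasurable (w j) ν)
    (h : ∀ᵐ t ∂ν,
      Filter.Tendsto (fun n ↦ ∑ j ∈ Finset.range n, w j t) Filter.atTop (nhds (v t))) :
    eLpNorm v 2 ν ≤ ∑' j, eLpNorm (w j) 2 ν := by
  refine (Lp.eLpNorm_lim_le_liminf_eLpNorm (f := fun n t ↦ ∑ j ∈ Finset.range n, w j t)
    (fun n ↦ ?_) v ?_).trans ?_
  · exact Finset.aestronglyMeasurable_fun_sum _ fun j _ ↦ hw j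
  · exact h
  · refine Filter.liminf_le_of_le (by isBoundedDefault) fun c hc ↦ ?_
    obtain ⟨n, hn⟩ := hc.exists
    refine hn.trans ?_
    have := eLpNorm_sum_le (μ := ν) (p := 2) (s := Finset.range n) (f := w) (fun j _ ↦ hw j) (by norm_num)
    have e : (fun t ↦ ∑ j ∈ Finset.range n, w j t) = ∑ j ∈ Finset.range n, w j := by
      ext t; simp
    rw [e]
    exact this.trans (ENNReal.sum_le_tsum _)

/-- `a` equals `G s (f k)` for `s ∈ E k` and vanishes outside the sets `E k`. -/
structure IsStep (G : ℝ → L2 → L2) (E : ℤ → Set ℝ) (f : ℤ → L2) (a : ℝ → L2) : Prop where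
  measurable : ∀ k, MeasurableSet (E k)
  eq_flow : ∀ k, ∀ s ∈ E k, a s = G s (f k)
  eq_zero : ∀ s, (∀ k, s ∉ E k) → a s = 0

/-- Only the pieces and the `ℓ²` sum matter below. Forgetting the order of the intervals lets
`IsStep` also cover the dyadic grid differences. -/
theorem IsU2Atom.exists_isStep {G : ℝ → L2 → L2} {a : ℝ → L2} (h : IsU2Atom G a) :
    ∃ E f, IsStep G E f a ∧ ∑' k, ‖f k‖ₑ ^ 2 = 1 := by
  obtain ⟨τ, f, -, hf, h1, h2⟩ := h
  refine ⟨fun k ↦ {s : ℝ | τ k ≤ (s : EReal) ∧ (s : EReal) < τ (k + 1)}, f, ⟨fun k ↦ ?_, ?_, ?_⟩, ?_⟩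
  · exact (measurableSet_Ico (a := τ k) (b := τ (k + 1))).preimage measurable_coe_real_ereal
  · exact fun k s hs ↦ h1 k s hs.1 hs.2
  · exact fun s hs ↦ h2 s hs
  · have e : ∀ k, ‖f k‖ₑ ^ 2 = ENNReal.ofReal (‖f k‖ ^ 2) := fun k ↦ by
      rw [ENNReal.ofReal_pow (norm_nonneg _), ofReal_norm]
    simp only [e]
    rw [← ENNReal.ofReal_tsum_of_nonneg (fun k ↦ by positivity) hf.summable, hf.tsum_eq,
      ENNReal.ofReal_one]

theorem IsStep.aestronglyMeasurable {G : ℝ → L2 → L2} (hG : ∀ f, Continuous fun t ↦ G t f)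
    {E : ℤ → Set ℝ} {f : ℤ → L2} {a : ℝ → L2} (h : IsStep G E f a) (ν : Measure ℝ) :
    AEStronglyMeasurable a ν := by
  have hU : MeasurableSet (⋃ k, E k) := MeasurableSet.iUnion h.measurable
  have h1 : AEStronglyMeasurable a (ν.restrict (⋃ k, E k)) := by
    refine AEStronglyMeasurable.iUnion fun k ↦ ?_
    refine ((hG (f k)).aestronglyMeasurable (μ := ν.restrict (E k))).congr ?_
    filter_upwards [ae_restrict_mem (h.measurable k)] with s hs
    exact (h.eq_flow k s hs).symm
  have h2 : AEStronglyMeasurable a (ν.restrict (⋃ k, E k)ᶜ) := by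
    refine (aestronglyMeasurable_const (b := (0 : L2))).congr ?_
    filter_upwards [ae_restrict_mem hU.compl] with s hs
    exact (h.eq_zero s (by simpa using hs)).symm
  have := (aestronglyMeasurable_union_iff (μ := ν)).2 ⟨h1, h2⟩
  rwa [Set.union_compl_self, Measure.restrict_univ] at this

/-- A time dependent family of operators bounding free solutions in `L²` with constant `A`. -/
structure FreeBound (ν : Measure ℝ) (T : ℝ → L2 →L[ℂ] L2) (A : ℝ≥0∞) : Prop where
  measurable : ∀ w : ℝ → L2, AEStronglyMeasurable w ν → AEStronglyMeasurable (fun t ↦ T t (w t)) ν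
  bound : ∀ f : L2, ∫⁻ t, ‖T t (schrodinger t f)‖ₑ ^ 2 ∂ν ≤ A ^ 2 * ‖f‖ₑ ^ 2

/-- On each `E k` the function is a free solution, and extending its time integral to all times only
increases it. The pieces are summed by countable subadditivity, so disjointness is not needed. -/
theorem FreeBound.step {ν : Measure ℝ} {T : ℝ → L2 →L[ℂ] L2} {A : ℝ≥0∞} (hT : FreeBound ν T A)
    {E : ℤ → Set ℝ} {f : ℤ → L2} {a : ℝ → L2} (h : IsStep schrodinger E f a) {M : ℝ≥0∞}
    (hM : ∑' k, ‖f k‖ₑ ^ 2 ≤ M ^ 2) :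
    eLpNorm (fun t ↦ T t (a t)) 2 ν ≤ A * M := by
  refine (ENNReal.pow_le_pow_left_iff two_ne_zero).1 ?_
  rw [eLpNorm_two_sq, mul_pow]
  have hU : MeasurableSet (⋃ k, E k) := MeasurableSet.iUnion h.measurable
  rw [← lintegral_add_compl _ hU]
  have h0 : ∫⁻ t in (⋃ k, E k)ᶜ, ‖T t (a t)‖ₑ ^ 2 ∂ν = 0 := by
    rw [setLIntegral_congr_fun hU.compl (g := fun _ ↦ 0) (fun t ht ↦ ?_), lintegral_zero]
    simp only
    rw [h.eq_zero t (by simpa using ht)]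
    simp
  rw [h0, add_zero]
  refine (lintegral_iUnion_le _ _).trans ?_
  refine le_trans ?_ (mul_le_mul' le_rfl hM)
  rw [← ENNReal.tsum_mul_left]
  refine ENNReal.tsum_le_tsum fun k ↦ ?_
  refine le_trans ?_ (hT.bound (f k))
  rw [setLIntegral_congr_fun (h.measurable k) (g := fun t ↦ ‖T t (schrodinger t (f k))‖ₑ ^ 2)
    (fun t ht ↦ by simp only; rw [h.eq_flow k t ht])]
  exact lintegral_mono' Measure.restrict_le_self le_rfl

/-- Sum the step bound over the atoms of a representation. The conditions on `A` allow division by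
it, so that the infimum over representations can be taken. -/
theorem FreeBound.normU2_le {ν : Measure ℝ} {T : ℝ → L2 →L[ℂ] L2} {A : ℝ≥0∞} (hT : FreeBound ν T A)
    (hA0 : A ≠ 0) (hA : A ≠ ⊤) (v : ℝ → L2) :
    eLpNorm (fun t ↦ T t (v t)) 2 ν ≤ A * normU2 schrodinger v := by
  rw [mul_comm, ← ENNReal.div_le_iff hA0 hA]
  refine le_iInf fun c ↦ le_iInf fun a ↦ le_iInf fun ⟨ha, hs⟩ ↦ ?_
  rw [ENNReal.div_le_iff hA0 hA, ← ENNReal.tsum_mul_right]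
  have hm : ∀ j, AEStronglyMeasurable (fun t ↦ T t (a j t)) ν := fun j ↦ by
    obtain ⟨E, f, hE, -⟩ := (ha j).exists_isStep
    exact hT.measurable _ (hE.aestronglyMeasurable continuous_schrodinger_left ν)
  refine (eLpNorm_le_tsum_of_tendsto (w := fun j t ↦ c j • T t (a j t))
    (fun j ↦ (hm j).const_smul (c j)) ?_).trans (ENNReal.tsum_le_tsum fun j ↦ ?_)
  · refine Filter.Eventually.of_forall fun t ↦ ?_
    have := (hs t).mapL (T t)
    simp only [map_smul] at this
    exact this.tendsto_sum_nat
  · obtain ⟨E, f, hE, hf⟩ := (ha j).exists_isStep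
    have h1 : eLpNorm (fun t ↦ c j • T t (a j t)) 2 ν = ‖c j‖ₑ * eLpNorm (fun t ↦ T t (a j t)) 2 ν :=
      eLpNorm_const_smul (c j) (fun t ↦ T t (a j t)) 2 ν
    rw [h1]
    refine mul_le_mul' le_rfl ?_
    simpa using hT.step hE (M := 1) (by rw [hf, one_pow])

/-- At a given time an atom equals a single `G t (f k)` with `‖f k‖ ≤ 1`, or zero. -/
theorem enorm_le_normU2 {G : ℝ → L2 → L2} (hG : ∀ t f, ‖G t f‖ = ‖f‖) (v : ℝ → L2) (t : ℝ) :
    ‖v t‖ₑ ≤ normU2 G v := by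
  refine le_iInf fun c ↦ le_iInf fun a ↦ le_iInf fun ⟨ha, hs⟩ ↦ ?_
  have h1 : ∀ j, ‖a j t‖ₑ ≤ 1 := fun j ↦ by
    obtain ⟨E, f, hE, hf⟩ := (ha j).exists_isStep
    by_cases h : ∃ k, t ∈ E k
    · obtain ⟨k, hk⟩ := h
      rw [hE.eq_flow k t hk, ← ofReal_norm, hG, ofReal_norm]
      refine (ENNReal.pow_le_pow_left_iff two_ne_zero).1 ?_
      rw [one_pow, ← hf]
      exact ENNReal.le_tsum (f := fun k ↦ ‖f k‖ₑ ^ 2) k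
    · rw [hE.eq_zero t (by simpa using h)]
      simp
  refine le_of_tendsto (hs t).tendsto_sum_nat.enorm (Filter.Eventually.of_forall fun n ↦ ?_)
  refine (enorm_sum_le _ _).trans (le_trans (Finset.sum_le_sum (g := fun j ↦ ‖c j‖ₑ)
    fun j _ ↦ ?_) (ENNReal.sum_le_tsum _))
  rw [enorm_smul]
  exact mul_le_of_le_one_right' (h1 j)

/-- Half powers of `mu` in the constants. -/
def invSqrt (mu : ℝ) : ℝ≥0∞ := ENNReal.ofReal (mu ^ (-(1 / 2 : ℝ)))

theorem invSqrt_sq {mu : ℝ} (h : 0 < mu) : invSqrt mu ^ 2 = ENNReal.ofReal mu⁻¹ := by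
  rw [invSqrt, ← ENNReal.ofReal_pow (by positivity), ← Real.rpow_natCast, ← Real.rpow_mul h.le]
  norm_num
  rw [Real.rpow_neg_one]

theorem invSqrt_ne_zero {mu : ℝ} (h : 0 < mu) : invSqrt mu ≠ 0 := by
  rw [invSqrt, Ne, ENNReal.ofReal_eq_zero, not_le]
  positivity

theorem invSqrt_ne_top (mu : ℝ) : invSqrt mu ≠ ⊤ := ENNReal.ofReal_ne_top

/-! ### Free bounds for local smoothing and for products -/

theorem freeBound_indicator {mu : ℝ} (h1 : mu ≠ 1) (h0 : 0 < mu) (A : Set ℝ) (hA : MeasurableSet A)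
    {r : ℝ≥0∞} (hr : volume A ≤ r ^ 2) :
    FreeBound volume (fun _ ↦ mulOp (indicatorSymbol A hA) ∘L freqProj mu)
      (2 * r * invSqrt mu) where
  measurable w hw := (ContinuousLinearMap.continuous _).comp_aestronglyMeasurable hw
  bound f := by
    refine (lintegral_schrodinger_indicator_le h1 h0 A hA f).trans ?_
    rw [mul_pow, mul_pow, invSqrt_sq h0]
    refine mul_le_mul' ?_ le_rfl
    calc 2 * ENNReal.ofReal mu⁻¹ * volume A ≤ 2 ^ 2 * ENNReal.ofReal mu⁻¹ * r ^ 2 := by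
          refine mul_le_mul' (mul_le_mul' ?_ le_rfl) hr
          norm_num
      _ = _ := by ring

theorem freeBound_freqMul_right {lam mu : ℝ} (hl0 : 0 ≤ lam) (h0 : 0 < mu) (h1 : mu ≠ 1)
    (hl : 8 * lam ≤ mu) (f : L2) :
    FreeBound volume (fun t ↦ (freqMul hl0 (schrodinger t f)) ∘L freqProj mu)
      (2 * invSqrt mu * ‖f‖ₑ) where
  measurable w hw := by
    have hf : AEStronglyMeasurable (fun t ↦ schrodinger t f) volume :=
      (continuous_schrodinger_left f).aestronglyMeasurable
    exact (freqMul hl0).aestronglyMeasurable_comp₂ hf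
      ((freqProj mu).continuous.comp_aestronglyMeasurable hw)
  bound g := by
    refine (lintegral_freqMul_schrodinger_le hl0 h0 h1 hl f g).trans ?_
    rw [mul_pow, mul_pow, invSqrt_sq h0]
    refine mul_le_mul' (mul_le_mul' ?_ le_rfl) le_rfl
    have : (mu / 2)⁻¹ = 2 * mu⁻¹ := by rw [inv_div]; ring
    rw [this, ENNReal.ofReal_mul (by norm_num), ENNReal.ofReal_ofNat, ← mul_assoc, ← pow_two]

/-- The transfer is first done in the second factor, with the first one frozen as a free wave. The
result is a free bound for the first factor, with operators depending on `v`; its constant may be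
infinite. -/
theorem freeBound_freqMul_left {lam mu : ℝ} (hl0 : 0 ≤ lam) (h0 : 0 < mu) (h1 : mu ≠ 1)
    (hl : 8 * lam ≤ mu) {v : ℝ → L2} (hv : AEStronglyMeasurable v volume) :
    FreeBound volume (fun t ↦ (freqMul hl0).flip (freqProj mu (v t)))
      (2 * invSqrt mu * normU2 schrodinger v) where
  measurable w hw :=
    (freqMul hl0).flip.aestronglyMeasurable_comp₂
      ((freqProj mu).continuous.comp_aestronglyMeasurable hv) hw
  bound f := by
    rw [← eLpNorm_two_sq, ← mul_pow]
    refine pow_le_pow_left₀ zero_le ?_ 2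
    -- For `f = 0` the constant of `freeBound_freqMul_right` vanishes and `FreeBound.normU2_le` is
    -- not applicable.
    by_cases hf : f = 0
    · subst hf
      have : ∀ t, schrodinger t 0 = 0 := fun t ↦ by rw [schrodinger_eq_fourierMult, map_zero]
      simp [this]
    · have h2 : (‖f‖ₑ : ℝ≥0∞) ≠ 0 := by simpa using hf
      have := (freeBound_freqMul_right hl0 h0 h1 hl f).normU2_le
        (mul_ne_zero (mul_ne_zero (by simp) (invSqrt_ne_zero h0)) h2)
        (ENNReal.mul_ne_top (ENNReal.mul_ne_top ENNReal.ofNat_ne_top (invSqrt_ne_top mu))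
          enorm_ne_top) v
      refine this.trans (le_of_eq ?_)
      ring

/-! ### The kernel of the cutoff -/

/-- The symbol `m(2πξ / N)`. -/
def cutSymbol (m : ℝ → ℝ) (N ξ : ℝ) : ℂ := (m (2 * Real.pi * ξ / N) : ℂ)

theorem modKernel_eq_synthesis (m : ℝ → ℝ) (N s : ℝ) :
    modKernel m N s = synthesis (cutSymbol m N) s := by
  have hp := Real.pi_pos
  have h := Measure.integral_comp_mul_left
    (fun σ : ℝ ↦ (m (σ / N) : ℂ) * Complex.exp (Complex.I * ((s * σ : ℝ) : ℂ))) (2 * Real.pi)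
  rw [modKernel, synthesis]
  have e : ∀ ξ : ℝ, Complex.exp (Complex.I * ((2 * Real.pi * (s * ξ) : ℝ) : ℂ)) * cutSymbol m N ξ =
      (m (2 * Real.pi * ξ / N) : ℂ) * Complex.exp (Complex.I * ((s * (2 * Real.pi * ξ) : ℝ) : ℂ)) := by
    intro ξ
    rw [cutSymbol, mul_comm]
    congr 4
    ring
  simp only [e]
  rw [h, abs_of_pos (by positivity), Complex.real_smul]
  push_cast
  rfl

theorem modKernel_scale (m : ℝ → ℝ) {N : ℝ} (hN : 0 < N) (s : ℝ) :
    modKernel m N s = N * modKernel m 1 (N * s) := by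
  have h := Measure.integral_comp_div
    (fun σ : ℝ ↦ (m σ : ℂ) * Complex.exp (Complex.I * ((N * s * σ : ℝ) : ℂ))) N
  rw [modKernel, modKernel, mul_left_comm]
  congr 1
  simp only [div_one]
  rw [abs_of_pos hN, Complex.real_smul] at h
  rw [← h]
  refine integral_congr_ae (Filter.Eventually.of_forall fun σ ↦ ?_)
  simp only
  congr 4
  field_simp

/-- Where `m(σ/N)` is nonzero one has `|σ| < 2N`, so `m(σ/(2N)) = 1` there. -/
theorem IsCutoff.eq_mul {m : ℝ → ℝ} (hm : IsCutoff m) {N : ℝ} (hN : 0 < N) (ξ : ℝ) :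
    cutSymbol m (2 * N) ξ * cutSymbol m N ξ = cutSymbol m N ξ := by
  unfold cutSymbol
  by_cases h : 2 ≤ |2 * Real.pi * ξ / N|
  · rw [hm.eq_zero _ h]; simp
  · rw [hm.eq_one (2 * Real.pi * ξ / (2 * N)), Complex.ofReal_one, one_mul]
    have : 2 * Real.pi * ξ / (2 * N) = (2 * Real.pi * ξ / N) / 2 := by field_simp
    rw [this, abs_div, abs_two]
    linarith

theorem IsCutoff.exists_symbol {m : ℝ → ℝ} (hm : IsCutoff m) {N : ℝ} (hN : 0 < N) (t : ℝ) :
    ∃ M : SchwartzMap ℝ ℂ, ∀ ξ, M ξ =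
      Complex.exp (Complex.I * ((2 * Real.pi * (t * ξ) : ℝ) : ℂ)) * cutSymbol m N ξ := by
  have h1 : ContDiff ℝ ∞ fun ξ : ℝ ↦
      Complex.exp (Complex.I * ((2 * Real.pi * (t * ξ) : ℝ) : ℂ)) * cutSymbol m N ξ := by
    refine ContDiff.mul ?_ ?_
    · refine Complex.contDiff_exp.comp (contDiff_const.mul (Complex.ofRealCLM.contDiff.comp ?_))
      exact contDiff_const.mul (contDiff_const.mul contDiff_id)
    · unfold cutSymbol
      refine Complex.ofRealCLM.contDiff.comp (hm.smooth.comp ?_)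
      fun_prop
  have h2 : HasCompactSupport fun ξ : ℝ ↦
      Complex.exp (Complex.I * ((2 * Real.pi * (t * ξ) : ℝ) : ℂ)) * cutSymbol m N ξ := by
    -- The symbol vanishes once `2π|ξ| ≥ 2N`, in particular for `|ξ| > N`.
    refine HasCompactSupport.intro (K := Set.Icc (-N) N) isCompact_Icc fun ξ hξ ↦ ?_
    rw [cutSymbol, hm.eq_zero, Complex.ofReal_zero, mul_zero]
    have h3 : N < |ξ| := by
      by_contra h
      exact hξ (abs_le.1 (not_lt.1 h))
    rw [abs_div, abs_of_pos hN, le_div_iff₀ hN, abs_mul, abs_of_pos (by positivity)]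
    have := Real.pi_gt_three
    nlinarith
  exact ⟨h2.toSchwartzMap h1, fun ξ ↦ rfl⟩

/-- The reflected and translated kernel as a Schwartz function of `y` with known inverse transform:
the form in which it is paired with other functions. -/
theorem IsCutoff.exists_kernel {m : ℝ → ℝ} (hm : IsCutoff m) {N : ℝ} (hN : 0 < N) (t : ℝ) :
    ∃ G : SchwartzMap ℝ ℂ, (∀ y, G y = modKernel m N (t - y)) ∧
      ∀ ξ, (𝓕⁻ G : SchwartzMap ℝ ℂ) ξ =
        Complex.exp (Complex.I * ((2 * Real.pi * (t * ξ) : ℝ) : ℂ)) * cutSymbol m N ξ := by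
  obtain ⟨M, hM⟩ := hm.exists_symbol hN t
  refine ⟨𝓕 M, fun y ↦ ?_, fun ξ ↦ ?_⟩
  · rw [modKernel_eq_synthesis, SchwartzMap.fourier_coe, Real.fourier_real_eq_integral_exp_smul,
      synthesis]
    refine integral_congr_ae (Filter.Eventually.of_forall fun ξ ↦ ?_)
    simp only [smul_eq_mul]
    rw [hM, ← mul_assoc, ← Complex.exp_add]
    congr 2
    push_cast
    ring
  · rw [FourierTransform.fourierInv_fourier_eq, hM]

theorem IsCutoff.exists_modKernel_schwartz {m : ℝ → ℝ} (hm : IsCutoff m) {N : ℝ} (hN : 0 < N) :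
    ∃ G : SchwartzMap ℝ ℂ, (G : ℝ → ℂ) = modKernel m N := by
  obtain ⟨M, hM⟩ := hm.exists_symbol hN 0
  refine ⟨𝓕⁻ M, funext fun s ↦ ?_⟩
  rw [SchwartzMap.fourierInv_coe, ← synthesis_eq_fourierInv, modKernel_eq_synthesis]
  congr 1
  ext ξ
  rw [hM]
  simp

theorem IsCutoff.continuous_modKernel {m : ℝ → ℝ} (hm : IsCutoff m) {N : ℝ} (hN : 0 < N) :
    Continuous (modKernel m N) := by
  obtain ⟨G, hG⟩ := hm.exists_modKernel_schwartz hN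
  rw [← hG]
  exact G.continuous

theorem IsCutoff.integrable_modKernel {m : ℝ → ℝ} (hm : IsCutoff m) {N : ℝ} (hN : 0 < N) :
    Integrable (modKernel m N) := by
  obtain ⟨G, hG⟩ := hm.exists_modKernel_schwartz hN
  rw [← hG]
  exact G.integrable

/-- The kernel at scale `2N` reproduces the kernel at scale `N`. -/
theorem IsCutoff.integral_modKernel_mul {m : ℝ → ℝ} (hm : IsCutoff m) {N : ℝ} (hN : 0 < N) (t : ℝ) :
    ∫ s, modKernel m (2 * N) s * modKernel m N (t - s) = modKernel m N t := by
  obtain ⟨G, hG, hG'⟩ := hm.exists_kernel hN t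
  obtain ⟨M, hM⟩ := hm.exists_symbol (N := 2 * N) (by positivity) 0
  have hM' : (M : ℝ → ℂ) = cutSymbol m (2 * N) := by
    ext ξ; rw [hM]; simp
  have hflip := integral_fourierInv_mul_eq_flip M.integrable G.integrable
  have e1 : ∀ s, (𝓕⁻ (M : ℝ → ℂ) : ℝ → ℂ) s = modKernel m (2 * N) s := fun s ↦ by
    rw [← synthesis_eq_fourierInv, modKernel_eq_synthesis, hM']
  simp only [← SchwartzMap.fourierInv_coe G, hG', hG, e1, smul_eq_mul] at hflip
  rw [hflip, modKernel_eq_synthesis, synthesis]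
  refine integral_congr_ae (Filter.Eventually.of_forall fun ξ ↦ ?_)
  simp only
  rw [hM', mul_left_comm, hm.eq_mul hN]

/-! ### Decay of the kernel and of its increments -/

theorem schwartz_decay (G : SchwartzMap ℝ ℂ) :
    ∃ D : ℝ, 0 < D ∧ ∀ x, ‖G x‖ ≤ D / (1 + |x|) ^ 4 := by
  set D := 2 ^ 4 * (Finset.Iic ((4, 0) : ℕ × ℕ)).sup
    (fun m ↦ SchwartzMap.seminorm ℝ (F := ℂ) (E := ℝ) m.1 m.2) G with hD
  refine ⟨max D 1, by positivity, fun x ↦ ?_⟩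
  have h := SchwartzMap.one_add_le_sup_seminorm_apply (𝕜 := ℝ) (m := (4, 0)) (k := 4) (n := 0)
    le_rfl le_rfl G x
  rw [norm_iteratedFDeriv_zero, Real.norm_eq_abs, mul_comm] at h
  rw [le_div_iff₀ (by positivity)]
  exact h.trans (le_max_left _ _)

/-- At scale one the kernel is Schwartz, and scaling gives the other `N`. Increments are bounded by
the mean value inequality; `16 = 2⁴` compares the weights at points of distance at most one. -/
theorem IsCutoff.exists_decay {m : ℝ → ℝ} (hm : IsCutoff m) : ∃ D : ℝ, 0 < D ∧ ∀ N : ℝ, 0 < N →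
    (∀ s, ‖modKernel m N s‖ ≤ D * N / (1 + |N * s|) ^ 4) ∧
    ∀ s r, |N * r| ≤ 1 →
      ‖modKernel m N (s + r) - modKernel m N s‖ ≤ D * N * |N * r| / (1 + |N * s|) ^ 4 := by
  obtain ⟨G, hG⟩ := hm.exists_modKernel_schwartz one_pos
  obtain ⟨D₁, hD₁, h₁⟩ := schwartz_decay G
  obtain ⟨D₂, hD₂, h₂⟩ := schwartz_decay (SchwartzMap.derivCLM ℝ ℂ G)
  simp only [SchwartzMap.derivCLM_apply] at h₂
  have hdiff : ∀ x y : ℝ, |y| ≤ 1 → ‖G (x + y) - G x‖ ≤ 16 * D₂ * |y| / (1 + |x|) ^ 4 := by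
    intro x y hy
    have hb : ∀ z ∈ Set.uIcc x (x + y), ‖deriv G z‖ ≤ 16 * D₂ / (1 + |x|) ^ 4 := by
      intro z hz
      refine (h₂ z).trans ?_
      rw [div_le_div_iff₀ (by positivity) (by positivity)]
      have hz' : |z - x| ≤ 1 := by
        have := Set.abs_sub_left_of_mem_uIcc hz
        rw [add_sub_cancel_left] at this
        exact this.trans hy
      have h3 : 1 + |x| ≤ 2 * (1 + |z|) := by
        have := abs_sub_abs_le_abs_sub x z
        rw [abs_sub_comm] at this
        have := abs_nonneg z
        linarith
      calc D₂ * (1 + |x|) ^ 4 ≤ D₂ * (2 * (1 + |z|)) ^ 4 := by gcongr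
        _ = 16 * D₂ * (1 + |z|) ^ 4 := by ring
    have := (convex_uIcc x (x + y)).norm_image_sub_le_of_norm_deriv_le (f := G)
      (fun z _ ↦ G.differentiableAt) hb Set.left_mem_uIcc Set.right_mem_uIcc
    rw [add_sub_cancel_left, Real.norm_eq_abs] at this
    refine this.trans (le_of_eq ?_)
    ring
  refine ⟨max D₁ (16 * D₂), by positivity, fun N hN ↦ ⟨fun s ↦ ?_, fun s r hr ↦ ?_⟩⟩
  · rw [modKernel_scale m hN, ← hG, norm_mul, Complex.norm_real, Real.norm_of_nonneg hN.le]
    calc N * ‖G (N * s)‖ ≤ N * (max D₁ (16 * D₂) / (1 + |N * s|) ^ 4) := by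
          refine mul_le_mul_of_nonneg_left ((h₁ _).trans ?_) hN.le
          gcongr
          exact le_max_left _ _
      _ = _ := by ring
  · rw [modKernel_scale m hN, modKernel_scale m hN, ← hG, ← mul_sub, norm_mul, Complex.norm_real,
      Real.norm_of_nonneg hN.le, mul_add]
    calc N * ‖G (N * s + N * r) - G (N * s)‖
        ≤ N * (max D₁ (16 * D₂) * |N * r| / (1 + |N * s|) ^ 4) := by
          refine mul_le_mul_of_nonneg_left ((hdiff _ _ hr).trans ?_) hN.le
          gcongr
          exact le_max_right _ _
      _ = _ := by ring

theorem lintegral_weight {N : ℝ} (hN : 0 < N) :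
    ∫⁻ s, ENNReal.ofReal (N * (1 + (N * s) ^ 2)⁻¹) = ENNReal.ofReal Real.pi := by
  have hi : Integrable fun s : ℝ ↦ N * (1 + (N * s) ^ 2)⁻¹ :=
    (integrable_inv_one_add_sq.comp_mul_left' hN.ne').const_mul N
  rw [← ofReal_integral_eq_lintegral_ofReal hi (Filter.Eventually.of_forall fun s ↦ by positivity),
    integral_const_mul, Measure.integral_comp_mul_left (fun x ↦ (1 + x ^ 2)⁻¹),
    integral_univ_inv_one_add_sq, abs_of_pos (by positivity), smul_eq_mul, ← mul_assoc,
    mul_inv_cancel₀ hN.ne', one_mul]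

/-- The fourth power of decay pays for the extra weight `1 + |x|`, which counts overlapping shifts,
and leaves an integrable remainder. -/
theorem inv_one_add_abs_pow_four_le (x : ℝ) : (1 + |x|) / (1 + |x|) ^ 4 ≤ (1 + x ^ 2)⁻¹ := by
  rw [div_le_iff₀ (by positivity), inv_mul_eq_div, le_div_iff₀ (by positivity), ← sq_abs]
  have := abs_nonneg x
  nlinarith [mul_nonneg this this, mul_nonneg this (mul_nonneg this this),
    mul_nonneg (mul_nonneg this this) (mul_nonneg this this)]

/-! ### Functions of bounded quadratic variation -/

/-- The quadratic variation of `w` is at most `V²`. -/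
def QuadVar (w : ℝ → L2) (V : ℝ≥0∞) : Prop :=
  ∀ (n : ℕ) (τ : ℕ → ℝ), Monotone τ →
    ∑ k ∈ Finset.range n, ‖w (τ k) - w (τ (k + 1))‖ₑ ^ 2 ≤ V ^ 2

theorem sum_range_even_le (f : ℕ → ℝ≥0∞) (n : ℕ) :
    ∑ i ∈ Finset.range n, f (2 * i) ≤ ∑ k ∈ Finset.range (2 * n), f k := by
  induction n with
  | zero => simp
  | succ n ih =>
    rw [Finset.sum_range_succ, mul_add, mul_one, Finset.sum_range_succ, Finset.sum_range_succ]
    exact (add_le_add ih le_rfl).trans le_self_add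

/-- The intervals `[x q, y q]` are ordered and do not overlap, so their endpoints interleave into
one monotone sequence. For a finite part of the sum the index is shifted by `n`, since partitions
are indexed by `ℕ`. -/
theorem QuadVar.tsum_le {w : ℝ → L2} {V : ℝ≥0∞} (h : QuadVar w V) {x y : ℤ → ℝ}
    (hxy : ∀ q, x q ≤ y q) (hyx : ∀ q, y q ≤ x (q + 1)) :
    ∑' q, ‖w (y q) - w (x q)‖ₑ ^ 2 ≤ V ^ 2 := by
  refine ENNReal.summable.tsum_le_of_sum_le fun s ↦ ?_
  obtain ⟨n, hn⟩ : ∃ n : ℕ, ∀ q ∈ s, -(n : ℤ) ≤ q ∧ q < n := by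
    refine ⟨(∑ q ∈ s, q.natAbs) + 1, fun q hq ↦ ?_⟩
    have := Finset.single_le_sum (f := fun q : ℤ ↦ q.natAbs) (fun _ _ ↦ Nat.zero_le _) hq
    omega
  let τ : ℕ → ℝ := fun k ↦ if k % 2 = 0 then x ((k / 2 : ℕ) - n) else y ((k / 2 : ℕ) - n)
  have hτ : Monotone τ := by
    refine monotone_nat_of_le_succ fun k ↦ ?_
    rcases Nat.mod_two_eq_zero_or_one k with h0 | h1
    · have e1 : (k + 1) % 2 = 1 := by omega
      have e2 : (k + 1) / 2 = k / 2 := by omega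
      simp only [τ, h0, e1, e2, if_true, one_ne_zero, if_false]
      exact hxy _
    · have e1 : (k + 1) % 2 = 0 := by omega
      have e2 : (k + 1) / 2 = k / 2 + 1 := by omega
      simp only [τ, h1, e1, e2, if_true, one_ne_zero, if_false]
      refine (hyx _).trans (le_of_eq ?_)
      congr 1
      push_cast
      ring
  have hev : ∀ i : ℕ, ‖w (y ((i : ℤ) - n)) - w (x ((i : ℤ) - n))‖ₑ ^ 2 =
      ‖w (τ (2 * i)) - w (τ (2 * i + 1))‖ₑ ^ 2 := fun i ↦ by
    have e1 : (2 * i) % 2 = 0 := by omega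
    have e2 : (2 * i + 1) % 2 = 1 := by omega
    have e3 : (2 * i) / 2 = i := by omega
    have e4 : (2 * i + 1) / 2 = i := by omega
    simp only [τ, e1, e2, e3, e4, if_true, one_ne_zero, if_false]
    rw [← ofReal_norm, ← ofReal_norm, norm_sub_rev]
  calc ∑ q ∈ s, ‖w (y q) - w (x q)‖ₑ ^ 2
      ≤ ∑ q ∈ (Finset.range (2 * n)).image (fun i : ℕ ↦ (i : ℤ) - n), ‖w (y q) - w (x q)‖ₑ ^ 2 := by
        refine Finset.sum_le_sum_of_subset fun q hq ↦ ?_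
        rw [Finset.mem_image]
        obtain ⟨h1, h2⟩ := hn q hq
        refine ⟨(q + n).toNat, ?_, ?_⟩
        · rw [Finset.mem_range]; omega
        · omega
    _ = ∑ i ∈ Finset.range (2 * n), ‖w (y ((i : ℤ) - n)) - w (x ((i : ℤ) - n))‖ₑ ^ 2 := by
        refine Finset.sum_image fun i _ j _ hij ↦ ?_
        have : (i : ℤ) - n = (j : ℤ) - n := hij
        omega
    _ = ∑ i ∈ Finset.range (2 * n), ‖w (τ (2 * i)) - w (τ (2 * i + 1))‖ₑ ^ 2 :=
        Finset.sum_congr rfl fun i _ ↦ hev i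
    _ ≤ _ := sum_range_even_le (fun k ↦ ‖w (τ k) - w (τ (k + 1))‖ₑ ^ 2) (2 * n)
    _ ≤ V ^ 2 := h _ τ hτ

/-- Intervals of length `|σ|` attached to a grid of step `d` may overlap. Sorting `k` by residue
modulo `M = ⌊|σ|/d⌋ + 1` leaves `M` families without overlap, as `M d ≥ |σ|`, and each contributes
at most `V²`. -/
theorem QuadVar.tsum_shift_le {w : ℝ → L2} {V : ℝ≥0∞} (h : QuadVar w V) (a : ℝ) {d : ℝ} (hd : 0 < d)
    (σ : ℝ) :
    ∑' k : ℤ, ‖w (a + k * d - σ) - w (a + k * d)‖ₑ ^ 2 ≤ ENNReal.ofReal (1 + |σ| / d) * V ^ 2 := by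
  set M : ℕ := ⌊|σ| / d⌋₊ + 1 with hM
  have hMle : (M : ℝ) ≤ 1 + |σ| / d := by
    rw [hM]; push_cast
    linarith [Nat.floor_le (a := |σ| / d) (by positivity)]
  have hσ : |σ| ≤ M * d := by
    rw [← div_le_iff₀ hd, hM]; push_cast
    exact (Nat.lt_floor_add_one _).le
  have hσ' := abs_le.1 hσ
  set F : ℤ → ℝ≥0∞ := fun k ↦ ‖w (a + k * d - σ) - w (a + k * d)‖ₑ ^ 2 with hF
  have key : ∀ r : Fin M, ∑' q : ℤ, F (q * M + r) ≤ V ^ 2 := by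
    intro r
    rcases le_total 0 σ with h0 | h0
    · have := h.tsum_le (x := fun q : ℤ ↦ a + ((q * M + r : ℤ) : ℝ) * d - σ)
        (y := fun q : ℤ ↦ a + ((q * M + r : ℤ) : ℝ) * d) (fun q ↦ by simpa using h0)
        (fun q ↦ by push_cast; nlinarith [hσ'.2])
      refine le_trans (le_of_eq (tsum_congr fun q ↦ ?_)) this
      simp only [hF]
      rw [← ofReal_norm, ← ofReal_norm, norm_sub_rev]
    · have := h.tsum_le (y := fun q : ℤ ↦ a + ((q * M + r : ℤ) : ℝ) * d - σ)
        (x := fun q : ℤ ↦ a + ((q * M + r : ℤ) : ℝ) * d) (fun q ↦ by simpa using h0)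
        (fun q ↦ by push_cast; nlinarith [hσ'.1])
      exact this
  calc ∑' k, F k = ∑' z : ℤ × Fin M, F ((Int.divModEquiv M).symm z) :=
        ((Int.divModEquiv M).symm.tsum_eq F).symm
    _ = ∑' (q : ℤ) (r : Fin M), F (q * M + r) := by
        rw [ENNReal.tsum_prod']
        refine tsum_congr fun q ↦ tsum_congr fun r ↦ ?_
        rw [Int.divModEquiv_symm_apply]
    _ = ∑' (r : Fin M) (q : ℤ), F (q * M + r) := ENNReal.tsum_comm
    _ ≤ ∑' _ : Fin M, V ^ 2 := ENNReal.tsum_le_tsum key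
    _ = M * V ^ 2 := by rw [tsum_fintype]; simp
    _ ≤ _ := by
        refine mul_le_mul' ?_ le_rfl
        rw [← ENNReal.ofReal_natCast]
        exact ENNReal.ofReal_le_ofReal hMle

/-- Cauchy–Schwarz for the measure with density `f`, that is for `f^(1/2)` and `f^(1/2) g`. -/
theorem lintegral_mul_sq_le {α : Type*} [MeasurableSpace α] {ν : Measure α} {f g : α → ℝ≥0∞}
    (hf : AEMeasurable f ν) (hg : AEMeasurable g ν) :
    (∫⁻ x, f x * g x ∂ν) ^ 2 ≤ (∫⁻ x, f x ∂ν) * ∫⁻ x, f x * g x ^ 2 ∂ν := by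
  have hs : ∀ c : ℝ≥0∞, c ^ (1 / 2 : ℝ) * c ^ (1 / 2 : ℝ) = c := fun c ↦ by
    rw [← ENNReal.rpow_add_of_nonneg _ _ (by norm_num) (by norm_num)]; norm_num
  have hs2 : ∀ c : ℝ≥0∞, (c ^ (1 / 2 : ℝ)) ^ (2 : ℝ) = c := fun c ↦ by
    rw [← ENNReal.rpow_mul]; norm_num
  have h := ENNReal.lintegral_mul_le_Lp_mul_Lq ν Real.HolderConjugate.two_two
    (f := fun x ↦ f x ^ (1 / 2 : ℝ)) (g := fun x ↦ f x ^ (1 / 2 : ℝ) * g x)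
    (hf.pow_const _) ((hf.pow_const _).mul hg)
  have e1 : ∀ x, ((fun x ↦ f x ^ (1 / 2 : ℝ)) * fun x ↦ f x ^ (1 / 2 : ℝ) * g x) x = f x * g x :=
    fun x ↦ by simp only [Pi.mul_apply]; rw [← mul_assoc, hs]
  have e2 : ∀ x, (f x ^ (1 / 2 : ℝ) * g x) ^ (2 : ℝ) = f x * g x ^ 2 := fun x ↦ by
    rw [ENNReal.mul_rpow_of_nonneg _ _ (by norm_num), hs2]
    norm_cast
  simp only [e1, e2, hs2] at h
  refine (pow_le_pow_left₀ zero_le h 2).trans (le_of_eq ?_)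
  rw [mul_pow, pow_two, pow_two, hs, hs]

/-! ### Increments of band limited functions -/

/-- A band limited function: it is reproduced by the kernel at scale `N`. -/
structure Reproduced (m : ℝ → ℝ) (N : ℝ) (w : ℝ → L2) : Prop where
  measurable : StronglyMeasurable w
  bounded : ∃ M : ℝ, ∀ t, ‖w t‖ ≤ M
  reproduce : ∀ t, w t = ∫ s, modKernel m N s • w (t - s)

theorem integrable_smul_bounded {φ : ℝ → ℂ} (hφ : Integrable φ) {w : ℝ → L2}
    (hw : StronglyMeasurable w) (hb : ∃ M : ℝ, ∀ t, ‖w t‖ ≤ M) :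
    Integrable fun s ↦ φ s • w s := by
  obtain ⟨M, hM⟩ := hb
  exact hφ.smul_bdd M hw.aestronglyMeasurable (Filter.Eventually.of_forall hM)

/-- The kernel difference has integral zero, so `w t` can be subtracted inside the integral. Values
of `w` become increments, which the quadratic variation controls. -/
theorem Reproduced.sub_eq {m : ℝ → ℝ} (hm : IsCutoff m) {N : ℝ} (hN : 0 < N) {w : ℝ → L2}
    (hw : Reproduced m N w) (t h : ℝ) :
    w (t + h) - w t = ∫ σ, (modKernel m N (σ + h) - modKernel m N σ) • (w (t - σ) - w t) := by
  have hφ := hm.integrable_modKernel hN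
  have hφh : Integrable fun σ ↦ modKernel m N (σ + h) := hφ.comp_add_right h
  have hs : StronglyMeasurable fun σ ↦ w (t - σ) :=
    hw.measurable.comp_measurable (by fun_prop)
  have hb : ∃ M : ℝ, ∀ σ, ‖w (t - σ)‖ ≤ M := by
    obtain ⟨M, hM⟩ := hw.bounded
    exact ⟨M, fun σ ↦ hM _⟩
  have h1 : w (t + h) = ∫ σ, modKernel m N (σ + h) • w (t - σ) := by
    rw [hw.reproduce (t + h), ← integral_add_right_eq_self (fun s ↦ modKernel m N s • w (t + h - s)) h]
    refine integral_congr_ae (Filter.Eventually.of_forall fun σ ↦ ?_)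
    simp only
    congr 2
    ring
  have h2 : ∫ σ, (modKernel m N (σ + h) - modKernel m N σ) • w t = 0 := by
    rw [integral_smul_const, integral_sub hφh hφ, integral_add_right_eq_self, sub_self, zero_smul]
  simp only [smul_sub]
  rw [integral_sub, h2, sub_zero]
  · simp only [sub_smul]
    rw [integral_sub (integrable_smul_bounded hφh hs hb) (integrable_smul_bounded hφ hs hb), ← h1,
      ← hw.reproduce t]
  · exact integrable_smul_bounded (hφh.sub hφ) hs hb
  · exact (hφh.sub hφ).smul_const _

theorem Reproduced.enorm_sub_le {m : ℝ → ℝ} (hm : IsCutoff m) {N : ℝ} (hN : 0 < N) {w : ℝ → L2}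
    (hw : Reproduced m N w) (t h : ℝ) :
    ‖w (t + h) - w t‖ₑ ≤
      ∫⁻ σ, ‖modKernel m N (σ + h) - modKernel m N σ‖ₑ * ‖w (t - σ) - w t‖ₑ := by
  rw [hw.sub_eq hm hN]
  refine (enorm_integral_le_lintegral_enorm _).trans (le_of_eq ?_)
  simp only [enorm_smul]

/-- The constant `D` controls the kernel of the cutoff. -/
def KernelBound (m : ℝ → ℝ) (D : ℝ) : Prop :=
  0 < D ∧ ∀ N : ℝ, 0 < N → (∀ s, ‖modKernel m N s‖ ≤ D * N / (1 + |N * s|) ^ 4) ∧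
    ∀ s r, |N * r| ≤ 1 →
      ‖modKernel m N (s + r) - modKernel m N s‖ ≤ D * N * |N * r| / (1 + |N * s|) ^ 4

theorem KernelBound.lintegral_diff_weight_le {m : ℝ → ℝ} {D : ℝ} (hD : KernelBound m D) {N h : ℝ}
    (hN : 0 < N) (hh : 0 < h) (hNh : N * h ≤ 1) :
    ∫⁻ σ, ‖modKernel m N (σ + h) - modKernel m N σ‖ₑ * ENNReal.ofReal (1 + |N * σ|) ≤
      ENNReal.ofReal (D * Real.pi * (N * h)) := by
  have hD0 := hD.1
  have hp := Real.pi_pos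
  calc _ ≤ ∫⁻ σ, ENNReal.ofReal (D * (N * h)) * ENNReal.ofReal (N * (1 + (N * σ) ^ 2)⁻¹) := by
        refine lintegral_mono fun σ ↦ ?_
        simp only
        rw [← ofReal_norm, ← ENNReal.ofReal_mul (norm_nonneg _),
          ← ENNReal.ofReal_mul (by positivity)]
        refine ENNReal.ofReal_le_ofReal ?_
        have h1 := (hD.2 N hN).2 σ h (by rw [abs_of_pos (by positivity)]; exact hNh)
        rw [abs_of_pos (show 0 < N * h by positivity)] at h1
        calc _ ≤ (D * N * (N * h) / (1 + |N * σ|) ^ 4) * (1 + |N * σ|) :=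
              mul_le_mul_of_nonneg_right h1 (by positivity)
          _ = D * N * (N * h) * ((1 + |N * σ|) / (1 + |N * σ|) ^ 4) := by ring
          _ ≤ D * N * (N * h) * (1 + (N * σ) ^ 2)⁻¹ :=
              mul_le_mul_of_nonneg_left (inv_one_add_abs_pow_four_le _) (by positivity)
          _ = _ := by ring
    _ = _ := by
        rw [lintegral_const_mul' _ _ ENNReal.ofReal_ne_top, lintegral_weight hN,
          ← ENNReal.ofReal_mul (by positivity)]
        congr 1; ring

theorem KernelBound.lintegral_diff_le {m : ℝ → ℝ} {D : ℝ} (hD : KernelBound m D) {N h : ℝ}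
    (hN : 0 < N) (hh : 0 < h) (hNh : N * h ≤ 1) :
    ∫⁻ σ, ‖modKernel m N (σ + h) - modKernel m N σ‖ₑ ≤ ENNReal.ofReal (D * Real.pi * (N * h)) := by
  refine le_trans (lintegral_mono fun σ ↦ ?_) (hD.lintegral_diff_weight_le hN hh hNh)
  refine le_mul_of_one_le_right' ?_
  rw [ENNReal.one_le_ofReal]
  linarith [abs_nonneg (N * σ)]

/-- Below the scale `1/N` the quadratic variation over a grid gains a factor `N h`. Cauchy–Schwarz
produces two integrals of the kernel difference, each of size `N h`, and the overlap count of
`QuadVar.tsum_shift_le` costs `(N h)⁻¹`. -/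
theorem Reproduced.tsum_sub_le {m : ℝ → ℝ} (hm : IsCutoff m) {D : ℝ} (hD : KernelBound m D) {N h : ℝ}
    (hN : 0 < N) (hh : 0 < h) (hNh : N * h ≤ 1) {w : ℝ → L2} (hw : Reproduced m N w) {V : ℝ≥0∞}
    (hV : QuadVar w V) (a : ℝ) :
    ∑' k : ℤ, ‖w (a + k * (2 * h) + h) - w (a + k * (2 * h))‖ₑ ^ 2 ≤
      ENNReal.ofReal ((D * Real.pi) ^ 2 * (N * h)) * V ^ 2 := by
  have hD0 := hD.1
  have hp := Real.pi_pos
  set ψ : ℝ → ℝ≥0∞ := fun σ ↦ ‖modKernel m N (σ + h) - modKernel m N σ‖ₑ with hψ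
  have hψm : Measurable ψ := by
    have := hm.continuous_modKernel hN
    exact (by fun_prop : Continuous fun σ ↦ modKernel m N (σ + h) - modKernel m N σ).measurable.enorm
  have hgm : ∀ t, Measurable fun σ ↦ ‖w (t - σ) - w t‖ₑ := fun t ↦
    ((hw.measurable.comp_measurable (by fun_prop : Measurable fun σ ↦ t - σ)).sub
      stronglyMeasurable_const).enorm
  set J := ∫⁻ σ, ψ σ with hJ
  calc _ ≤ ∑' k : ℤ, J * ∫⁻ σ, ψ σ * ‖w (a + k * (2 * h) - σ) - w (a + k * (2 * h))‖ₑ ^ 2 := by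
        refine ENNReal.tsum_le_tsum fun k ↦ ?_
        refine (pow_le_pow_left₀ zero_le (hw.enorm_sub_le hm hN _ h) 2).trans ?_
        exact lintegral_mul_sq_le hψm.aemeasurable (hgm _).aemeasurable
    _ = J * ∫⁻ σ, ψ σ * ∑' k : ℤ, ‖w (a + k * (2 * h) - σ) - w (a + k * (2 * h))‖ₑ ^ 2 := by
        have hmk : ∀ k : ℤ, AEMeasurable (fun σ ↦
            ψ σ * ‖w (a + k * (2 * h) - σ) - w (a + k * (2 * h))‖ₑ ^ 2) volume :=
          fun k ↦ (hψm.mul ((hgm _).pow_const 2)).aemeasurable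
        rw [ENNReal.tsum_mul_left, ← lintegral_tsum hmk]
        simp only [ENNReal.tsum_mul_left]
    _ ≤ J * ∫⁻ σ, ENNReal.ofReal (N * h)⁻¹ * V ^ 2 * (ψ σ * ENNReal.ofReal (1 + |N * σ|)) := by
        refine mul_le_mul' le_rfl (lintegral_mono fun σ ↦ ?_)
        refine (mul_le_mul' le_rfl (hV.tsum_shift_le a (by positivity) σ)).trans ?_
        -- `N h ≤ 1` is used to absorb the constant term of the overlap count.
        have : ENNReal.ofReal (1 + |σ| / (2 * h)) ≤
            ENNReal.ofReal (N * h)⁻¹ * ENNReal.ofReal (1 + |N * σ|) := by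
          rw [← ENNReal.ofReal_mul (by positivity)]
          refine ENNReal.ofReal_le_ofReal ?_
          rw [abs_mul, abs_of_pos hN, inv_mul_eq_div, le_div_iff₀ (by positivity)]
          have e : (1 + |σ| / (2 * h)) * (N * h) = N * h + N * |σ| / 2 := by
            field_simp
          rw [e]
          have := mul_nonneg hN.le (abs_nonneg σ)
          linarith
        calc ψ σ * (ENNReal.ofReal (1 + |σ| / (2 * h)) * V ^ 2)
            ≤ ψ σ * (ENNReal.ofReal (N * h)⁻¹ * ENNReal.ofReal (1 + |N * σ|) * V ^ 2) := by gcongr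
          _ = _ := by ring
    _ ≤ ENNReal.ofReal (D * Real.pi * (N * h)) *
        (ENNReal.ofReal (N * h)⁻¹ * V ^ 2 * ENNReal.ofReal (D * Real.pi * (N * h))) := by
        refine mul_le_mul' (hD.lintegral_diff_le hN hh hNh) ?_
        have hm1 : Measurable fun σ ↦ ψ σ * ENNReal.ofReal (1 + |N * σ|) :=
          hψm.mul (by fun_prop)
        rw [lintegral_const_mul _ hm1]
        exact mul_le_mul' le_rfl (hD.lintegral_diff_weight_le hN hh hNh)
    _ = ENNReal.ofReal (D * Real.pi * (N * h)) * ENNReal.ofReal (N * h)⁻¹ *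
        ENNReal.ofReal (D * Real.pi * (N * h)) * V ^ 2 := by ring
    _ = _ := by
        rw [← ENNReal.ofReal_mul (by positivity), ← ENNReal.ofReal_mul (by positivity)]
        congr 2
        field_simp

/-- The kernel increments tend to zero in `L¹` and `w` is bounded. Grid points approach `t` from the
left, so only positive steps are needed. -/
theorem Reproduced.tendsto_of_le {m : ℝ → ℝ} (hm : IsCutoff m) {D : ℝ} (hD : KernelBound m D) {N : ℝ}
    (hN : 0 < N) {w : ℝ → L2} (hw : Reproduced m N w) {t : ℝ} {x : ℕ → ℝ} (hx : ∀ n, x n ≤ t)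
    (hlim : Filter.Tendsto x Filter.atTop (nhds t)) :
    Filter.Tendsto (fun n ↦ w (x n)) Filter.atTop (nhds (w t)) := by
  obtain ⟨M, hM⟩ := hw.bounded
  have hD0 := hD.1
  have hp := Real.pi_pos
  have hM0 : 0 ≤ M := (norm_nonneg _).trans (hM 0)
  rw [tendsto_iff_norm_sub_tendsto_zero]
  have h1 : Filter.Tendsto (fun n ↦ D * Real.pi * (N * (t - x n)) * (2 * M)) Filter.atTop (nhds 0) := by
    have : Filter.Tendsto (fun n ↦ D * Real.pi * (N * (t - x n)) * (2 * M)) Filter.atTop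
        (nhds (D * Real.pi * (N * (t - t)) * (2 * M))) :=
      (((hlim.const_sub t).const_mul N).const_mul _).mul_const _
    simpa using this
  have h2 : ∀ᶠ n in Filter.atTop, N * (t - x n) ≤ 1 := by
    have : Filter.Tendsto (fun n ↦ N * (t - x n)) Filter.atTop (nhds (N * (t - t))) :=
      (hlim.const_sub t).const_mul N
    rw [sub_self, mul_zero] at this
    exact (this.eventually (gt_mem_nhds one_pos)).mono fun n hn ↦ le_of_lt hn
  refine squeeze_zero' (Filter.Eventually.of_forall fun n ↦ norm_nonneg _) ?_ h1
  filter_upwards [h2] with n hn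
  rcases (hx n).eq_or_lt with h | h
  · simp [h]
  · have h3 : 0 < t - x n := by linarith
    have := hw.enorm_sub_le hm hN (x n) (t - x n)
    rw [add_sub_cancel, ← ofReal_norm, norm_sub_rev] at this
    refine (ENNReal.ofReal_le_ofReal_iff (by positivity)).1 (this.trans ?_)
    rw [ENNReal.ofReal_mul (by positivity)]
    refine le_trans ?_ (mul_le_mul' (hD.lintegral_diff_le hN h3 hn) le_rfl)
    rw [← lintegral_mul_const' _ _ ENNReal.ofReal_ne_top]
    refine lintegral_mono fun σ ↦ mul_le_mul' le_rfl ?_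
    rw [← ofReal_norm]
    refine ENNReal.ofReal_le_ofReal ((norm_sub_le _ _).trans ?_)
    linarith [hM (x n - σ), hM (x n)]

/-! ### Dyadic approximation in time -/

/-- The largest point `≤ t` of the grid `a + 2⁻ʲ ℤ`. -/
def gridPoint (a : ℝ) (j : ℕ) (t : ℝ) : ℝ := a + ⌊2 ^ j * (t - a)⌋ / 2 ^ j

theorem gridPoint_le (a : ℝ) (j : ℕ) (t : ℝ) : gridPoint a j t ≤ t := by
  have h := Int.floor_le (2 ^ j * (t - a))
  have : (⌊2 ^ j * (t - a)⌋ : ℝ) / 2 ^ j ≤ t - a := by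
    rw [div_le_iff₀ (by positivity)]; linarith
  unfold gridPoint
  linarith

theorem lt_gridPoint_add (a : ℝ) (j : ℕ) (t : ℝ) : t < gridPoint a j t + (1 / 2) ^ j := by
  have h := Int.lt_floor_add_one (2 ^ j * (t - a))
  have : t - a < (⌊2 ^ j * (t - a)⌋ : ℝ) / 2 ^ j + (1 / 2) ^ j := by
    rw [one_div, inv_pow, ← one_div, ← add_div, lt_div_iff₀ (by positivity)]; linarith
  unfold gridPoint
  linarith

theorem tendsto_gridPoint (a t : ℝ) :
    Filter.Tendsto (fun j ↦ gridPoint a j t) Filter.atTop (nhds t) := by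
  have h1 : Filter.Tendsto (fun j : ℕ ↦ t - (1 / 2 : ℝ) ^ j) Filter.atTop (nhds (t - 0)) :=
    (tendsto_pow_atTop_nhds_zero_of_lt_one (by norm_num) (by norm_num)).const_sub t
  rw [sub_zero] at h1
  refine tendsto_of_tendsto_of_tendsto_of_le_of_le h1 tendsto_const_nhds (fun j ↦ ?_)
    (fun j ↦ gridPoint_le a j t)
  have := lt_gridPoint_add a j t
  simp only
  linarith

theorem floor_two_mul_cases (x : ℝ) : ⌊2 * x⌋ = 2 * ⌊x⌋ ∨ ⌊2 * x⌋ = 2 * ⌊x⌋ + 1 := by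
  have h1 := Int.floor_le x
  have h2 := Int.lt_floor_add_one x
  have h3 : 2 * ⌊x⌋ ≤ ⌊2 * x⌋ := Int.le_floor.2 (by push_cast; linarith)
  have h4 : ⌊2 * x⌋ < 2 * ⌊x⌋ + 2 := Int.floor_lt.2 (by push_cast; linarith)
  omega

/-- The difference of two consecutive dyadic approximations of `S(t) w(t)`. -/
def gridDiff (a : ℝ) (w : ℝ → L2) (j : ℕ) (t : ℝ) : L2 :=
  schrodinger t (w (gridPoint a (j + 1) t) - w (gridPoint a j t))

/-- Refining the grid moves the grid point of `t` only if `t` lies in the right half of its coarse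
cell, that is if the finer floor is odd. There both grid values are constant, so the difference is a
free wave on each such half cell. -/
theorem isStep_gridDiff (a : ℝ) (w : ℝ → L2) (j : ℕ) :
    IsStep schrodinger (fun k ↦ {t | ⌊2 ^ (j + 1) * (t - a)⌋ = 2 * k + 1})
      (fun k ↦ w (a + k * (2 * (1 / 2) ^ (j + 1)) + (1 / 2) ^ (j + 1)) -
        w (a + k * (2 * (1 / 2) ^ (j + 1)))) (gridDiff a w j) := by
  have hpow : ∀ t : ℝ, (2 : ℝ) ^ (j + 1) * (t - a) = 2 * (2 ^ j * (t - a)) := fun t ↦ by ring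
  have hinv : (2 : ℝ) * (1 / 2) ^ (j + 1) = (2 ^ j)⁻¹ := by
    rw [one_div, inv_pow, pow_succ]; field_simp
  have hinv' : ((1 : ℝ) / 2) ^ (j + 1) = (2 ^ (j + 1))⁻¹ := by rw [one_div, inv_pow]
  refine ⟨fun k ↦ ?_, fun k s hs ↦ ?_, fun s hs ↦ ?_⟩
  · have : Measurable fun t : ℝ ↦ ⌊2 ^ (j + 1) * (t - a)⌋ :=
      Int.measurable_floor.comp (by fun_prop)
    exact this (MeasurableSet.singleton (2 * k + 1))
  · have hs' : ⌊(2 : ℝ) ^ (j + 1) * (s - a)⌋ = 2 * k + 1 := hs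
    have hk : ⌊(2 : ℝ) ^ j * (s - a)⌋ = k := by
      rw [hpow] at hs'
      rcases floor_two_mul_cases (2 ^ j * (s - a)) with h | h <;> omega
    simp only [gridDiff, gridPoint, hs', hk]
    congr 3
    · rw [hinv, hinv', add_assoc]
      congr 1
      push_cast
      rw [pow_succ]
      field_simp
    · rw [hinv, div_eq_mul_inv]
  · have h0 : gridPoint a (j + 1) s = gridPoint a j s := by
      rcases floor_two_mul_cases (2 ^ j * (s - a)) with h | h
      · rw [gridPoint, gridPoint, hpow, h]
        push_cast
        rw [pow_succ]
        field_simp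
      · rw [← hpow] at h
        exact absurd h (hs ⌊2 ^ j * (s - a)⌋)
    rw [gridDiff, h0, sub_self, schrodinger_eq_fourierMult, map_zero]

theorem sum_gridDiff (a : ℝ) (w : ℝ → L2) (n : ℕ) (t : ℝ) :
    ∑ j ∈ Finset.range n, gridDiff a w j t =
      schrodinger t (w (gridPoint a n t)) - schrodinger t (w (gridPoint a 0 t)) := by
  simp only [gridDiff, schrodinger_eq_fourierMult, map_sub]
  exact Finset.sum_range_sub (fun j ↦ fourierMult (phaseSymbol t) (w (gridPoint a j t))) n

theorem gridDiff_sum_le {w : ℝ → L2} {V : ℝ≥0∞} (hV : QuadVar w V) (a : ℝ) {h : ℝ} (hh : 0 < h) :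
    ∑' k : ℤ, ‖w (a + k * (2 * h) + h) - w (a + k * (2 * h))‖ₑ ^ 2 ≤ V ^ 2 := by
  refine hV.tsum_le (x := fun k : ℤ ↦ a + k * (2 * h)) (y := fun k : ℤ ↦ a + k * (2 * h) + h)
    (fun q ↦ by linarith) fun q ↦ ?_
  push_cast
  linarith

theorem FreeBound.gridDiff {ν : Measure ℝ} {T : ℝ → L2 →L[ℂ] L2} {A : ℝ≥0∞} (hT : FreeBound ν T A)
    {w : ℝ → L2} {V : ℝ≥0∞} (hV : QuadVar w V) (a : ℝ) (j : ℕ) :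
    eLpNorm (fun t ↦ T t (gridDiff a w j t)) 2 ν ≤ A * V :=
  hT.step (isStep_gridDiff a w j) (gridDiff_sum_le hV a (by positivity))

theorem FreeBound.gridDiff_small {m : ℝ → ℝ} (hm : IsCutoff m) {D : ℝ} (hD : KernelBound m D)
    {ν : Measure ℝ} {T : ℝ → L2 →L[ℂ] L2} {A : ℝ≥0∞} (hT : FreeBound ν T A)
    {w : ℝ → L2} {V : ℝ≥0∞} (hV : QuadVar w V) (p : ℕ) (hw : Reproduced m (2 * (2 ^ p) ^ 2) w)
    (a : ℝ) (i : ℕ) :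
    eLpNorm (fun t ↦ T t (NLS.gridDiff a w (i + 2 * p) t)) 2 ν ≤
      A * (ENNReal.ofReal (D * Real.pi * (3 / 4) ^ i) * V) := by
  have hD0 := hD.1
  have hp := Real.pi_pos
  -- With `N = 2 λ²`, `λ = 2^p` and `h = 2^{-(i+2p+1)}` one has `N h = 2^{-i}`; hence decay sets in
  -- at level `2p`.
  have e : (2 : ℝ) * (2 ^ p) ^ 2 * (1 / 2) ^ (i + 2 * p + 1) = (1 / 2) ^ i := by
    have : ((1 : ℝ) / 2) ^ p * 2 ^ p = 1 := by rw [← mul_pow]; norm_num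
    calc _ = ((1 / 2 : ℝ) ^ p * 2 ^ p) ^ 2 * (1 / 2) ^ i := by ring
      _ = _ := by rw [this]; ring
  refine hT.step (isStep_gridDiff a w _) ?_
  refine (hw.tsum_sub_le hm hD (by positivity) (by positivity) ?_ hV a).trans ?_
  · rw [e]
    exact pow_le_one₀ (by norm_num) (by norm_num)
  · rw [e, mul_pow (ENNReal.ofReal _), ← ENNReal.ofReal_pow (by positivity)]
    refine mul_le_mul' (ENNReal.ofReal_le_ofReal ?_) le_rfl
    rw [mul_pow (D * Real.pi), ← pow_mul, mul_comm i 2, pow_mul]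
    refine mul_le_mul_of_nonneg_left ?_ (by positivity)
    -- `1/2 ≤ (3/4)²`: the ratio `3/4` is a rational majorant of `2^{-1/2}`.
    exact pow_le_pow_left₀ (by norm_num) (by norm_num) i

theorem tsum_ofReal_geometric {c : ℝ} (hc : 0 ≤ c) :
    ∑' i : ℕ, ENNReal.ofReal (c * (3 / 4) ^ i) = ENNReal.ofReal (4 * c) := by
  have hs : Summable fun i : ℕ ↦ c * (3 / 4 : ℝ) ^ i :=
    (summable_geometric_of_lt_one (by norm_num) (by norm_num)).mul_left c
  rw [← ENNReal.ofReal_tsum_of_nonneg (fun i ↦ by positivity) hs, tsum_mul_left,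
    tsum_geometric_of_lt_one (by norm_num) (by norm_num)]
  congr 1
  norm_num
  ring

/-- On `[a, a + 1)` the level zero grid point is `a`, so the telescoping sum starts from `w a`; it
converges by left continuity of `w`. -/
theorem tendsto_sum_gridDiff {m : ℝ → ℝ} (hm : IsCutoff m) {D : ℝ} (hD : KernelBound m D)
    {w : ℝ → L2} {p : ℕ} (hw : Reproduced m (2 * (2 ^ p) ^ 2) w) {a t : ℝ}
    (ht : t ∈ Set.Ico a (a + 1)) (T : L2 →L[ℂ] L2) :
    Filter.Tendsto (fun n ↦ ∑ j ∈ Finset.range n, T (gridDiff a w j t)) Filter.atTop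
      (nhds (T (schrodinger t (w t)) - T (schrodinger t (w a)))) := by
  have hg0 : gridPoint a 0 t = a := by
    have : ⌊t - a⌋ = 0 := Int.floor_eq_zero_iff.2 ⟨by linarith [ht.1], by linarith [ht.2]⟩
    simp [gridPoint, this]
  have hsum : ∀ n, ∑ j ∈ Finset.range n, T (gridDiff a w j t) =
      T (schrodinger t (w (gridPoint a n t))) - T (schrodinger t (w a)) := by
    intro n
    rw [← map_sum, sum_gridDiff, hg0, map_sub]
  simp only [hsum]
  have h1 := hw.tendsto_of_le hm hD (by positivity) (fun n ↦ gridPoint_le a n t)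
    (tendsto_gridPoint a t)
  simp only [schrodinger_eq_fourierMult]
  have h2 := ((T.continuous.comp (fourierMult (phaseSymbol t)).continuous).tendsto _).comp h1
  exact h2.sub_const _

/-- The first `2p` levels cost `A V` each; the rest is a geometric series of ratio `3/4`, with sum
`4`. -/
theorem tsum_gridDiff_le {m : ℝ → ℝ} (hm : IsCutoff m) {D : ℝ} (hD : KernelBound m D)
    {T : ℝ → L2 →L[ℂ] L2} {A : ℝ≥0∞} (hT : FreeBound volume T A)
    {w : ℝ → L2} {V : ℝ≥0∞} (hV : QuadVar w V) (p : ℕ)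
    (hw : Reproduced m (2 * (2 ^ p) ^ 2) w) (a : ℝ) (ν : Measure ℝ) (hν : ν ≤ volume) :
    ∑' j, eLpNorm (fun t ↦ T t (gridDiff a w j t)) 2 ν ≤
      A * V * ENNReal.ofReal (2 * p + 4 * (D * Real.pi)) := by
  have hD0 := hD.1
  have hp := Real.pi_pos
  have hmono : ∀ F : ℝ → L2, eLpNorm F 2 ν ≤ eLpNorm F 2 volume := fun F ↦
    eLpNorm_mono_measure F hν
  have h1 : ∀ j, eLpNorm (fun t ↦ T t (gridDiff a w j t)) 2 ν ≤ A * V := fun j ↦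
    (hmono _).trans (hT.gridDiff hV a j)
  have h2 : ∀ i, eLpNorm (fun t ↦ T t (gridDiff a w (i + 2 * p) t)) 2 ν ≤
      A * V * ENNReal.ofReal (D * Real.pi * (3 / 4) ^ i) := fun i ↦ by
    refine (hmono _).trans ((hT.gridDiff_small hm hD hV p hw a i).trans (le_of_eq ?_))
    ring
  set F : ℕ → ℝ≥0∞ := fun j ↦ eLpNorm (fun t ↦ T t (gridDiff a w j t)) 2 ν with hF
  have hs : ∑ j ∈ Finset.range (2 * p), F j + ∑' i, F (i + 2 * p) = ∑' j, F j :=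
    Summable.sum_add_tsum_nat_add' ENNReal.summable
  have h3 : ∑ j ∈ Finset.range (2 * p), F j ≤ (2 * p : ℕ) * (A * V) := by
    refine (Finset.sum_le_card_nsmul _ _ _ fun j _ ↦ h1 j).trans ?_
    rw [Finset.card_range, nsmul_eq_mul]
  have h4 : ∑' i, F (i + 2 * p) ≤ A * V * ENNReal.ofReal (4 * (D * Real.pi)) := by
    rw [← tsum_ofReal_geometric (mul_pos hD0 hp).le, ← ENNReal.tsum_mul_left]
    exact ENNReal.tsum_le_tsum h2
  have e1 : (0 : ℝ) ≤ 2 * (p : ℝ) := by positivity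
  have e2 : 0 ≤ 4 * (D * Real.pi) := by positivity
  have e3 : ENNReal.ofReal (2 * (p : ℝ)) = ((2 * p : ℕ) : ℝ≥0∞) := by
    rw [← ENNReal.ofReal_natCast]
    push_cast
    rfl
  rw [← hs, ENNReal.ofReal_add e1 e2, e3, mul_add, mul_comm (A * V) ((2 * p : ℕ) : ℝ≥0∞)]
  exact add_le_add h3 h4

/-- `V²` functions of frequency and modulation localized type satisfy the bounds of free solutions on
unit time intervals with a logarithmic loss. -/
theorem FreeBound.logarithmic_loss {m : ℝ → ℝ} (hm : IsCutoff m) {D : ℝ} (hD : KernelBound m D)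
    {T : ℝ → L2 →L[ℂ] L2} {A : ℝ≥0∞} (hT : FreeBound volume T A)
    {w : ℝ → L2} {V : ℝ≥0∞} (hV : QuadVar w V) (hsup : ∀ t, ‖w t‖ₑ ≤ V) (p : ℕ)
    (hw : Reproduced m (2 * (2 ^ p) ^ 2) w) (a : ℝ) :
    eLpNorm (fun t ↦ T t (schrodinger t (w t))) 2 (volume.restrict (Set.Ico a (a + 1))) ≤
      A * V * ENNReal.ofReal (1 + 2 * p + 4 * (D * Real.pi)) := by
  have hD0 := hD.1
  have hp := Real.pi_pos
  set ν := volume.restrict (Set.Ico a (a + 1)) with hν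
  have hmono : ∀ F : ℝ → L2, eLpNorm F 2 ν ≤ eLpNorm F 2 volume := fun F ↦
    eLpNorm_mono_measure F Measure.restrict_le_self
  -- The start of the telescope is a single free wave; it contributes the summand `1` to the loss.
  have h0 : eLpNorm (fun t ↦ T t (schrodinger t (w a))) 2 ν ≤ A * V := by
    refine (hmono _).trans ?_
    refine (ENNReal.pow_le_pow_left_iff two_ne_zero).1 ?_
    rw [eLpNorm_two_sq, mul_pow]
    exact (hT.bound (w a)).trans (mul_le_mul' le_rfl (pow_le_pow_left₀ zero_le (hsup a) 2))
  have hm0 : AEStronglyMeasurable (fun t ↦ T t (schrodinger t (w a))) ν :=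
    (hT.measurable _ (continuous_schrodinger_left (w a)).aestronglyMeasurable).restrict
  have hWm : ∀ j, AEStronglyMeasurable (fun t ↦ T t (NLS.gridDiff a w j t)) ν := fun j ↦
    (hT.measurable _
      ((isStep_gridDiff a w j).aestronglyMeasurable continuous_schrodinger_left _)).restrict
  have hlim : ∀ᵐ t ∂ν, Filter.Tendsto
      (fun n ↦ ∑ j ∈ Finset.range n, T t (NLS.gridDiff a w j t)) Filter.atTop
      (nhds (T t (schrodinger t (w t)) - T t (schrodinger t (w a)))) := by
    filter_upwards [ae_restrict_mem measurableSet_Ico] with t ht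
    exact tendsto_sum_gridDiff hm hD hw ht (T t)
  have h1 := tsum_gridDiff_le hm hD hT hV p hw a ν Measure.restrict_le_self
  have h2 := (eLpNorm_le_tsum_of_tendsto hWm hlim).trans h1
  have hmw : AEStronglyMeasurable
      (fun t ↦ T t (schrodinger t (w t)) - T t (schrodinger t (w a))) ν :=
    aestronglyMeasurable_of_tendsto_ae Filter.atTop
      (fun n ↦ Finset.aestronglyMeasurable_fun_sum (Finset.range n) fun j _ ↦ hWm j) hlim
  calc eLpNorm (fun t ↦ T t (schrodinger t (w t))) 2 ν
      = eLpNorm ((fun t ↦ T t (schrodinger t (w a))) +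
          fun t ↦ T t (schrodinger t (w t)) - T t (schrodinger t (w a))) 2 ν := by
        congr 1
        ext1 t
        simp only [Pi.add_apply, add_sub_cancel]
    _ ≤ A * V + A * V * ENNReal.ofReal (2 * p + 4 * (D * Real.pi)) :=
        (eLpNorm_add_le hm0 hmw (by norm_num)).trans (add_le_add h0 h2)
    _ = _ := by
        rw [add_assoc, ENNReal.ofReal_add zero_le_one (by positivity), ENNReal.ofReal_one]
        ring

/-- Constants are absorbed by `log 2 ≤ log (1 + 2^p)`, and `2p` by `p log 2 ≤ log (1 + 2^p)`. -/
theorem log_loss_le {c : ℝ} (hc : 0 ≤ c) (p : ℕ) :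
    1 + 2 * (p : ℝ) + c ≤ (3 + c) / Real.log 2 * Real.log (1 + 2 ^ p) := by
  have h2 : 0 < Real.log 2 := Real.log_pos (by norm_num)
  rw [div_mul_eq_mul_div, le_div_iff₀ h2]
  have h3 : Real.log 2 ≤ Real.log (1 + 2 ^ p) := by
    refine Real.log_le_log (by norm_num) ?_
    have : (1 : ℝ) ≤ 2 ^ p := one_le_pow₀ (by norm_num)
    linarith
  have h4 : p * Real.log 2 ≤ Real.log (1 + 2 ^ p) := by
    rw [← Real.log_pow]
    exact Real.log_le_log (by positivity) (by linarith)
  nlinarith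

/-! ### Modulation projections of right continuous functions -/

/-- Sample `u` at grid points `x n t` to the right of `t` that converge to `t`; each approximation
factors through an integer valued floor. -/
theorem stronglyMeasurable_of_right_continuous {u : ℝ → L2}
    (hu : ∀ t : ℝ, ContinuousWithinAt u (Set.Ici t) t) : StronglyMeasurable u := by
  let x : ℕ → ℝ → ℝ := fun n t ↦ ((⌊((n : ℝ) + 1) * t⌋ : ℝ) + 1) / ((n : ℝ) + 1)
  have hx1 : ∀ n t, t ≤ x n t := fun n t ↦ by
    have hn : (0 : ℝ) < (n : ℝ) + 1 := by positivity
    rw [le_div_iff₀ hn]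
    linarith [Int.lt_floor_add_one (((n : ℝ) + 1) * t)]
  have hx2 : ∀ n t, x n t ≤ t + 1 / ((n : ℝ) + 1) := fun n t ↦ by
    have hn : (0 : ℝ) < (n : ℝ) + 1 := by positivity
    simp only [x]
    rw [add_div]
    have : (⌊((n : ℝ) + 1) * t⌋ : ℝ) / ((n : ℝ) + 1) ≤ t := by
      rw [div_le_iff₀ hn]
      linarith [Int.floor_le (((n : ℝ) + 1) * t)]
    linarith
  refine stronglyMeasurable_of_tendsto (f := fun n t ↦ u (x n t)) Filter.atTop (fun n ↦ ?_) ?_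
  · have h1 : StronglyMeasurable fun k : ℤ ↦ u (((k : ℝ) + 1) / ((n : ℝ) + 1)) :=
      StronglyMeasurable.of_discrete
    have h2 : Measurable fun t : ℝ ↦ ⌊((n : ℝ) + 1) * t⌋ := Int.measurable_floor.comp (by fun_prop)
    exact h1.comp_measurable h2
  · rw [tendsto_pi_nhds]
    intro t
    have h1 : Filter.Tendsto (fun n ↦ x n t) Filter.atTop (nhds t) := by
      have h2 : Filter.Tendsto (fun n : ℕ ↦ t + 1 / ((n : ℝ) + 1)) Filter.atTop (nhds (t + 0)) :=
        tendsto_one_div_add_atTop_nhds_zero_nat.const_add t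
      rw [add_zero] at h2
      exact tendsto_of_tendsto_of_tendsto_of_le_of_le tendsto_const_nhds h2 (fun n ↦ hx1 n t)
        fun n ↦ hx2 n t
    exact (hu t).tendsto.comp (tendsto_nhdsWithin_iff.2
      ⟨h1, Filter.Eventually.of_forall fun n ↦ hx1 n t⟩)

/-- The profile `S(-t) u(t)`. -/
def profile (u : ℝ → L2) (t : ℝ) : L2 := schrodinger (-t) (u t)

theorem schrodinger_profile (u : ℝ → L2) (t : ℝ) : schrodinger t (profile u t) = u t := by
  rw [profile, schrodinger_add, add_neg_cancel, schrodinger_zero]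

theorem norm_profile (u : ℝ → L2) (t : ℝ) : ‖profile u t‖ = ‖u t‖ := norm_schrodinger _ _

theorem stronglyMeasurable_schrodinger {f : ℝ → ℝ} {g : ℝ → L2} (hf : StronglyMeasurable f)
    (hg : StronglyMeasurable g) : StronglyMeasurable fun t ↦ schrodinger (f t) (g t) := by
  have h1 : StronglyMeasurable fun t ↦ (f t, g t) := hf.prodMk hg
  have h2 := Continuous.comp_stronglyMeasurable continuous_schrodinger h1
  simpa only [Function.comp_def] using h2

theorem stronglyMeasurable_profile {u : ℝ → L2} (hu : StronglyMeasurable u) :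
    StronglyMeasurable (profile u) := by
  have h : StronglyMeasurable fun t : ℝ ↦ -t := measurable_neg.stronglyMeasurable
  have h2 := stronglyMeasurable_schrodinger h hu
  simpa only [profile] using! h2

theorem stronglyMeasurable_of_profile {u : ℝ → L2} (hu : StronglyMeasurable (profile u)) :
    StronglyMeasurable u := by
  have h : StronglyMeasurable fun t : ℝ ↦ t := measurable_id.stronglyMeasurable
  have := stronglyMeasurable_schrodinger h hu
  simpa only [schrodinger_profile] using this

section

variable {m : ℝ → ℝ} {N : ℝ} {u : ℝ → L2}

theorem integrable_Qlow (hm : IsCutoff m) (hN : 0 < N) (hu : StronglyMeasurable u)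
    (hb : ∃ M : ℝ, ∀ t, ‖u t‖ ≤ M) (t : ℝ) :
    Integrable fun s ↦ modKernel m N s • schrodinger s (u (t - s)) := by
  refine integrable_smul_bounded (hm.integrable_modKernel hN) ?_ ?_
  · have h : StronglyMeasurable fun t : ℝ ↦ t := measurable_id.stronglyMeasurable
    have h1 : StronglyMeasurable fun s ↦ u (t - s) := hu.comp_measurable (by fun_prop)
    exact stronglyMeasurable_schrodinger h h1
  · obtain ⟨M, hM⟩ := hb
    exact ⟨M, fun s ↦ by rw [norm_schrodinger]; exact hM _⟩

/-- `S(-t) S(s) = S(-(t-s))` turns the modulation projection into a convolution in time of the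
profile. -/
theorem profile_Qlow (hm : IsCutoff m) (hN : 0 < N) (hu : StronglyMeasurable u)
    (hb : ∃ M : ℝ, ∀ t, ‖u t‖ ≤ M) (t : ℝ) :
    profile (Qlow m N u) t = ∫ s, modKernel m N s • profile u (t - s) := by
  rw [profile, Qlow, schrodinger_eq_fourierMult,
    ← ContinuousLinearMap.integral_comp_comm _ (integrable_Qlow hm hN hu hb t)]
  refine integral_congr_ae (Filter.Eventually.of_forall fun s ↦ ?_)
  simp only [map_smul]
  rw [← schrodinger_eq_fourierMult, schrodinger_add, profile]
  congr 2
  ring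

theorem freqProj_Qlow (hm : IsCutoff m) (hN : 0 < N) (hu : StronglyMeasurable u)
    (hb : ∃ M : ℝ, ∀ t, ‖u t‖ ≤ M) {lam : ℝ} (hl : ∀ t, freqProj lam (u t) = u t) (t : ℝ) :
    freqProj lam (Qlow m N u t) = Qlow m N u t := by
  rw [Qlow, ← ContinuousLinearMap.integral_comp_comm _ (integrable_Qlow hm hN hu hb t)]
  refine integral_congr_ae (Filter.Eventually.of_forall fun s ↦ ?_)
  simp only [map_smul]
  rw [← schrodinger_freqProj, hl]

theorem freqProj_Qhigh (hm : IsCutoff m) (hN : 0 < N) (hu : StronglyMeasurable u)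
    (hb : ∃ M : ℝ, ∀ t, ‖u t‖ ≤ M) {lam : ℝ} (hl : ∀ t, freqProj lam (u t) = u t) (t : ℝ) :
    freqProj lam (Qhigh m N u t) = Qhigh m N u t := by
  rw [Qhigh, map_sub, hl, freqProj_Qlow hm hN hu hb hl]

theorem stronglyMeasurable_convolution {φ : ℝ → ℂ} (hφ : Continuous φ) {w : ℝ → L2}
    (hw : StronglyMeasurable w) : StronglyMeasurable fun t ↦ ∫ s, φ s • w (t - s) := by
  refine StronglyMeasurable.integral_prod_right (f := fun t s ↦ φ s • w (t - s)) ?_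
  refine StronglyMeasurable.smul (hφ.comp continuous_snd).stronglyMeasurable ?_
  exact hw.comp_measurable (by fun_prop)

theorem norm_convolution_le {φ : ℝ → ℂ} (hφ : Integrable φ) {w : ℝ → L2}
    {M : ℝ} (hM : ∀ t, ‖w t‖ ≤ M) (t : ℝ) : ‖∫ s, φ s • w (t - s)‖ ≤ (∫ s, ‖φ s‖) * M := by
  refine (norm_integral_le_of_norm_le (hφ.norm.mul_const M)
    (Filter.Eventually.of_forall fun s ↦ ?_)).trans (le_of_eq (integral_mul_const _ _))
  rw [norm_smul]
  exact mul_le_mul_of_nonneg_left (hM _) (norm_nonneg _)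

theorem stronglyMeasurable_Qlow (hm : IsCutoff m) (hN : 0 < N) (hu : StronglyMeasurable u)
    (hb : ∃ M : ℝ, ∀ t, ‖u t‖ ≤ M) : StronglyMeasurable (Qlow m N u) := by
  refine stronglyMeasurable_of_profile ?_
  have : profile (Qlow m N u) = fun t ↦ ∫ s, modKernel m N s • profile u (t - s) :=
    funext (profile_Qlow hm hN hu hb)
  rw [this]
  exact stronglyMeasurable_convolution (hm.continuous_modKernel hN) (stronglyMeasurable_profile hu)

/-- By Fubini the two kernels are convolved first, and `IsCutoff.integral_modKernel_mul` gives back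
the kernel at scale `N`. -/
theorem reproduce_convolution (hm : IsCutoff m) (hN : 0 < N) {w : ℝ → L2}
    (hw : StronglyMeasurable w) (hb : ∃ M : ℝ, ∀ t, ‖w t‖ ≤ M) (t : ℝ) :
    ∫ s, modKernel m (2 * N) s • ∫ r, modKernel m N r • w (t - s - r) =
      ∫ r, modKernel m N r • w (t - r) := by
  have hN2 : 0 < 2 * N := by positivity
  obtain ⟨M, hM⟩ := hb
  have h1 : ∀ s, ∫ r, modKernel m N r • w (t - s - r) = ∫ r, modKernel m N (r - s) • w (t - r) := by
    intro s
    rw [← integral_sub_right_eq_self (fun r ↦ modKernel m N r • w (t - s - r)) s]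
    refine integral_congr_ae (Filter.Eventually.of_forall fun r ↦ ?_)
    simp only
    congr 2
    ring
  have hI : Integrable (fun z : ℝ × ℝ ↦ (modKernel m (2 * N) z.2 * modKernel m N (z.1 - z.2)) •
      w (t - z.1)) (volume.prod volume) := by
    have h2 : Integrable (fun z : ℝ × ℝ ↦ modKernel m (2 * N) z.2 * modKernel m N (z.1 - z.2))
        (volume.prod volume) :=
      (hm.integrable_modKernel hN2).convolution_integrand (ContinuousLinearMap.mul ℂ ℂ)
        (hm.integrable_modKernel hN)
    refine h2.smul_bdd M ?_ (Filter.Eventually.of_forall fun z ↦ hM _)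
    exact (hw.comp_measurable (by fun_prop)).aestronglyMeasurable
  calc _ = ∫ s, ∫ r, (modKernel m (2 * N) s * modKernel m N (r - s)) • w (t - r) := by
        refine integral_congr_ae (Filter.Eventually.of_forall fun s ↦ ?_)
        simp only
        rw [h1, ← integral_smul]
        simp only [mul_smul]
    _ = ∫ r, ∫ s, (modKernel m (2 * N) s * modKernel m N (r - s)) • w (t - r) :=
        (integral_integral_swap hI).symm
    _ = _ := by
        refine integral_congr_ae (Filter.Eventually.of_forall fun r ↦ ?_)
        simp only
        rw [integral_smul_const, hm.integral_modKernel_mul hN]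

theorem reproduced_profile_Qlow (hm : IsCutoff m) (hN : 0 < N) (hu : StronglyMeasurable u)
    (hb : ∃ M : ℝ, ∀ t, ‖u t‖ ≤ M) : Reproduced m (2 * N) (profile (Qlow m N u)) := by
  have hb' : ∃ M : ℝ, ∀ t, ‖profile u t‖ ≤ M := by simpa only [norm_profile] using hb
  refine ⟨stronglyMeasurable_profile (stronglyMeasurable_Qlow hm hN hu hb), ?_, fun t ↦ ?_⟩
  · obtain ⟨M, hM⟩ := hb'
    refine ⟨(∫ s, ‖modKernel m N s‖) * M, fun t ↦ ?_⟩
    rw [profile_Qlow hm hN hu hb]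
    exact norm_convolution_le (hm.integrable_modKernel hN) hM t
  · simp only [profile_Qlow hm hN hu hb]
    exact (reproduce_convolution hm hN (stronglyMeasurable_profile hu) hb' t).symm

end

/-! ### Supremum and quadratic variation in the `V²` norm -/

theorem normV2_sq (G : ℝ → L2 → L2) (u : ℝ → L2) : normV2 G u ^ 2 =
    (⨆ t : ℝ, ‖u t‖ₑ) ^ 2 + ⨆ (n : ℕ) (τ : ℕ → ℝ) (_ : Monotone τ),
      ∑ k ∈ Finset.range n, ‖G (-τ k) (u (τ k)) - G (-τ (k + 1)) (u (τ (k + 1)))‖ₑ ^ 2 := by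
  rw [normV2, ← ENNReal.rpow_natCast, ← ENNReal.rpow_mul]
  norm_num

theorem enorm_le_normV2 (G : ℝ → L2 → L2) (u : ℝ → L2) (t : ℝ) : ‖u t‖ₑ ≤ normV2 G u := by
  refine (ENNReal.pow_le_pow_left_iff two_ne_zero).1 ?_
  rw [normV2_sq]
  exact (pow_le_pow_left₀ zero_le (le_iSup (fun t ↦ ‖u t‖ₑ) t) 2).trans le_self_add

theorem quadVar_profile (u : ℝ → L2) : QuadVar (profile u) (normV2 schrodinger u) := by
  intro n τ hτ
  rw [normV2_sq]
  refine le_trans ?_ le_add_self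
  exact le_iSup_of_le n (le_iSup_of_le τ (le_iSup_of_le hτ le_rfl))

/-! ### The grid -/

theorem iUnion_grid {c : ℝ} (hc : 0 < c) :
    (⋃ k : ℤ, Set.Ico ((k : ℝ) / c) (((k : ℝ) + 1) / c)) = Set.univ := by
  refine Set.eq_univ_of_forall fun x ↦ Set.mem_iUnion.2 ⟨⌊x * c⌋, ?_, ?_⟩
  · rw [div_le_iff₀ hc]; exact Int.floor_le _
  · rw [lt_div_iff₀ hc]; exact Int.lt_floor_add_one _

theorem volume_grid {c : ℝ} (k : ℤ) :
    volume (Set.Ico ((k : ℝ) / c) (((k : ℝ) + 1) / c)) = ENNReal.ofReal c⁻¹ := by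
  rw [Real.volume_Ico]
  congr 1
  ring

theorem lintegral_le_tsum_grid {c : ℝ} (hc : 0 < c) (f : ℝ → ℝ≥0∞) :
    ∫⁻ x, f x ≤ ∑' k : ℤ, ∫⁻ x in Set.Ico ((k : ℝ) / c) (((k : ℝ) + 1) / c), f x := by
  have := lintegral_iUnion_le (μ := volume)
    (fun k : ℤ ↦ Set.Ico ((k : ℝ) / c) (((k : ℝ) + 1) / c)) f
  rwa [iUnion_grid hc, Measure.restrict_univ] at this

theorem enorm_sq_spaceCut (a b : ℝ) (f : L2) :
    ‖spaceCut a b f‖ₑ ^ 2 = ∫⁻ x in Set.Ico a b, ‖f x‖ₑ ^ 2 := by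
  rw [spaceCut_eq_mulOp, enorm_sq_mulOp_indicator]

theorem rectCut_of_mem {lam : ℝ} {k : ℤ} {t : ℝ}
    (ht : t ∈ Set.Ico ((k : ℝ) / lam ^ 2) (((k : ℝ) + 1) / lam ^ 2)) (j : ℤ) (w : ℝ → L2) :
    rectCut lam k j w t = spaceCut (j / lam) ((j + 1) / lam) (w t) :=
  Set.indicator_of_mem ht _

/-- `R` stands for the `U²` or the `V²` norm: only its control of the supremum in time is used. -/
theorem enorm_sq_le_tsum_rectCut {lam : ℝ} (hl : 0 < lam) {R : (ℝ → L2) → ℝ≥0∞}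
    (hR : ∀ w t, ‖w t‖ₑ ≤ R w) (w : ℝ → L2) {k : ℤ} {t : ℝ}
    (ht : t ∈ Set.Ico ((k : ℝ) / lam ^ 2) (((k : ℝ) + 1) / lam ^ 2)) :
    ‖w t‖ₑ ^ 2 ≤ ∑' j : ℤ, R (rectCut lam k j w) ^ 2 := by
  rw [enorm_sq_eq_lintegral]
  refine (lintegral_le_tsum_grid hl _).trans (ENNReal.tsum_le_tsum fun j ↦ ?_)
  rw [← enorm_sq_spaceCut, ← rectCut_of_mem ht]
  exact pow_le_pow_left₀ zero_le (hR _ _) 2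

theorem enorm_sq_le_tsum_tsum_rectCut {lam : ℝ} (hl : 0 < lam) {R : (ℝ → L2) → ℝ≥0∞}
    (hR : ∀ w t, ‖w t‖ₑ ≤ R w) (w : ℝ → L2) (t : ℝ) :
    ‖w t‖ₑ ^ 2 ≤ ∑' (k : ℤ) (j : ℤ), R (rectCut lam k j w) ^ 2 := by
  have ht : t ∈ ⋃ k : ℤ, Set.Ico ((k : ℝ) / lam ^ 2) (((k : ℝ) + 1) / lam ^ 2) := by
    rw [iUnion_grid (by positivity)]; trivial
  obtain ⟨k, hk⟩ := Set.mem_iUnion.1 ht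
  exact (enorm_sq_le_tsum_rectCut hl hR w hk).trans
    (ENNReal.le_tsum (f := fun k : ℤ ↦ ∑' j : ℤ, R (rectCut lam k j w) ^ 2) k)

/-- The factor `lam⁻²` is the length of a time interval of the grid: high modulation yields
space-time `L²` bounds. -/
theorem lintegral_enorm_sq_le_tsum_rectCut {lam : ℝ} (hl : 0 < lam) {R : (ℝ → L2) → ℝ≥0∞}
    (hR : ∀ w t, ‖w t‖ₑ ≤ R w) (w : ℝ → L2) :
    ∫⁻ t, ‖w t‖ₑ ^ 2 ≤
      ENNReal.ofReal (lam ^ 2)⁻¹ * ∑' (k : ℤ) (j : ℤ), R (rectCut lam k j w) ^ 2 := by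
  refine (lintegral_le_tsum_grid (c := lam ^ 2) (by positivity) _).trans ?_
  rw [← ENNReal.tsum_mul_left]
  refine ENNReal.tsum_le_tsum fun k ↦ ?_
  refine (setLIntegral_mono' measurableSet_Ico fun t ht ↦
    enorm_sq_le_tsum_rectCut hl hR w ht).trans ?_
  rw [setLIntegral_const, volume_grid, mul_comm]

/-! ### Local Bernstein inequality -/

/-- The symbol at scale `2 lam` equals `1` on `freqSet lam`, so its kernel reproduces `f`. -/
theorem freqProj_ae_convolution {m : ℝ → ℝ} (hm : IsCutoff m) {lam : ℝ} (hl : 0 < lam) {f : L2}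
    (hf : freqProj lam f = f) :
    ∀ᵐ x, f x = ∫ y, modKernel m (2 * lam) (x - y) * f y := by
  have h1 := freqProj_ae hl.le f
  have h2 := fourier_freqProj_ae lam f
  rw [hf] at h1 h2
  filter_upwards [h1] with x hx
  obtain ⟨G, hG, hG'⟩ := hm.exists_kernel (N := 2 * lam) (by positivity) x
  have key := integral_schwartz_fourierInv_L2 G (𝓕 f : L2)
  rw [FourierTransform.fourierInv_fourier_eq] at key
  simp only [hG, smul_eq_mul] at key
  rw [hx, ← key, synthesis]
  refine integral_congr_ae ?_
  filter_upwards [h2] with ξ hξ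
  rw [hG', hξ, freqDensity]
  by_cases h : ξ ∈ freqSet lam
  · have : cutSymbol m (2 * lam) ξ = 1 := by
      rw [cutSymbol, hm.eq_one, Complex.ofReal_one]
      rw [abs_div, abs_of_pos (show 0 < 2 * lam by positivity), div_le_one (by positivity)]
      exact h.1
    rw [this, mul_one]
  · rw [Set.indicator_of_notMem h, mul_zero, mul_zero]

/-- Square summable weights on `ℤ`. -/
def gridWeight (d : ℤ) : ℝ≥0∞ := ENNReal.ofReal (1 / (1 + |(d : ℝ)|) ^ 2)

theorem tsum_gridWeight_ne_top : ∑' d, gridWeight d ≠ ⊤ := by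
  have h : Summable fun d : ℤ ↦ 1 / (1 + |(d : ℝ)|) ^ 2 := by
    have h1 : Summable fun n : ℕ ↦ 1 / (1 + |((n : ℤ) : ℝ)|) ^ 2 := by
      have := (summable_nat_add_iff 1).2 (Real.summable_one_div_nat_pow.2 one_lt_two)
      refine this.congr fun n ↦ ?_
      rw [Int.cast_natCast, Nat.abs_cast]
      push_cast
      rw [add_comm]
    refine Summable.of_nat_of_neg h1 (h1.congr fun n ↦ ?_)
    push_cast
    rw [abs_neg]
  have := h.tsum_ofReal_ne_top
  exact this

theorem one_add_le_of_mem_grid {lam : ℝ} (hl : 0 < lam) {i j : ℤ} {x y : ℝ}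
    (hx : x ∈ Set.Ico ((i : ℝ) / lam) (((i : ℝ) + 1) / lam))
    (hy : y ∈ Set.Ico ((j : ℝ) / lam) (((j : ℝ) + 1) / lam)) :
    1 + |((i - j : ℤ) : ℝ)| ≤ 2 * (1 + |2 * lam * (x - y)|) := by
  obtain ⟨hx1, hx2⟩ := hx
  obtain ⟨hy1, hy2⟩ := hy
  rw [div_le_iff₀ hl] at hx1 hy1
  rw [lt_div_iff₀ hl] at hx2 hy2
  have e : 2 * lam * (x - y) = 2 * (x * lam - y * lam) := by ring
  rw [e, abs_mul, abs_two]
  push_cast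
  have h0 := abs_nonneg (x * lam - y * lam)
  have h1 := le_abs_self (x * lam - y * lam)
  have h2 := neg_abs_le (x * lam - y * lam)
  rcases abs_cases ((i : ℝ) - j) with ⟨h, -⟩ | ⟨h, -⟩ <;> rw [h] <;> linarith

theorem enorm_modKernel_le_gridWeight {m : ℝ → ℝ} {D : ℝ} (hD : KernelBound m D) {lam : ℝ}
    (hl : 0 < lam) {i j : ℤ} {x y : ℝ}
    (hx : x ∈ Set.Ico ((i : ℝ) / lam) (((i : ℝ) + 1) / lam))
    (hy : y ∈ Set.Ico ((j : ℝ) / lam) (((j : ℝ) + 1) / lam)) :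
    ‖modKernel m (2 * lam) (x - y)‖ₑ ≤ ENNReal.ofReal (8 * D * lam) * gridWeight (i - j) := by
  have hD0 := hD.1
  rw [gridWeight, ← ENNReal.ofReal_mul (by positivity), ← ofReal_norm]
  refine ENNReal.ofReal_le_ofReal (((hD.2 (2 * lam) (by positivity)).1 _).trans ?_)
  have h := one_add_le_of_mem_grid hl hx hy
  set X := |2 * lam * (x - y)| with hX
  have hX0 : 0 ≤ X := abs_nonneg _
  set d := |((i - j : ℤ) : ℝ)| with hd
  have hd0 : 0 ≤ d := abs_nonneg _
  have h2 : (1 + d) ^ 2 ≤ 4 * (1 + X) ^ 2 := by nlinarith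
  have h3 : (1 + X) ^ 2 ≤ (1 + X) ^ 4 := pow_le_pow_right₀ (by linarith) (by norm_num)
  rw [mul_one_div, div_le_div_iff₀ (by positivity) (by positivity)]
  have h4 : (1 + d) ^ 2 ≤ 4 * (1 + X) ^ 4 := by linarith
  calc D * (2 * lam) * (1 + d) ^ 2 ≤ D * (2 * lam) * (4 * (1 + X) ^ 4) :=
        mul_le_mul_of_nonneg_left h4 (by positivity)
    _ = _ := by ring

theorem lintegral_grid_le {lam : ℝ} (hl : 0 < lam) (j : ℤ) (f : L2) :
    ∫⁻ y in Set.Ico ((j : ℝ) / lam) (((j : ℝ) + 1) / lam), ‖f y‖ₑ ≤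
      invSqrt lam * ‖spaceCut (j / lam) ((j + 1) / lam) f‖ₑ := by
  refine (ENNReal.pow_le_pow_left_iff two_ne_zero).1 ?_
  rw [mul_pow, invSqrt_sq hl, enorm_sq_spaceCut, ← volume_grid (c := lam) j]
  have := lintegral_mul_sq_le
    (ν := volume.restrict (Set.Ico ((j : ℝ) / lam) (((j : ℝ) + 1) / lam)))
    (f := fun _ ↦ 1) (g := fun y ↦ ‖f y‖ₑ) aemeasurable_const
    (Lp.aestronglyMeasurable f).enorm.restrict
  simpa using this

/-- Pointwise bound of a frequency localized function on an interval of the dual length. -/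
theorem local_bernstein {m : ℝ → ℝ} (hm : IsCutoff m) {D : ℝ} (hD : KernelBound m D) {lam : ℝ}
    (hl : 0 < lam) {f : L2} (hf : freqProj lam f = f) :
    ∀ᵐ x, ∀ i : ℤ, x ∈ Set.Ico ((i : ℝ) / lam) (((i : ℝ) + 1) / lam) →
      ‖f x‖ₑ ≤ ENNReal.ofReal (8 * D * lam) * invSqrt lam *
        ∑' j : ℤ, gridWeight (i - j) * ‖spaceCut (j / lam) ((j + 1) / lam) f‖ₑ := by
  filter_upwards [freqProj_ae_convolution hm hl hf] with x hx i hi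
  rw [hx, ← ENNReal.tsum_mul_left]
  refine (enorm_integral_le_lintegral_enorm _).trans ((lintegral_le_tsum_grid hl _).trans
    (ENNReal.tsum_le_tsum fun j ↦ ?_))
  calc _ ≤ ∫⁻ y in Set.Ico ((j : ℝ) / lam) (((j : ℝ) + 1) / lam),
        (ENNReal.ofReal (8 * D * lam) * gridWeight (i - j)) * ‖f y‖ₑ := by
        refine setLIntegral_mono' measurableSet_Ico fun y hy ↦ ?_
        rw [enorm_mul]
        exact mul_le_mul' (enorm_modKernel_le_gridWeight hD hl hi hy) le_rfl
    _ ≤ (ENNReal.ofReal (8 * D * lam) * gridWeight (i - j)) *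
        (invSqrt lam * ‖spaceCut (j / lam) ((j + 1) / lam) f‖ₑ) := by
        have hne : ENNReal.ofReal (8 * D * lam) * gridWeight (i - j) ≠ ⊤ :=
          ENNReal.mul_ne_top ENNReal.ofReal_ne_top ENNReal.ofReal_ne_top
        rw [lintegral_const_mul' _ _ hne]
        exact mul_le_mul' le_rfl (lintegral_grid_le hl j f)
    _ = _ := by ring

/-- Young's inequality for `ℓ¹ * ℓ²`, from weighted Cauchy–Schwarz with counting measure. -/
theorem tsum_convolution_sq_le (ρ A : ℤ → ℝ≥0∞) :
    ∑' i, (∑' j, ρ (i - j) * A j) ^ 2 ≤ (∑' d, ρ d) ^ 2 * ∑' j, A j ^ 2 := by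
  have h1 : ∀ i, ∑' j, ρ (i - j) = ∑' d, ρ d := fun i ↦ (Equiv.subLeft i).tsum_eq ρ
  have h2 : ∀ j, ∑' i, ρ (i - j) = ∑' d, ρ d := fun j ↦ (Equiv.subRight j).tsum_eq ρ
  calc _ ≤ ∑' i, (∑' d, ρ d) * ∑' j, ρ (i - j) * A j ^ 2 := by
        refine ENNReal.tsum_le_tsum fun i ↦ ?_
        have := lintegral_mul_sq_le (ν := (Measure.count : Measure ℤ)) (f := fun j ↦ ρ (i - j))
          (g := A) (measurable_of_countable _).aemeasurable (measurable_of_countable _).aemeasurable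
        simpa only [lintegral_count, h1] using this
    _ = (∑' d, ρ d) * ∑' (j : ℤ) (i : ℤ), ρ (i - j) * A j ^ 2 := by
        rw [ENNReal.tsum_mul_left, ENNReal.tsum_comm]
    _ = _ := by
        simp only [ENNReal.tsum_mul_right, h2]
        rw [ENNReal.tsum_mul_left]
        ring

/-! ### The product of a high modulation with a low modulation function -/

theorem enorm_sq_freqMul_le {lam : ℝ} (hl : 0 < lam) {f g : L2} (hf : freqProj lam f = f)
    {B : ℤ → ℝ≥0∞} (hB : ∀ᵐ x, ∀ i : ℤ,
      x ∈ Set.Ico ((i : ℝ) / lam) (((i : ℝ) + 1) / lam) → ‖f x‖ₑ ≤ B i) :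
    ‖freqMul hl.le f g‖ₑ ^ 2 ≤
      ∑' i : ℤ, B i ^ 2 * ‖spaceCut (i / lam) ((i + 1) / lam) g‖ₑ ^ 2 := by
  rw [enorm_sq_eq_lintegral]
  refine (lintegral_le_tsum_grid hl _).trans (ENNReal.tsum_le_tsum fun i ↦ ?_)
  rw [enorm_sq_spaceCut, ← lintegral_const_mul'' _
    ((Lp.aestronglyMeasurable g).enorm.pow_const 2).restrict]
  refine lintegral_mono_ae ?_
  filter_upwards [ae_restrict_mem measurableSet_Ico, ae_restrict_of_ae hB,
    ae_restrict_of_ae (coeFn_freqMul hl.le f g)] with x hx h1 h2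
  rw [h2, hf, enorm_mul, mul_pow]
  exact mul_le_mul' (pow_le_pow_left₀ zero_le (h1 i hx) 2) le_rfl

/-- On each grid time interval `w` is replaced on each strip by its Bernstein bound, constant there
in time and space. The remaining integral of `v` over the strip is bounded by local smoothing over
all times, so the summability in `k` comes from `w` alone. -/
theorem lintegral_freqMul_high_low_le {m : ℝ → ℝ} (hm : IsCutoff m) {D : ℝ} (hD : KernelBound m D)
    {lam mu : ℝ} (hl : 0 < lam) (h1 : mu ≠ 1) (h0 : 0 < mu) {w v : ℝ → L2}
    (hw : ∀ t, freqProj lam (w t) = w t) (hv : StronglyMeasurable v)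
    (hv' : ∀ t, freqProj mu (v t) = v t) {R : (ℝ → L2) → ℝ≥0∞} (hR : ∀ w t, ‖w t‖ₑ ≤ R w) :
    ∫⁻ t, ‖freqMul hl.le (w t) (v t)‖ₑ ^ 2 ≤
      (ENNReal.ofReal (16 * D) * (∑' d, gridWeight d) * invSqrt mu * normU2 schrodinger v) ^ 2 *
        ∑' (k : ℤ) (j : ℤ), R (rectCut lam k j w) ^ 2 := by
  have hD0 := hD.1
  set c : ℝ≥0∞ := ENNReal.ofReal (8 * D * lam) * invSqrt lam with hc
  set S : ℝ≥0∞ := 2 * invSqrt lam * invSqrt mu * normU2 schrodinger v with hS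
  let A : ℤ → ℤ → ℝ≥0∞ := fun k j ↦ R (rectCut lam k j w)
  let B : ℤ → ℤ → ℝ≥0∞ := fun k i ↦ c * ∑' j : ℤ, gridWeight (i - j) * A k j
  have hsm : ∀ i : ℤ, Measurable fun t ↦ ‖spaceCut (i / lam) ((i + 1) / lam) (v t)‖ₑ ^ 2 := fun i ↦ by
    simp only [spaceCut_eq_mulOp]
    exact ((ContinuousLinearMap.continuous _).comp_stronglyMeasurable hv).enorm.pow_const 2
  have hsmooth : ∀ i : ℤ, ∫⁻ t, ‖spaceCut (i / lam) ((i + 1) / lam) (v t)‖ₑ ^ 2 ≤ S ^ 2 := by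
    intro i
    have hT := freeBound_indicator h1 h0 (Set.Ico ((i : ℝ) / lam) (((i : ℝ) + 1) / lam))
      measurableSet_Ico (r := invSqrt lam) (by rw [volume_grid, invSqrt_sq hl])
    have h2 := hT.normU2_le (mul_ne_zero (mul_ne_zero two_ne_zero (invSqrt_ne_zero hl))
      (invSqrt_ne_zero h0)) (ENNReal.mul_ne_top (ENNReal.mul_ne_top ENNReal.ofNat_ne_top
      (invSqrt_ne_top lam)) (invSqrt_ne_top mu)) v
    have h3 := pow_le_pow_left₀ zero_le h2 2
    rw [eLpNorm_two_sq] at h3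
    refine le_trans (le_of_eq (lintegral_congr fun t ↦ ?_)) h3
    rw [ContinuousLinearMap.comp_apply, hv', spaceCut_eq_mulOp]
  have hpoint : ∀ k : ℤ, ∀ t ∈ Set.Ico ((k : ℝ) / lam ^ 2) (((k : ℝ) + 1) / lam ^ 2),
      ‖freqMul hl.le (w t) (v t)‖ₑ ^ 2 ≤
        ∑' i : ℤ, B k i ^ 2 * ‖spaceCut (i / lam) ((i + 1) / lam) (v t)‖ₑ ^ 2 := by
    intro k t ht
    refine enorm_sq_freqMul_le hl (hw t) ?_
    filter_upwards [local_bernstein hm hD hl (hw t)] with x hx i hi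
    refine (hx i hi).trans (mul_le_mul' le_rfl (ENNReal.tsum_le_tsum fun j ↦ mul_le_mul' le_rfl ?_))
    rw [← rectCut_of_mem ht]
    exact hR _ _
  calc _ ≤ ∑' k : ℤ, ∫⁻ t in Set.Ico ((k : ℝ) / lam ^ 2) (((k : ℝ) + 1) / lam ^ 2),
        ∑' i : ℤ, B k i ^ 2 * ‖spaceCut (i / lam) ((i + 1) / lam) (v t)‖ₑ ^ 2 :=
        (lintegral_le_tsum_grid (c := lam ^ 2) (by positivity) _).trans
          (ENNReal.tsum_le_tsum fun k ↦ setLIntegral_mono' measurableSet_Ico (hpoint k))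
    _ ≤ ∑' (k : ℤ) (i : ℤ), B k i ^ 2 * S ^ 2 := by
        refine ENNReal.tsum_le_tsum fun k ↦ ?_
        rw [lintegral_tsum fun i ↦ ((hsm i).const_mul _).aemeasurable]
        refine ENNReal.tsum_le_tsum fun i ↦ ?_
        rw [lintegral_const_mul _ (hsm i)]
        exact mul_le_mul' le_rfl ((lintegral_mono' Measure.restrict_le_self le_rfl).trans (hsmooth i))
    _ ≤ ∑' k : ℤ, S ^ 2 * (c ^ 2 * ((∑' d, gridWeight d) ^ 2 * ∑' j : ℤ, A k j ^ 2)) := by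
        refine ENNReal.tsum_le_tsum fun k ↦ ?_
        rw [ENNReal.tsum_mul_right, mul_comm]
        refine mul_le_mul' le_rfl ?_
        simp only [B, mul_pow]
        rw [ENNReal.tsum_mul_left]
        exact mul_le_mul' le_rfl (tsum_convolution_sq_le gridWeight (A k))
    _ = (c * invSqrt lam * 2 * (∑' d, gridWeight d) * invSqrt mu * normU2 schrodinger v) ^ 2 *
        ∑' (k : ℤ) (j : ℤ), A k j ^ 2 := by
        simp only [← mul_assoc]
        rw [ENNReal.tsum_mul_left, hS]
        ring
    _ = _ := by
        -- The powers of `lam` cancel: Bernstein costs `lam^(1/2)`, and smoothing on a strip of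
        -- width `lam⁻¹` gains `lam^(-1/2)`.
        have : c * invSqrt lam * 2 = ENNReal.ofReal (16 * D) := by
          rw [hc, mul_assoc (ENNReal.ofReal _), ← pow_two, invSqrt_sq hl,
            ← ENNReal.ofReal_mul (by positivity), ← ENNReal.ofReal_ofNat 2,
            ← ENNReal.ofReal_mul (by positivity)]
          congr 1
          field_simp
          norm_num
        rw [this]

/-! ### The bilinear estimate -/

theorem rpow_half_sq (x : ℝ≥0∞) : (x ^ (1 / 2 : ℝ)) ^ 2 = x := by
  rw [← ENNReal.rpow_natCast, ← ENNReal.rpow_mul]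
  norm_num

theorem normU2_le_normU2At (m : ℝ → ℝ) (lam : ℝ) (u : ℝ → L2) :
    normU2 schrodinger (Qlow m (lam ^ 2) u) ≤ normU2At m lam u := by
  refine (ENNReal.pow_le_pow_left_iff two_ne_zero).1 ?_
  rw [normU2At, rpow_half_sq]
  exact le_self_add

theorem normV2_le_normV2At (m : ℝ → ℝ) (lam : ℝ) (u : ℝ → L2) :
    normV2 schrodinger (Qlow m (lam ^ 2) u) ≤ normV2At m lam u := by
  refine (ENNReal.pow_le_pow_left_iff two_ne_zero).1 ?_
  rw [normV2At, rpow_half_sq]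
  exact le_self_add

theorem tsum_le_normU2At_sq (m : ℝ → ℝ) (lam : ℝ) (u : ℝ → L2) :
    ∑' (k : ℤ) (j : ℤ), normU2 trivialFlow (rectCut lam k j (Qhigh m (lam ^ 2) u)) ^ 2 ≤
      normU2At m lam u ^ 2 := by
  rw [normU2At, rpow_half_sq]
  exact le_add_self

theorem tsum_le_normV2At_sq (m : ℝ → ℝ) (lam : ℝ) (u : ℝ → L2) :
    ∑' (k : ℤ) (j : ℤ), normV2 trivialFlow (rectCut lam k j (Qhigh m (lam ^ 2) u)) ^ 2 ≤
      normV2At m lam u ^ 2 := by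
  rw [normV2At, rpow_half_sq]
  exact le_add_self

theorem enorm_le_normV2At (m : ℝ → ℝ) {lam : ℝ} (hl : 0 < lam) (u : ℝ → L2) (t : ℝ) :
    ‖u t‖ₑ ≤ 2 * normV2At m lam u := by
  have h1 : ‖Qlow m (lam ^ 2) u t‖ₑ ≤ normV2At m lam u :=
    (enorm_le_normV2 schrodinger _ t).trans (normV2_le_normV2At m lam u)
  have h2 : ‖Qhigh m (lam ^ 2) u t‖ₑ ≤ normV2At m lam u :=
    (ENNReal.pow_le_pow_left_iff two_ne_zero).1
      ((enorm_sq_le_tsum_tsum_rectCut hl (enorm_le_normV2 trivialFlow) _ t).trans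
        (tsum_le_normV2At_sq m lam u))
  have h3 : u t = Qlow m (lam ^ 2) u t + Qhigh m (lam ^ 2) u t := by
    rw [Qhigh, add_sub_cancel]
  rw [h3, two_mul]
  exact (enorm_add_le _ _).trans (add_le_add h1 h2)

/-- Two points of an order connected set of measure `1` are at most `1` apart, so `a = sInf I`
works. -/
theorem exists_subset_Icc {I : Set ℝ} (hI : I.OrdConnected) (h1 : volume I = 1) :
    ∃ a, I ⊆ Set.Icc a (a + 1) := by
  have h : ∀ x ∈ I, ∀ y ∈ I, y - 1 ≤ x := by
    intro x hx y hy
    have h2 := measure_mono (μ := volume) (hI.out hx hy)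
    rw [h1, Real.volume_Icc, ← ENNReal.ofReal_one,
      ENNReal.ofReal_le_ofReal_iff zero_le_one] at h2
    linarith
  refine ⟨sInf I, fun y hy ↦ ⟨csInf_le ⟨y - 1, fun x hx ↦ h x hx y hy⟩ hy, ?_⟩⟩
  have := le_csInf ⟨y, hy⟩ fun x hx ↦ h x hx y hy
  linarith

/-! ### The three products of the modulation decomposition -/

section

variable {m : ℝ → ℝ} {D lam mu : ℝ} {I : Set ℝ} {u v : ℝ → L2}

theorem AtFrequency.freqProj_eq (h : AtFrequency lam u) (t : ℝ) : freqProj lam (u t) = u t :=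
  (h.localized t).freqProj_eq

theorem AtFrequency.stronglyMeasurable (h : AtFrequency lam u) : StronglyMeasurable u :=
  stronglyMeasurable_of_right_continuous h.right_continuous

theorem AtFrequency.stronglyMeasurable_Qlow (hm : IsCutoff m) (hl : 0 < lam)
    (h : AtFrequency lam u) : StronglyMeasurable (Qlow m (lam ^ 2) u) :=
  NLS.stronglyMeasurable_Qlow hm (by positivity) h.stronglyMeasurable h.bounded

theorem eLpNorm_low_low_le (hm : IsCutoff m) (hD : KernelBound m D) (hl : 0 < lam) (h0 : 0 < mu)
    (h1 : mu ≠ 1) (hlm : 8 * lam ≤ mu) {p : ℕ} (hp : lam = 2 ^ p) (hI : I.OrdConnected)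
    (hI1 : volume I = 1) (hu : AtFrequency lam u) (hv : AtFrequency mu v) :
    eLpNorm (fun t ↦ freqMul hl.le (Qlow m (lam ^ 2) u t) (Qlow m (mu ^ 2) v t)) 2
        (volume.restrict I) ≤
      2 * ENNReal.ofReal (1 + 2 * p + 4 * (D * Real.pi)) *
        (invSqrt mu * normV2At m lam u * normU2At m mu v) := by
  obtain ⟨a, ha⟩ := exists_subset_Icc hI hI1
  have hT := freeBound_freqMul_left hl.le h0 h1 hlm
    (hv.stronglyMeasurable_Qlow hm h0).aestronglyMeasurable
  have hsup : ∀ t, ‖profile (Qlow m (lam ^ 2) u) t‖ₑ ≤ normV2 schrodinger (Qlow m (lam ^ 2) u) :=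
    fun t ↦ by
      rw [← ofReal_norm, norm_profile, ofReal_norm]
      exact enorm_le_normV2 _ _ t
  have hw : Reproduced m (2 * (2 ^ p) ^ 2) (profile (Qlow m (lam ^ 2) u)) := by
    rw [← hp]
    exact reproduced_profile_Qlow hm (by positivity) hu.stronglyMeasurable hu.bounded
  have key := hT.logarithmic_loss hm hD (quadVar_profile _) hsup p hw a
  rw [Measure.restrict_congr_set Ico_ae_eq_Icc] at key
  have e : (fun t ↦ (freqMul hl.le).flip (freqProj mu (Qlow m (mu ^ 2) v t))
        (schrodinger t (profile (Qlow m (lam ^ 2) u) t))) =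
      fun t ↦ freqMul hl.le (Qlow m (lam ^ 2) u t) (Qlow m (mu ^ 2) v t) := by
    funext t
    rw [schrodinger_profile, freqProj_Qlow hm (by positivity) hv.stronglyMeasurable hv.bounded
      hv.freqProj_eq, ContinuousLinearMap.flip_apply]
  rw [e] at key
  refine (eLpNorm_mono_measure _ (Measure.restrict_mono ha le_rfl)).trans (key.trans ?_)
  calc _ = 2 * ENNReal.ofReal (1 + 2 * p + 4 * (D * Real.pi)) *
        (invSqrt mu * normV2 schrodinger (Qlow m (lam ^ 2) u) *
          normU2 schrodinger (Qlow m (mu ^ 2) v)) := by ring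
    _ ≤ _ := mul_le_mul' le_rfl (mul_le_mul' (mul_le_mul' le_rfl (normV2_le_normV2At m lam u))
        (normU2_le_normU2At m mu v))

theorem eLpNorm_high_low_le (hm : IsCutoff m) (hD : KernelBound m D) (hl : 0 < lam) (h0 : 0 < mu)
    (h1 : mu ≠ 1) (hu : AtFrequency lam u) (hv : AtFrequency mu v) :
    eLpNorm (fun t ↦ freqMul hl.le (Qhigh m (lam ^ 2) u t) (Qlow m (mu ^ 2) v t)) 2 volume ≤
      ENNReal.ofReal (16 * D) * (∑' d, gridWeight d) *
        (invSqrt mu * normV2At m lam u * normU2At m mu v) := by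
  have key := lintegral_freqMul_high_low_le hm hD hl h1 h0
    (freqProj_Qhigh hm (N := lam ^ 2) (by positivity) hu.stronglyMeasurable hu.bounded hu.freqProj_eq)
    (hv.stronglyMeasurable_Qlow hm h0)
    (freqProj_Qlow hm (N := mu ^ 2) (by positivity) hv.stronglyMeasurable hv.bounded hv.freqProj_eq)
    (enorm_le_normV2 trivialFlow)
  refine (ENNReal.pow_le_pow_left_iff two_ne_zero).1 ?_
  rw [eLpNorm_two_sq]
  refine key.trans ((mul_le_mul' (pow_le_pow_left₀ zero_le (mul_le_mul' le_rfl
    (normU2_le_normU2At m mu v)) 2) (tsum_le_normV2At_sq m lam u)).trans (le_of_eq ?_))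
  ring

/-- Bernstein for `u` costs `lam^(1/2)` and the high modulation of `v` gains `mu⁻¹`; `lam ≤ mu`
leaves `mu^(-1/2)`. -/
theorem eLpNorm_right_high_le (hm : IsCutoff m) (hl : 0 < lam) (h0 : 0 < mu)
    (hlm : lam ≤ mu) (hv : AtFrequency mu v) :
    eLpNorm (fun t ↦ freqMul hl.le (u t) (Qhigh m (mu ^ 2) v t)) 2 volume ≤
      2 * (invSqrt mu * normV2At m lam u * normU2At m mu v) := by
  have hmeas : Measurable fun t ↦ ‖Qhigh m (mu ^ 2) v t‖ₑ ^ 2 :=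
    (hv.stronglyMeasurable.sub (hv.stronglyMeasurable_Qlow hm h0)).enorm.pow_const 2
  have hmod : ∫⁻ t, ‖Qhigh m (mu ^ 2) v t‖ₑ ^ 2 ≤
      ENNReal.ofReal (mu ^ 2)⁻¹ * normU2At m mu v ^ 2 :=
    (lintegral_enorm_sq_le_tsum_rectCut h0 (enorm_le_normU2 (G := trivialFlow) fun _ _ ↦ rfl) _).trans
      (mul_le_mul' le_rfl (tsum_le_normU2At_sq m mu v))
  have hc : ENNReal.ofReal (lam ^ (1 / 2 : ℝ)) ^ 2 * ENNReal.ofReal (mu ^ 2)⁻¹ ≤ invSqrt mu ^ 2 := by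
    rw [invSqrt_sq h0, ← ENNReal.ofReal_pow (by positivity), ← Real.rpow_natCast,
      ← Real.rpow_mul hl.le, ← ENNReal.ofReal_mul (by positivity)]
    refine ENNReal.ofReal_le_ofReal ?_
    norm_num
    rw [← div_eq_mul_inv, ← one_div, div_le_div_iff₀ (by positivity) h0]
    nlinarith
  refine (ENNReal.pow_le_pow_left_iff two_ne_zero).1 ?_
  rw [eLpNorm_two_sq]
  calc _ ≤ ∫⁻ t, (ENNReal.ofReal (lam ^ (1 / 2 : ℝ)) * (2 * normV2At m lam u)) ^ 2 *
        ‖Qhigh m (mu ^ 2) v t‖ₑ ^ 2 := by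
        refine lintegral_mono fun t ↦ ?_
        rw [← mul_pow]
        exact pow_le_pow_left₀ zero_le ((enorm_freqMul_le hl.le _ _).trans
          (mul_le_mul' (mul_le_mul' le_rfl (enorm_le_normV2At m hl u t)) le_rfl)) 2
    _ ≤ (ENNReal.ofReal (lam ^ (1 / 2 : ℝ)) * (2 * normV2At m lam u)) ^ 2 *
        (ENNReal.ofReal (mu ^ 2)⁻¹ * normU2At m mu v ^ 2) := by
        rw [lintegral_const_mul _ hmeas]
        exact mul_le_mul' le_rfl hmod
    _ = (ENNReal.ofReal (lam ^ (1 / 2 : ℝ)) ^ 2 * ENNReal.ofReal (mu ^ 2)⁻¹) *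
        (2 * normV2At m lam u * normU2At m mu v) ^ 2 := by ring
    _ ≤ invSqrt mu ^ 2 * (2 * normV2At m lam u * normU2At m mu v) ^ 2 := mul_le_mul' hc le_rfl
    _ = _ := by ring

theorem normL2Prod_le (hm : IsCutoff m) (hD : KernelBound m D) (hl : 0 < lam) (h0 : 0 < mu)
    (h1 : mu ≠ 1) (hlm : 8 * lam ≤ mu) {p : ℕ} (hp : lam = 2 ^ p) (hI : I.OrdConnected)
    (hI1 : volume I = 1) (hu : AtFrequency lam u) (hv : AtFrequency mu v) :
    normL2Prod I u v ≤ (2 * ENNReal.ofReal (1 + 2 * p + 4 * (D * Real.pi)) +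
      ENNReal.ofReal (16 * D) * (∑' d, gridWeight d) + 2) *
        (invSqrt mu * normV2At m lam u * normU2At m mu v) := by
  have hul := (hu.stronglyMeasurable_Qlow hm hl).aestronglyMeasurable (μ := volume.restrict I)
  have hvl := (hv.stronglyMeasurable_Qlow hm h0).aestronglyMeasurable (μ := volume.restrict I)
  have hum := hu.stronglyMeasurable.aestronglyMeasurable (μ := volume.restrict I)
  have hvm := hv.stronglyMeasurable.aestronglyMeasurable (μ := volume.restrict I)
  have hm1 : AEStronglyMeasurable (fun t ↦ freqMul hl.le (Qlow m (lam ^ 2) u t)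
      (Qlow m (mu ^ 2) v t)) (volume.restrict I) :=
    (freqMul hl.le).aestronglyMeasurable_comp₂ hul hvl
  have hm2 : AEStronglyMeasurable (fun t ↦ freqMul hl.le (Qhigh m (lam ^ 2) u t)
      (Qlow m (mu ^ 2) v t)) (volume.restrict I) :=
    (freqMul hl.le).aestronglyMeasurable_comp₂ (hum.sub hul) hvl
  have hm3 : AEStronglyMeasurable (fun t ↦ freqMul hl.le (u t)
      (Qhigh m (mu ^ 2) v t)) (volume.restrict I) :=
    (freqMul hl.le).aestronglyMeasurable_comp₂ hum (hvm.sub hvl)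
  have e : (fun t ↦ freqMul hl.le (u t) (v t)) =
      (fun t ↦ freqMul hl.le (Qlow m (lam ^ 2) u t) (Qlow m (mu ^ 2) v t)) +
        (fun t ↦ freqMul hl.le (Qhigh m (lam ^ 2) u t) (Qlow m (mu ^ 2) v t)) +
        fun t ↦ freqMul hl.le (u t) (Qhigh m (mu ^ 2) v t) := by
    funext t
    simp only [Pi.add_apply]
    rw [← add_apply, ← map_add, Qhigh, Qhigh, add_sub_cancel, ← map_add,
      add_sub_cancel]
  rw [normL2Prod_eq_eLpNorm hl.le I u v hu.localized, e, add_mul, add_mul]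
  refine (eLpNorm_add_le (hm1.add hm2) hm3 one_le_two).trans (add_le_add
    ((eLpNorm_add_le hm1 hm2 one_le_two).trans (add_le_add ?_ ?_)) ?_)
  · exact eLpNorm_low_low_le hm hD hl h0 h1 hlm hp hI hI1 hu hv
  · exact (eLpNorm_mono_measure _ Measure.restrict_le_self).trans
      (eLpNorm_high_low_le hm hD hl h0 h1 hu hv)
  · exact (eLpNorm_mono_measure _ Measure.restrict_le_self).trans
      (eLpNorm_right_high_le hm hl h0 (by linarith) hv)

end

end NLS

end

/-! ### Choice of the constants -/

theorem mainTheorem9 (m : ℝ → ℝ) (hm : NLS.IsCutoff m) :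
    ∃ (K : ℝ) (C : ℝ≥0), ∀ (p q : ℕ) (lam mu : ℝ), lam = 2 ^ p → mu = 2 ^ q → K * lam ≤ mu →
      ∀ I : Set ℝ, I.OrdConnected → volume I = 1 →
      ∀ u v : ℝ → NLS.L2, NLS.AtFrequency lam u → NLS.AtFrequency mu v →
        NLS.normL2Prod I u v ≤
          C * ENNReal.ofReal (mu ^ (-(1 / 2 : ℝ)) * Real.log (1 + lam)) *
            NLS.normV2At m lam u * NLS.normU2At m mu v := by
  obtain ⟨D, hD⟩ := hm.exists_decay
  set W : ℝ≥0∞ := ENNReal.ofReal (16 * D) * ∑' d, NLS.gridWeight d with hW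
  have hWt : W ≠ ⊤ := ENNReal.mul_ne_top ENNReal.ofReal_ne_top NLS.tsum_gridWeight_ne_top
  have hD0 := hD.1
  have hW0 : 0 ≤ W.toReal := ENNReal.toReal_nonneg
  -- `2 (1 + 2p + c)` dominates the sum of the three constants: the term `1` in `c` accounts for the
  -- last summand `2`.
  set c : ℝ := 4 * (D * Real.pi) + W.toReal + 1 with hc
  have hc0 : 0 ≤ c := by positivity
  -- `8` is the frequency separation used in `map_pairPhase_le`; since `lam ≥ 1`, it also forces `mu
  -- ≠ 1`.
  refine ⟨8, Real.toNNReal (2 * ((3 + c) / Real.log 2)), ?_⟩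
  intro p q lam mu hlam hmu hK I hI hI1 u v hu hv
  have hl1 : 1 ≤ lam := by
    rw [hlam]
    exact one_le_pow₀ one_le_two
  have hl : 0 < lam := by linarith
  have h0 : 0 < mu := by linarith
  have h1 : mu ≠ 1 := by
    intro h
    linarith
  refine (NLS.normL2Prod_le hm hD hl h0 h1 hK hlam hI hI1 hu hv).trans ?_
  have hlog := NLS.log_loss_le hc0 p
  rw [← hlam] at hlog
  have hlog0 : 0 ≤ Real.log (1 + lam) := Real.log_nonneg (by linarith)
  have key : 2 * ENNReal.ofReal (1 + 2 * p + 4 * (D * Real.pi)) + W + 2 ≤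
      ENNReal.ofReal (2 * ((3 + c) / Real.log 2)) * ENNReal.ofReal (Real.log (1 + lam)) := by
    rw [← ENNReal.ofReal_toReal hWt, ← ENNReal.ofReal_ofNat 2, ← ENNReal.ofReal_mul zero_le_two,
      ← ENNReal.ofReal_add (by positivity) hW0,
      ← ENNReal.ofReal_add (by positivity) zero_le_two, ← ENNReal.ofReal_mul' hlog0]
    refine ENNReal.ofReal_le_ofReal ?_
    linarith
  refine (mul_le_mul' key le_rfl).trans (le_of_eq ?_)
  have e : ENNReal.ofReal (mu ^ (-(1 / 2 : ℝ)) * Real.log (1 + lam)) =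
      NLS.invSqrt mu * ENNReal.ofReal (Real.log (1 + lam)) := by
    rw [ENNReal.ofReal_mul (by positivity), NLS.invSqrt]
  rw [e, ← ENNReal.ofReal]
  ring
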